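/- **Conventions.** 2-categories, 2-functors, 2-natural transformations, 2-monads, their algebras, and (co)limits are all strict. A 2-category $K$ is *infinitely distributive* if it has finite products and small coproducts, in the strict 2-dimensional sense (the universal property is an isomorphism of hom-categories), and the products distribute over the coproducts, i.e. $A\times-$ preserves small coproducts for every $A$. An *operad* $P$ in $K$ is a non-symmetric operad, with respect to finite products, in the underlying 1-category of $K$. A *$K$-graph* $X$ is a (small) set of objects $X_0$ with an object $X(a,b)$ of $K$ for all $a,b\in X_0$; a morphism $F\colon X\to Y$ is a function $F\colon X_0\to Y_0$ with 1-cells $F_{ab}\colon X(a,b)\to Y(Fa,Fb)$; a 2-cell $\alpha\colon F\Rightarrow G$ exists only if $F$ and $G$ agree on objects, and is then a family of 2-cells $\alpha_{ab}\colon F_{ab}\Rightarrow G_{ab}$ of $K$. These form a 2-category $K\text{-}\mathbf{Gph}$. A *$(K,P)$-category* is a $K$-graph $X$ with composition 1-cells $m\colon P(k)\times X(x_{k-1},x_k)\times\cdots\times X(x_0,x_1)\to X(x_0,x_k)$ for all $k\ge 0$ and $x_0,\dots,x_k\in X_0$, compatible with the unit and composition of $P$. A *strict $(K,P)$-functor*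 is a graph morphism commuting with these 1-cells. A *$(K,P)$-icon* $\alpha\colon F\Rightarrow G$ between strict functors $X\to Y$ is a 2-cell of $K$-graphs such that $\alpha_{x_0x_k}$ whiskered with the composition $m$ of $X$ equals $1\times\alpha_{x_{k-1}x_k}\times\cdots\times\alpha_{x_0x_1}$ whiskered with the composition $m'$ of $Y$, for all $k\ge 0$ and $x_0,\dots,x_k\in X_0$. These form a 2-category $K\text{-}\mathbf{Cat}_P$ with a forgetful 2-functor $U\colon K\text{-}\mathbf{Cat}_P\to K\text{-}\mathbf{Gph}$. **Proposition.** Let $K$ be an infinitely distributive 2-category and $P$ an operad in $K$. Then $K\text{-}\mathbf{Cat}_P$ is 2-monadic over $K\text{-}\mathbf{Gph}$ via a 2-monad $\mathsf{fc}_P$: the 2-functor $U$ has a left 2-adjoint inducing the 2-monad $\mathsf{fc}_P$ on $K\text{-}\mathbf{Gph}$, and the canonical comparison 2-functor from $K\text{-}\mathbf{Cat}_P$ to the 2-category of strict $\mathsf{fc}_P$-algebras, strict algebra maps and algebra 2-cells is an isomorphism of 2-categories. The underlying 1-monad of $\mathsf{fc}_P$ is the free $(K,P)$-category monad: it is induced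 by the left adjoint of the underlying 1-functor of $U$, and, up to identifying objects along the unit, $\mathsf{fc}_P(X)$ has the same objects as $X$ and $$\mathsf{fc}_P(X)(a,b)=\coprod_{k\ge 0,\ a=x_0,x_1,\dots,x_k=b}P(k)\times X(x_{k-1},x_k)\times\cdots\times X(x_0,x_1),$$ where the coproduct injections are the unit on each factor $X(x_{i-1},x_i)$ followed by composition in the free $(K,P)$-category on $X$. Furthermore, the 2-category $K\text{-}\mathbf{Cat}_P$ is itself infinitely distributive. -/

import Mathlib

open CategoryTheory CategoryTheory.Limits CategoryTheory.Bicategory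

-- Avoids a second, definitionally equal, route from a category to its quiver of 1-cells.
attribute [-instance] CategoryTheory.catToReflQuiver

universe w w₂ v u w' w₂' v' u'

/-! ### Universal properties in a strict 2-category -/

section Universal

variable {B : Type u} [Bicategory.{w₂, v} B]

/-- `π` exhibits `p` as the strict 2-product of the family `X`: for every `Z` the functor
`B(Z, p) → ∏ i, B(Z, X i)` is an isomorphism of categories, that is, it is bijective on objects
(1-cells) and on morphisms (2-cells). -/
structure IsTwoProduct {ι : Type*} (X : ι → B) (p : B) (π : ∀ i, p ⟶ X i) : Prop where
  existsUnique_lift : ∀ (Z : B) (f : ∀ i, Z ⟶ X i), ∃! g : Z ⟶ p, ∀ i, g ≫ π i = f i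
  existsUnique_lift₂ : ∀ (Z : B) (g h : Z ⟶ p) (α : ∀ i, g ≫ π i ⟶ h ≫ π i),
    ∃! β : g ⟶ h, ∀ i, β ▷ π i = α i

/-- `j` exhibits `c` as the strict 2-coproduct of the family `X`: for every `Z` the functor
`B(c, Z) → ∏ i, B(X i, Z)` is an isomorphism of categories. -/
structure IsTwoCoproduct {ι : Type*} (X : ι → B) (c : B) (j : ∀ i, X i ⟶ c) : Prop where
  existsUnique_desc : ∀ (Z : B) (f : ∀ i, X i ⟶ Z), ∃! g : c ⟶ Z, ∀ i, j i ≫ g = f i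
  existsUnique_desc₂ : ∀ (Z : B) (g h : c ⟶ Z) (α : ∀ i, j i ≫ g ⟶ j i ≫ h),
    ∃! β : g ⟶ h, ∀ i, j i ◁ β = α i

end Universal

/-- A strict 2-category has finite products, in the strict 2-dimensional sense. -/
class HasFiniteTwoProducts (K : Type u) [Bicategory.{w₂, v} K] [Bicategory.Strict K] : Prop where
  exists_isTwoProduct : ∀ (n : ℕ) (X : Fin n → K), ∃ (p : K) (π : ∀ i, p ⟶ X i),
    IsTwoProduct X p π

instance HasFiniteTwoProducts.hasFiniteProducts (K : Type u) [Bicategory.{w₂, v} K]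
    [Bicategory.Strict K] [HasFiniteTwoProducts K] : HasFiniteProducts K where
  out n := by
    have key (X : Fin n → K) : HasProduct X := by
      obtain ⟨p, π, h⟩ := HasFiniteTwoProducts.exists_isTwoProduct n X
      exact ⟨⟨{
        cone := Fan.mk p π
        isLimit := Fan.IsLimit.mk _
          (fun s => (h.existsUnique_lift s.pt s.proj).choose)
          (fun s => (h.existsUnique_lift s.pt s.proj).choose_spec.1)
          (fun s _ hm => (h.existsUnique_lift s.pt s.proj).choose_spec.2 _ hm) }⟩⟩
    exact ⟨fun F => hasLimit_of_iso (Discrete.natIsoFunctor (F := F)).symm⟩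

/-- A strict 2-category is infinitely distributive if it has finite products and small coproducts
(both in the strict 2-dimensional sense) and the products distribute over the coproducts. -/
structure InfinitelyDistributive (K : Type u) [Bicategory.{w₂, v} K] [Bicategory.Strict K] : Prop
    extends HasFiniteTwoProducts K where
  exists_isTwoCoproduct : ∀ (ι : Type w) (X : ι → K), ∃ (c : K) (j : ∀ i, X i ⟶ c),
    IsTwoCoproduct X c j
  distrib : ∀ (A : K) (ι : Type w) (X : ι → K) (c : K) (j : ∀ i, X i ⟶ c),
    IsTwoCoproduct X c j →
      IsTwoCoproduct (fun i => A ⨯ X i) (A ⨯ c) (fun i => prod.map (𝟙 A) (j i))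

/-! ### Calculus of 2-cells in strict 2-categories, up to heterogeneous equality -/

namespace TwoCat

variable {B : Type u} [Bicategory.{w₂, v} B]

theorem whiskerLeft_heq {a b c : B} {f f' : a ⟶ b} {g g' h h' : b ⟶ c} {η : g ⟶ h} {η' : g' ⟶ h'}
    (hf : f = f') (hg : g = g') (hh : h = h') (e : HEq η η') : HEq (f ◁ η) (f' ◁ η') := by
  subst hf hg hh; cases e; rfl

theorem whiskerRight_heq {a b c : B} {f f' : b ⟶ c} {g g' h h' : a ⟶ b} {η : g ⟶ h} {η' : g' ⟶ h'}
    (hf : f = f') (hg : g = g') (hh : h = h') (e : HEq η η') : HEq (η ▷ f) (η' ▷ f') := by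
  subst hf hg hh; cases e; rfl

theorem comp_heq {a b : B} {f f' g g' h h' : a ⟶ b} {η : f ⟶ g} {η' : f' ⟶ g'}
    {θ : g ⟶ h} {θ' : g' ⟶ h'} (hf : f = f') (hg : g = g') (hh : h = h')
    (e : HEq η η') (e' : HEq θ θ') : HEq (η ≫ θ) (η' ≫ θ') := by
  subst hf hg hh; cases e; cases e'; rfl

theorem id_heq {a b : B} {f g : a ⟶ b} (h : f = g) : HEq (𝟙 f) (𝟙 g) := by
  subst h; rfl

theorem eqToHom_heq_id {a b : B} {f g : a ⟶ b} (h : f = g) : HEq (eqToHom h) (𝟙 f) := by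
  subst h; rfl

variable [Strict B]

theorem eqToHom_conj_heq {a b : B} {f f' g g' : a ⟶ b} (hf : f = f') (η : f' ⟶ g') (hg : g' = g) :
    HEq (eqToHom hf ≫ η ≫ eqToHom hg) η := by
  subst hf hg; simp

theorem id_whiskerLeft_heq {a b : B} {f g : a ⟶ b} (η : f ⟶ g) : HEq (𝟙 a ◁ η) η := by
  rw [id_whiskerLeft, Strict.leftUnitor_eqToIso, Strict.leftUnitor_eqToIso]
  exact eqToHom_conj_heq (Strict.id_comp f) η (Strict.id_comp g).symm

theorem whiskerRight_id_heq {a b : B} {f g : a ⟶ b} (η : f ⟶ g) : HEq (η ▷ 𝟙 b) η := by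
  rw [whiskerRight_id, Strict.rightUnitor_eqToIso, Strict.rightUnitor_eqToIso]
  exact eqToHom_conj_heq (Strict.comp_id f) η (Strict.comp_id g).symm

theorem comp_whiskerLeft_heq {a b c d : B} (f : a ⟶ b) (g : b ⟶ c) {h h' : c ⟶ d} (η : h ⟶ h') :
    HEq ((f ≫ g) ◁ η) (f ◁ g ◁ η) := by
  rw [comp_whiskerLeft, Strict.associator_eqToIso, Strict.associator_eqToIso]
  exact eqToHom_conj_heq (Strict.assoc f g h) _ (Strict.assoc f g h').symm

theorem whiskerRight_comp_heq {a b c d : B} {f f' : a ⟶ b} (η : f ⟶ f') (g : b ⟶ c) (h : c ⟶ d) :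
    HEq (η ▷ (g ≫ h)) (η ▷ g ▷ h) := by
  rw [whiskerRight_comp, Strict.associator_eqToIso, Strict.associator_eqToIso]
  exact eqToHom_conj_heq (Strict.assoc f g h).symm _ (Strict.assoc f' g h)

theorem whisker_assoc_heq {a b c d : B} (f : a ⟶ b) {g g' : b ⟶ c} (η : g ⟶ g') (h : c ⟶ d) :
    HEq ((f ◁ η) ▷ h) (f ◁ η ▷ h) := by
  rw [whisker_assoc, Strict.associator_eqToIso, Strict.associator_eqToIso]
  exact eqToHom_conj_heq (Strict.assoc f g h) _ (Strict.assoc f g' h).symm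

end TwoCat

/-! ### Locally defined sub-2-categories -/

/-- Data describing a strict 2-category with type of objects `C`, whose 1-cells and 2-cells are
those 1-cells and 2-cells between underlying objects in a strict 2-category `B` which have given
properties, closed under all operations of `B`. -/
structure StructureOver (B : Type u) [Bicategory.{w₂, v} B] (C : Type u') where
  obj : C → B
  IsHom : ∀ {X Y : C}, (obj X ⟶ obj Y) → Prop
  IsHom₂ : ∀ (X Y : C) {f g : obj X ⟶ obj Y}, (f ⟶ g) → Prop
  isHom_id : ∀ X : C, IsHom (X := X) (Y := X) (𝟙 (obj X))
  isHom_comp : ∀ {X Y Z : C} {f : obj X ⟶ obj Y} {g : obj Y ⟶ obj Z},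
    IsHom f → IsHom g → IsHom (X := X) (Y := Z) (f ≫ g)
  isHom₂_id : ∀ {X Y : C} {f : obj X ⟶ obj Y}, IsHom f → IsHom₂ X Y (𝟙 f)
  isHom₂_comp : ∀ {X Y : C} {f g h : obj X ⟶ obj Y} {η : f ⟶ g} {θ : g ⟶ h},
    IsHom f → IsHom g → IsHom h → IsHom₂ X Y η → IsHom₂ X Y θ → IsHom₂ X Y (η ≫ θ)
  isHom₂_whiskerLeft : ∀ {X Y Z : C} {f : obj X ⟶ obj Y} {g h : obj Y ⟶ obj Z} {η : g ⟶ h},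
    IsHom f → IsHom g → IsHom h → IsHom₂ Y Z η → IsHom₂ X Z (f ◁ η)
  isHom₂_whiskerRight : ∀ {X Y Z : C} {f g : obj X ⟶ obj Y} {h : obj Y ⟶ obj Z} {η : f ⟶ g},
    IsHom f → IsHom g → IsHom h → IsHom₂ X Y η → IsHom₂ X Z (η ▷ h)

namespace StructureOver

variable {B : Type u} [Bicategory.{w₂, v} B] {C : Type u'} (S : StructureOver B C)

/-- The 1-cells of `C`. -/
@[ext]
structure Hom (X Y : C) where
  hom : S.obj X ⟶ S.obj Y
  isHom : S.IsHom hom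

/-- The 2-cells of `C`. -/
@[ext]
structure Hom₂ {X Y : C} (f g : S.Hom X Y) where
  hom : f.hom ⟶ g.hom
  isHom₂ : S.IsHom₂ X Y hom

variable {S} in
theorem Hom₂.heq {X Y : C} {f f' g g' : S.Hom X Y} (hf : f.hom = f'.hom) (hg : g.hom = g'.hom)
    {η : S.Hom₂ f g} {θ : S.Hom₂ f' g'} (e : HEq η.hom θ.hom) : HEq η θ := by
  obtain rfl := Hom.ext hf
  obtain rfl := Hom.ext hg
  exact heq_of_eq (Hom₂.ext (eq_of_heq e))

theorem isHom₂_eqToHom {X Y : C} {f g : S.obj X ⟶ S.obj Y} (hf : S.IsHom f) (e : f = g) :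
    S.IsHom₂ X Y (eqToHom e) := by
  subst e; exact S.isHom₂_id hf

/-- Identities and composition of 1-cells, as in `B`. -/
@[reducible]
def categoryStruct : CategoryStruct C where
  Hom X Y := S.Hom X Y
  id X := ⟨𝟙 (S.obj X), S.isHom_id X⟩
  comp f g := ⟨f.hom ≫ g.hom, S.isHom_comp f.isHom g.isHom⟩

/-- Identities and vertical composition of 2-cells, as in `B`. -/
@[reducible]
def homCategory (X Y : C) : Category (S.Hom X Y) where
  Hom f g := S.Hom₂ f g
  id f := ⟨𝟙 f.hom, S.isHom₂_id f.isHom⟩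
  comp {f g h} η θ := ⟨η.hom ≫ θ.hom, S.isHom₂_comp f.isHom g.isHom h.isHom η.isHom₂ θ.isHom₂⟩
  id_comp _ := Hom₂.ext (Category.id_comp _)
  comp_id _ := Hom₂.ext (Category.comp_id _)
  assoc _ _ _ := Hom₂.ext (Category.assoc _ _ _)

/-- The structural isomorphisms of `B`, which are equalities of 1-cells, as 2-cells of `C`. -/
def isoOfEq {X Y : C} (f g : S.Hom X Y) (φ : f.hom ≅ g.hom) (e : f.hom = g.hom)
    (h : φ = eqToIso e) :
    letI := S.homCategory X Y; f ≅ g :=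
  letI := S.homCategory X Y
  { hom := ⟨φ.hom, by subst h; exact S.isHom₂_eqToHom f.isHom e⟩
    inv := ⟨φ.inv, by subst h; exact S.isHom₂_eqToHom g.isHom e.symm⟩
    hom_inv_id := Hom₂.ext φ.hom_inv_id
    inv_hom_id := Hom₂.ext φ.inv_hom_id }

theorem isoOfEq_eq {X Y : C} (f g : S.Hom X Y) (φ : f.hom ≅ g.hom) (e : f.hom = g.hom)
    (h : φ = eqToIso e) :
    letI := S.homCategory X Y
    S.isoOfEq f g φ e h = eqToIso (Hom.ext e) := by
  cases f; cases g; cases e; cases h; rfl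

variable [Strict B]

/-- The 2-category structure on `C`; all operations are those of `B`. -/
@[reducible]
def bicategory : Bicategory C where
  toCategoryStruct := S.categoryStruct
  homCategory := S.homCategory
  whiskerLeft {_ _ _} f {g h} η :=
    ⟨f.hom ◁ η.hom, S.isHom₂_whiskerLeft f.isHom g.isHom h.isHom η.isHom₂⟩
  whiskerRight {_ _ _ f g} η h :=
    ⟨η.hom ▷ h.hom, S.isHom₂_whiskerRight f.isHom g.isHom h.isHom η.isHom₂⟩
  associator f g h := S.isoOfEq _ _ (α_ f.hom g.hom h.hom) (Strict.assoc _ _ _)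
    (Strict.associator_eqToIso _ _ _)
  leftUnitor f := S.isoOfEq _ _ (λ_ f.hom) (Strict.id_comp _) (Strict.leftUnitor_eqToIso _)
  rightUnitor f := S.isoOfEq _ _ (ρ_ f.hom) (Strict.comp_id _) (Strict.rightUnitor_eqToIso _)
  whiskerLeft_id _ _ := Hom₂.ext (whiskerLeft_id _ _)
  whiskerLeft_comp _ _ _ _ _ _ := Hom₂.ext (whiskerLeft_comp _ _ _)
  id_whiskerLeft _ := Hom₂.ext (id_whiskerLeft _)
  comp_whiskerLeft _ _ _ _ _ := Hom₂.ext (comp_whiskerLeft _ _ _)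
  id_whiskerRight _ _ := Hom₂.ext (id_whiskerRight _ _)
  comp_whiskerRight _ _ _ := Hom₂.ext (comp_whiskerRight _ _ _)
  whiskerRight_id _ := Hom₂.ext (whiskerRight_id _)
  whiskerRight_comp _ _ _ := Hom₂.ext (whiskerRight_comp _ _ _)
  whisker_assoc _ _ _ _ _ := Hom₂.ext (whisker_assoc _ _ _)
  whisker_exchange _ _ := Hom₂.ext (whisker_exchange _ _)
  pentagon _ _ _ _ := Hom₂.ext (pentagon _ _ _ _)
  triangle _ _ := Hom₂.ext (triangle _ _)

theorem strict : @Bicategory.Strict C S.bicategory :=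
  letI := S.bicategory
  { id_comp f := Hom.ext (Strict.id_comp _)
    comp_id f := Hom.ext (Strict.comp_id _)
    assoc f g h := Hom.ext (Strict.assoc _ _ _)
    leftUnitor_eqToIso _ := S.isoOfEq_eq _ _ _ _ _
    rightUnitor_eqToIso _ := S.isoOfEq_eq _ _ _ _ _
    associator_eqToIso _ _ _ := S.isoOfEq_eq _ _ _ _ _ }

/-- The forgetful 2-functor `C → B`. -/
def forget : letI := S.bicategory; StrictPseudofunctor C B :=
  letI := S.bicategory
  haveI := S.strict
  StrictPseudofunctor.mk''
    { obj := S.obj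
      map := fun f => f.hom
      map₂ := fun η => η.hom
      map₂_id := fun _ => rfl
      map₂_comp := fun _ _ => rfl
      map_id := fun _ => rfl
      map_comp := fun _ _ => rfl
      map₂_whisker_left := fun f _ _ η => by simp; rfl
      map₂_whisker_right := fun η f => by simp; rfl }

end StructureOver

/-! ### 2-natural transformations, 2-monads, algebras, 2-adjunctions -/

section TwoMonads

variable {B : Type u} [Bicategory.{w₂, v} B] [Strict B]
  {C : Type u'} [Bicategory.{w₂', v'} C] [Strict C]

theorem CategoryTheory.StrictPseudofunctor.map₂_whiskerLeft_heq (F : StrictPseudofunctor B C)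
    {a b c : B} (f : a ⟶ b) {g h : b ⟶ c} (η : g ⟶ h) :
    HEq (F.map₂ (f ◁ η)) (F.map f ◁ F.map₂ η) := by
  rw [F.map₂_whisker_left, F.mapComp_eq_eqToIso, F.mapComp_eq_eqToIso]
  exact TwoCat.eqToHom_conj_heq (F.map_comp f g) _ (F.map_comp f h).symm

theorem CategoryTheory.StrictPseudofunctor.map₂_whiskerRight_heq (F : StrictPseudofunctor B C)
    {a b c : B} {f g : a ⟶ b} (η : f ⟶ g) (h : b ⟶ c) :
    HEq (F.map₂ (η ▷ h)) (F.map₂ η ▷ F.map h) := by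
  rw [F.map₂_whisker_right, F.mapComp_eq_eqToIso, F.mapComp_eq_eqToIso]
  exact TwoCat.eqToHom_conj_heq (F.map_comp f h) _ (F.map_comp g h).symm

theorem CategoryTheory.StrictPseudofunctor.map₂_heq (F : StrictPseudofunctor B C)
    {a b : B} {f f' g g' : a ⟶ b} (hf : f = f') (hg : g = g') {η : f ⟶ g} {η' : f' ⟶ g'}
    (e : HEq η η') : HEq (F.map₂ η) (F.map₂ η') := by
  subst hf hg; cases e; rfl

/-- A (strict) 2-natural transformation between 2-functors. The two sides of `naturality₂` have
types that agree by `naturality`. -/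
structure TwoNatTrans (F G : StrictPseudofunctor B C) where
  app : ∀ X : B, F.obj X ⟶ G.obj X
  naturality : ∀ {X Y : B} (f : X ⟶ Y), F.map f ≫ app Y = app X ≫ G.map f
  naturality₂ : ∀ {X Y : B} {f g : X ⟶ Y} (η : f ⟶ g),
    HEq (F.map₂ η ▷ app Y) (app X ◁ G.map₂ η)

variable (B) in
/-- A (strict) 2-monad on a 2-category. -/
structure TwoMonad where
  T : StrictPseudofunctor B B
  η : TwoNatTrans (StrictPseudofunctor.id B) T
  μ : TwoNatTrans (T.comp T) T
  left_unit : ∀ X : B, η.app (T.obj X) ≫ μ.app X = 𝟙 (T.obj X)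
  right_unit : ∀ X : B, T.map (η.app X) ≫ μ.app X = 𝟙 (T.obj X)
  assoc : ∀ X : B, T.map (μ.app X) ≫ μ.app X = μ.app (T.obj X) ≫ μ.app X

namespace TwoMonad

/-- The underlying 1-monad of a 2-monad, on the underlying 1-category. -/
def toMonad (M : TwoMonad B) : Monad B where
  toFunctor := M.T.toFunctor
  η := { app := M.η.app, naturality := fun _ _ f => M.η.naturality f }
  μ := { app := M.μ.app, naturality := fun _ _ f => M.μ.naturality f }
  assoc := M.assoc
  left_unit := M.left_unit
  right_unit := M.right_unit

/-- A strict algebra for a 2-monad. -/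
structure Algebra (M : TwoMonad B) where
  A : B
  a : M.T.obj A ⟶ A
  unit : M.η.app A ≫ a = 𝟙 A
  assoc : M.μ.app A ≫ a = M.T.map a ≫ a

/-- Strict algebra maps are the 1-cells `f` with `a ≫ f = T f ≫ b`, and algebra 2-cells are the
2-cells `α` whose whiskerings satisfy `a ◁ α = T α ▷ b` (the cylinder condition). -/
def algebraStructure (M : TwoMonad B) : StructureOver B M.Algebra where
  obj X := X.A
  IsHom {X Y} f := X.a ≫ f = M.T.map f ≫ Y.a
  IsHom₂ X Y _ _ α := HEq (X.a ◁ α) (M.T.map₂ α ▷ Y.a)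
  isHom_id X := by rw [M.T.map_id, Strict.comp_id, Strict.id_comp]
  isHom_comp {X Y Z f g} hf hg := by
    rw [M.T.map_comp, ← Strict.assoc, hf, Strict.assoc, hg, ← Strict.assoc]
  isHom₂_id {X Y f} hf := by
    rw [M.T.map₂_id, whiskerLeft_id, id_whiskerRight]
    exact TwoCat.id_heq hf
  isHom₂_comp {X Y f g h η θ} hf hg hh hη hθ := by
    rw [M.T.map₂_comp, whiskerLeft_comp, comp_whiskerRight]
    exact TwoCat.comp_heq hf hg hh hη hθ
  isHom₂_whiskerLeft {X Y Z f g h η} hf hg hh hη :=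
    (TwoCat.comp_whiskerLeft_heq X.a f η).symm.trans <|
    (TwoCat.whiskerLeft_heq hf rfl rfl HEq.rfl).trans <|
    (TwoCat.comp_whiskerLeft_heq _ _ η).trans <|
    (TwoCat.whiskerLeft_heq rfl hg hh hη).trans <|
    (TwoCat.whisker_assoc_heq _ _ _).symm.trans <|
    TwoCat.whiskerRight_heq rfl (M.T.map_comp f g).symm (M.T.map_comp f h).symm
      (M.T.map₂_whiskerLeft_heq f η).symm
  isHom₂_whiskerRight {X Y Z f g h η} hf hg hh hη :=
    (TwoCat.whisker_assoc_heq X.a η h).symm.trans <|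
    (TwoCat.whiskerRight_heq rfl hf hg hη).trans <|
    (TwoCat.whiskerRight_comp_heq _ _ _).symm.trans <|
    (TwoCat.whiskerRight_heq hh rfl rfl HEq.rfl).trans <|
    (TwoCat.whiskerRight_comp_heq _ _ _).trans <|
    TwoCat.whiskerRight_heq rfl (M.T.map_comp f h).symm (M.T.map_comp g h).symm
      (M.T.map₂_whiskerRight_heq η h).symm

/-- The 2-category `T-Alg` of strict algebras, strict algebra maps and algebra 2-cells. -/
instance (M : TwoMonad B) : Bicategory M.Algebra := M.algebraStructure.bicategory

instance (M : TwoMonad B) : Strict M.Algebra := M.algebraStructure.strict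

end TwoMonad

/-- A (strict) 2-adjunction `F ⊣ U`. -/
structure TwoAdjunction (F : StrictPseudofunctor B C) (U : StrictPseudofunctor C B) where
  unit : TwoNatTrans (StrictPseudofunctor.id B) (F.comp U)
  counit : TwoNatTrans (U.comp F) (StrictPseudofunctor.id C)
  left_triangle : ∀ X : B, F.map (unit.app X) ≫ counit.app (F.obj X) = 𝟙 (F.obj X)
  right_triangle : ∀ Y : C, unit.app (U.obj Y) ≫ U.map (counit.app Y) = 𝟙 (U.obj Y)

namespace TwoAdjunction

variable {F : StrictPseudofunctor B C} {U : StrictPseudofunctor C B} (adj : TwoAdjunction F U)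

/-- The 2-monad `U F` induced by a 2-adjunction `F ⊣ U`. -/
def twoMonad : TwoMonad B where
  T := F.comp U
  η := adj.unit
  μ :=
    { app := fun X => U.map (adj.counit.app (F.obj X))
      naturality := fun f =>
        (U.map_comp _ _).symm.trans <|
        (congrArg U.map (adj.counit.naturality (F.map f))).trans (U.map_comp _ _)
      naturality₂ := fun {X Y f g} η =>
        (U.map₂_whiskerRight_heq _ _).symm.trans <|
        (U.map₂_heq (adj.counit.naturality (F.map f)) (adj.counit.naturality (F.map g))
          (adj.counit.naturality₂ (F.map₂ η))).trans (U.map₂_whiskerLeft_heq _ _) }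
  left_unit X := adj.right_triangle (F.obj X)
  right_unit X :=
    (U.map_comp _ _).symm.trans <|
    (congrArg U.map (adj.left_triangle X)).trans (U.map_id _)
  assoc X :=
    (U.map_comp _ _).symm.trans <|
    (congrArg U.map (adj.counit.naturality (adj.counit.app (F.obj X)))).trans (U.map_comp _ _)

/-- The canonical comparison 2-functor `C → T-Alg` for the 2-monad `T` induced by `F ⊣ U`, sending
`X` to the algebra `U X` with structure map `U ε_X`. -/
def comparison : StrictPseudofunctor C adj.twoMonad.Algebra :=
  StrictPseudofunctor.mk''
    { obj := fun X =>
        { A := U.obj X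
          a := U.map (adj.counit.app X)
          unit := adj.right_triangle X
          assoc := (U.map_comp _ _).symm.trans <|
            (congrArg U.map (adj.counit.naturality (adj.counit.app X)).symm).trans
              (U.map_comp _ _) }
      map := fun {X Y} f =>
        { hom := U.map f
          isHom := (U.map_comp _ _).symm.trans <|
            (congrArg U.map (adj.counit.naturality f).symm).trans (U.map_comp _ _) }
      map₂ := fun {X Y f g} η =>
        { hom := U.map₂ η
          isHom₂ := (U.map₂_whiskerLeft_heq _ _).symm.trans <|
            (U.map₂_heq (adj.counit.naturality f).symm (adj.counit.naturality g).symm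
              (adj.counit.naturality₂ η).symm).trans (U.map₂_whiskerRight_heq _ _) }
      map₂_id := fun _ => StructureOver.Hom₂.ext (U.map₂_id _)
      map₂_comp := fun _ _ => StructureOver.Hom₂.ext (U.map₂_comp _ _)
      map_id := fun _ => StructureOver.Hom.ext (U.map_id _)
      map_comp := fun _ _ => StructureOver.Hom.ext (U.map_comp _ _)
      map₂_whisker_left := fun f _ _ η => by
        refine eq_of_heq (HEq.trans ?_ (TwoCat.eqToHom_conj_heq (B := adj.twoMonad.Algebra) _ _ _).symm)
        exact StructureOver.Hom₂.heq (U.map_comp _ _) (U.map_comp _ _)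
          (U.map₂_whiskerLeft_heq f η)
      map₂_whisker_right := fun η f => by
        refine eq_of_heq (HEq.trans ?_ (TwoCat.eqToHom_conj_heq (B := adj.twoMonad.Algebra) _ _ _).symm)
        exact StructureOver.Hom₂.heq (U.map_comp _ _) (U.map_comp _ _)
          (U.map₂_whiskerRight_heq η f) }

end TwoAdjunction

/-- `Φ` is an isomorphism of 2-categories: it is bijective on objects, 1-cells and 2-cells (so it
has a strict inverse 2-functor). -/
structure IsTwoIso (Φ : StrictPseudofunctor B C) : Prop where
  bijective_obj : Function.Bijective Φ.obj
  bijective_map : ∀ X Y : B, Function.Bijective (Φ.map : (X ⟶ Y) → _)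
  bijective_map₂ : ∀ {X Y : B} (f g : X ⟶ Y), Function.Bijective (Φ.map₂ : (f ⟶ g) → _)

/-- The 2-functor `U : C → B` exhibits `C` as (strictly) 2-monadic over `B` via the 2-monad `M`:
it has a left 2-adjoint inducing `M`, and the canonical comparison 2-functor from `C` to the
2-category of `M`-algebras is an isomorphism of 2-categories. -/
def IsTwoMonadicVia (U : StrictPseudofunctor C B) (M : TwoMonad B) : Prop :=
  ∃ (F : StrictPseudofunctor B C) (adj : TwoAdjunction F U),
    adj.twoMonad = M ∧ IsTwoIso adj.comparison

end TwoMonads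

/-! ### Graphs enriched in a 2-category -/

/-- A (small) graph enriched in `K`. -/
structure KGraph (K : Type u) where
  Obj : Type w
  hom : Obj → Obj → K

namespace KGraph

/-- A morphism of enriched graphs. -/
structure Hom {K : Type u} [Quiver.{v} K] (X Y : KGraph.{w} K) where
  obj : X.Obj → Y.Obj
  map : ∀ a b, X.hom a b ⟶ Y.hom (obj a) (obj b)

variable {K : Type u} [Bicategory.{w₂, v} K]

/-- A 2-cell between morphisms of enriched graphs. It exists only between morphisms with the same
action on objects, and then consists of a 2-cell of `K` for every pair of objects. -/
inductive Hom₂ {X Y : KGraph.{w} K} : Hom X Y → Hom X Y → Type (max w v w₂)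
  | mk (f : X.Obj → Y.Obj) {F G : ∀ a b, X.hom a b ⟶ Y.hom (f a) (f b)}
      (α : ∀ a b, F a b ⟶ G a b) : Hom₂ ⟨f, F⟩ ⟨f, G⟩

/-- Identities and composition of graph morphisms, inherited from `K`. -/
@[reducible]
def categoryStruct : CategoryStruct (KGraph.{w} K) where
  Hom X Y := Hom X Y
  id X := ⟨fun a => a, fun a b => 𝟙 (X.hom a b)⟩
  comp F G := ⟨fun a => G.obj (F.obj a), fun a b => F.map a b ≫ G.map (F.obj a) (F.obj b)⟩

namespace Hom₂

variable {X Y Z : KGraph.{w} K}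

/-- The identity 2-cell. -/
def id : ∀ F : Hom X Y, Hom₂ F F
  | ⟨f, F⟩ => mk f fun a b => 𝟙 (F a b)

/-- Vertical composition of 2-cells. -/
def comp : ∀ {F G H : Hom X Y}, Hom₂ F G → Hom₂ G H → Hom₂ F H
  | _, _, _, mk f α, mk _ β => mk f fun a b => α a b ≫ β a b

/-- Whiskering on the left. -/
def whiskerLeft (F : Hom X Y) : ∀ {G H : Hom Y Z}, Hom₂ G H →
    Hom₂ (categoryStruct.comp F G) (categoryStruct.comp F H)
  | _, _, mk g β => mk (fun a => g (F.obj a)) fun a b => F.map a b ◁ β (F.obj a) (F.obj b)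

/-- Whiskering on the right. -/
def whiskerRight : ∀ {F G : Hom X Y}, Hom₂ F G → ∀ H : Hom Y Z,
    Hom₂ (categoryStruct.comp F H) (categoryStruct.comp G H)
  | _, _, mk f α, H => mk (fun a => H.obj (f a)) fun a b => α a b ▷ H.map (f a) (f b)

end Hom₂

/-- Vertical composition of 2-cells of graphs, inherited from `K`. -/
@[reducible]
def homCategory (X Y : KGraph.{w} K) : Category (Hom X Y) where
  Hom F G := Hom₂ F G
  id F := Hom₂.id F
  comp α β := Hom₂.comp α β
  id_comp := by rintro _ _ ⟨f, α⟩; simp [Hom₂.id, Hom₂.comp]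
  comp_id := by rintro _ _ ⟨f, α⟩; simp [Hom₂.id, Hom₂.comp]
  assoc := by rintro _ _ _ _ ⟨f, α⟩ ⟨_, β⟩ ⟨_, γ⟩; simp [Hom₂.comp]

/-- Invertible 2-cells from componentwise invertible 2-cells. -/
def isoMk {X Y : KGraph.{w} K} (f : X.Obj → Y.Obj) {F G : ∀ a b, X.hom a b ⟶ Y.hom (f a) (f b)}
    (α : ∀ a b, F a b ≅ G a b) :
    letI := homCategory X Y; (⟨f, F⟩ : Hom X Y) ≅ ⟨f, G⟩ :=
  letI := homCategory X Y
  { hom := Hom₂.mk f fun a b => (α a b).hom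
    inv := Hom₂.mk f fun a b => (α a b).inv
    hom_inv_id := by simp [Hom₂.id, Hom₂.comp, CategoryStruct.id, CategoryStruct.comp]
    inv_hom_id := by simp [Hom₂.id, Hom₂.comp, CategoryStruct.id, CategoryStruct.comp] }

/-- The 2-category of `K`-graphs. -/
instance : Bicategory (KGraph.{w} K) where
  toCategoryStruct := categoryStruct
  homCategory := homCategory
  whiskerLeft F _ _ β := Hom₂.whiskerLeft F β
  whiskerRight α H := Hom₂.whiskerRight α H
  associator F G H := isoMk _ fun a b => α_ _ _ _
  leftUnitor F := isoMk _ fun a b => λ_ _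
  rightUnitor F := isoMk _ fun a b => ρ_ _
  whiskerLeft_id F := by
    rintro ⟨g, G⟩
    exact congrArg (Hom₂.mk _) (funext fun a => funext fun b => whiskerLeft_id _ _)
  whiskerLeft_comp F := by
    rintro _ _ _ ⟨g, β⟩ ⟨_, γ⟩
    exact congrArg (Hom₂.mk _) (funext fun a => funext fun b => whiskerLeft_comp _ _ _)
  id_whiskerLeft := by
    rintro _ _ _ _ ⟨g, β⟩
    exact congrArg (Hom₂.mk g) (funext fun a => funext fun b => id_whiskerLeft (β a b))
  comp_whiskerLeft F G := by
    rintro _ _ ⟨g, β⟩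
    exact congrArg (Hom₂.mk _) (funext fun a => funext fun b => comp_whiskerLeft _ _ _)
  id_whiskerRight := by
    rintro _ _ _ ⟨f, F⟩ G
    exact congrArg (Hom₂.mk _) (funext fun a => funext fun b => id_whiskerRight _ _)
  comp_whiskerRight := by
    rintro _ _ _ _ _ _ ⟨f, α⟩ ⟨_, β⟩ G
    exact congrArg (Hom₂.mk _) (funext fun a => funext fun b => comp_whiskerRight _ _ _)
  whiskerRight_id := by
    rintro _ _ _ _ ⟨f, α⟩
    exact congrArg (Hom₂.mk f) (funext fun a => funext fun b => Bicategory.whiskerRight_id (α a b))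
  whiskerRight_comp := by
    rintro _ _ _ _ _ _ ⟨f, α⟩ G H
    exact congrArg (Hom₂.mk _) (funext fun a => funext fun b => whiskerRight_comp _ _ _)
  whisker_assoc := by
    rintro _ _ _ _ F _ _ ⟨g, β⟩ H
    exact congrArg (Hom₂.mk _) (funext fun a => funext fun b => whisker_assoc _ _ _)
  whisker_exchange := by
    rintro _ _ _ _ _ _ _ ⟨f, α⟩ ⟨g, β⟩
    exact congrArg (Hom₂.mk _) (funext fun a => funext fun b => whisker_exchange _ _)
  pentagon _ _ _ _ :=
    congrArg (Hom₂.mk _) (funext fun a => funext fun b => pentagon _ _ _ _)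
  triangle _ _ :=
    congrArg (Hom₂.mk _) (funext fun a => funext fun b => triangle _ _)

theorem isoMk_eq {X Y : KGraph.{w} K} (f : X.Obj → Y.Obj)
    {F G : ∀ a b, X.hom a b ⟶ Y.hom (f a) (f b)} (h : ∀ a b, F a b = G a b) :
    letI := homCategory X Y
    isoMk f (fun a b => eqToIso (h a b)) =
      eqToIso (congrArg (Hom.mk f) (funext fun a => funext fun b => h a b)) := by
  obtain rfl : F = G := funext fun a => funext fun b => h a b
  rfl

instance [Strict K] : Strict (KGraph.{w} K) where
  id_comp F := congrArg (Hom.mk F.obj) (funext fun a => funext fun b => Strict.id_comp _)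
  comp_id F := congrArg (Hom.mk F.obj) (funext fun a => funext fun b => Strict.comp_id _)
  assoc _ _ _ := congrArg (Hom.mk _) (funext fun a => funext fun b => Strict.assoc _ _ _)
  leftUnitor_eqToIso F := (congrArg (isoMk F.obj) (funext fun a => funext fun b =>
    Strict.leftUnitor_eqToIso (F.map a b))).trans (isoMk_eq _ _)
  rightUnitor_eqToIso F := (congrArg (isoMk F.obj) (funext fun a => funext fun b =>
    Strict.rightUnitor_eqToIso (F.map a b))).trans (isoMk_eq _ _)
  associator_eqToIso F G H := (congrArg (isoMk _) (funext fun a => funext fun b =>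
    Strict.associator_eqToIso _ _ _)).trans (isoMk_eq _ _)

end KGraph

/-! ### Operads and categories with operadically parametrised composition -/

/-- A (non-symmetric) operad in a category with finite products. The axioms are stated on
generalised elements; `mul n N h` is composition `P(k) × ∏ i, P(n i) ⟶ P(N)` for `N = ∑ i, n i`. -/
structure Operad (V : Type u) [Category.{v} V] [HasFiniteProducts V] where
  obj : ℕ → V
  unit : ⊤_ V ⟶ obj 1
  mul : ∀ {k : ℕ} (n : Fin k → ℕ) (N : ℕ), ∑ i, n i = N →
    ((obj k ⨯ ∏ᶜ fun i => obj (n i)) ⟶ obj N)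
  unit_mul : ∀ (n : ℕ) (h : ∑ _i : Fin 1, n = n) (Z : V) (p : Z ⟶ obj n),
    prod.lift (terminal.from Z ≫ unit) (Pi.lift fun _ : Fin 1 => p) ≫ mul (fun _ => n) n h = p
  mul_unit : ∀ (k : ℕ) (h : ∑ _i : Fin k, 1 = k) (Z : V) (p : Z ⟶ obj k),
    prod.lift p (Pi.lift fun _ : Fin k => terminal.from Z ≫ unit) ≫ mul (fun _ => 1) k h = p
  assoc : ∀ {k : ℕ} (n : Fin k → ℕ) (m : Fin (∑ i, n i) → ℕ) (N : ℕ)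
    (h : ∑ l, m l = N) (h' : ∑ i, ∑ j, m (finSigmaFinEquiv ⟨i, j⟩) = N)
    (Z : V) (p : Z ⟶ obj k) (q : ∀ i, Z ⟶ obj (n i)) (r : ∀ l, Z ⟶ obj (m l)),
    prod.lift (prod.lift p (Pi.lift q) ≫ mul n _ rfl) (Pi.lift r) ≫ mul m N h =
      prod.lift p (Pi.lift fun i =>
        prod.lift (q i) (Pi.lift fun j => r (finSigmaFinEquiv ⟨i, j⟩)) ≫
          mul (fun j => m (finSigmaFinEquiv ⟨i, j⟩)) _ rfl) ≫
        mul (fun i => ∑ j, m (finSigmaFinEquiv ⟨i, j⟩)) N h'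

/-- The pairs `(s i, t i)`, for `i < k`, are the consecutive edges of a path of length `k` from `a`
to `b` with vertices `a = x k, …, x 1, x 0 = b`. As in a composite of maps, the last edge of the
path is listed first. -/
def IsPath {O : Type w} (a b : O) {k : ℕ} (s t : Fin k → O) : Prop :=
  ∃ x : Fin (k + 1) → O, x 0 = b ∧ x (Fin.last k) = a ∧
    ∀ i : Fin k, s i = x i.succ ∧ t i = x i.castSucc

theorem IsPath.map {O : Type w} {O' : Type w'} (f : O → O') {a b : O} {k : ℕ} {s t : Fin k → O}
    (h : IsPath a b s t) : IsPath (f a) (f b) (fun i => f (s i)) (fun i => f (t i)) := by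
  obtain ⟨x, hb, ha, hx⟩ := h
  exact ⟨fun i => f (x i), congrArg f hb, congrArg f ha,
    fun i => ⟨congrArg f (hx i).1, congrArg f (hx i).2⟩⟩

/-- The type of paths of any length from `a` to `b`. -/
structure PathIn {O : Type w} (a b : O) where
  len : ℕ
  src : Fin len → O
  tgt : Fin len → O
  isPath : IsPath a b src tgt

/-- A `(K, P)`-category: a `K`-graph with, for every path of length `k`, a composition map
parametrised by `P(k)`, compatible with the unit and the composition of the operad (stated on
generalised elements). -/
structure KPCat {V : Type u} [Category.{v} V] [HasFiniteProducts V] (P : Operad V) where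
  graph : KGraph.{w} V
  act : ∀ {k : ℕ} {s t : Fin k → graph.Obj} {a b : graph.Obj}, IsPath a b s t →
    ((P.obj k ⨯ ∏ᶜ fun i => graph.hom (s i) (t i)) ⟶ graph.hom a b)
  act_unit : ∀ (a b : graph.Obj) (h : IsPath a b (fun _ : Fin 1 => a) (fun _ : Fin 1 => b))
    (Z : V) (f : Z ⟶ graph.hom a b),
    prod.lift (terminal.from Z ≫ P.unit) (Pi.lift fun _ : Fin 1 => f) ≫ act h = f
  act_mul : ∀ {k : ℕ} (n : Fin k → ℕ) (S T : Fin k → graph.Obj)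
    (s t : Fin (∑ i, n i) → graph.Obj) (a b : graph.Obj)
    (H : IsPath a b S T)
    (h : ∀ i, IsPath (S i) (T i) (fun j => s (finSigmaFinEquiv ⟨i, j⟩))
      (fun j => t (finSigmaFinEquiv ⟨i, j⟩)))
    (h' : IsPath a b s t)
    (Z : V) (p : Z ⟶ P.obj k) (q : ∀ i, Z ⟶ P.obj (n i))
    (f : ∀ l, Z ⟶ graph.hom (s l) (t l)),
    prod.lift (prod.lift p (Pi.lift q) ≫ P.mul n _ rfl) (Pi.lift f) ≫ act h' =
      prod.lift p (Pi.lift fun i =>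
        prod.lift (q i) (Pi.lift fun j => f (finSigmaFinEquiv ⟨i, j⟩)) ≫ act (h i)) ≫ act H

/-! ### The 2-cells `1 × α^k` -/

section ParamProduct

variable {K : Type u} [Bicategory.{w₂, v} K] [Strict K] [HasFiniteTwoProducts K]

/-- The 1-cell `1 × F₁ × ⋯ × F_k`. -/
noncomputable abbrev paramMap (A : K) {k : ℕ} {X Y : Fin k → K} (F : ∀ i, X i ⟶ Y i) :
    (A ⨯ ∏ᶜ X) ⟶ (A ⨯ ∏ᶜ Y) :=
  prod.map (𝟙 A) (Limits.Pi.map F)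

/-- `β` is the 2-cell `1 × α₁ × ⋯ × α_k`: its projection to the parameter is an identity and its
other projections are the `α i`. -/
structure IsParamMap₂ (A : K) {k : ℕ} {X Y : Fin k → K} {F G : ∀ i, X i ⟶ Y i}
    (α : ∀ i, F i ⟶ G i) (β : paramMap A F ⟶ paramMap A G) : Prop where
  fst : HEq (β ▷ (prod.fst : (A ⨯ ∏ᶜ Y) ⟶ A)) (𝟙 (prod.fst : (A ⨯ ∏ᶜ X) ⟶ A))
  snd : ∀ i, HEq (β ▷ ((prod.snd : (A ⨯ ∏ᶜ Y) ⟶ _) ≫ Pi.π Y i))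
    (((prod.snd : (A ⨯ ∏ᶜ X) ⟶ _) ≫ Pi.π X i) ◁ α i)

/-- An ordinary product is a 2-product as soon as a 2-product of the same family exists. -/
theorem IsTwoProduct.of_isProduct {ι : Type*} {X : ι → K} {p : K} {π : ∀ i, p ⟶ X i}
    (hp : IsTwoProduct X p π) {q : K} {ρ : ∀ i, q ⟶ X i}
    (hq : ∀ (Z : K) (f : ∀ i, Z ⟶ X i), ∃! g : Z ⟶ q, ∀ i, g ≫ ρ i = f i) :
    IsTwoProduct X q ρ := by
  refine ⟨hq, fun Z g h α => ?_⟩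
  obtain ⟨e, he, -⟩ := hp.existsUnique_lift q ρ
  obtain ⟨e', he', -⟩ := hq p π
  have hee : e ≫ e' = 𝟙 q := (hq q ρ).unique
    (fun i => by rw [Strict.assoc, he', he]) (fun i => Strict.id_comp _)
  have hg (g : Z ⟶ q) : (g ≫ e) ≫ e' = g := by rw [Strict.assoc, hee, Strict.comp_id]
  have hge (g : Z ⟶ q) (i : ι) : (g ≫ e) ≫ π i = g ≫ ρ i := by rw [Strict.assoc, he]
  obtain ⟨γ, hγ, -⟩ := hp.existsUnique_lift₂ Z (g ≫ e) (h ≫ e)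
    (fun i => eqToHom (hge g i) ≫ α i ≫ eqToHom (hge h i).symm)
  refine ⟨eqToHom (hg g).symm ≫ γ ▷ e' ≫ eqToHom (hg h), fun i => eq_of_heq ?_, fun β hβ => ?_⟩
  · refine (TwoCat.whiskerRight_heq rfl (hg g).symm (hg h).symm
      (TwoCat.eqToHom_conj_heq (hg g).symm (γ ▷ e') (hg h))).trans ?_
    refine (TwoCat.whiskerRight_comp_heq γ e' (ρ i)).symm.trans ?_
    refine (TwoCat.whiskerRight_heq (he' i) rfl rfl HEq.rfl).trans ?_
    rw [hγ i]
    exact TwoCat.eqToHom_conj_heq _ _ _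
  · have hβγ : β ▷ e = γ := by
      refine (hp.existsUnique_lift₂ Z (g ≫ e) (h ≫ e) _).unique (fun i => eq_of_heq ?_) hγ
      refine (TwoCat.whiskerRight_comp_heq β e (π i)).symm.trans ?_
      refine (TwoCat.whiskerRight_heq (he i) rfl rfl HEq.rfl).trans ?_
      rw [hβ i]
      exact (TwoCat.eqToHom_conj_heq _ _ _).symm
    refine eq_of_heq (HEq.trans ?_ (TwoCat.eqToHom_conj_heq (hg g).symm (γ ▷ e') (hg h)).symm)
    rw [← hβγ]
    exact ((TwoCat.whiskerRight_id_heq β).symm.trans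
      (TwoCat.whiskerRight_heq hee.symm rfl rfl HEq.rfl)).trans
      (TwoCat.whiskerRight_comp_heq β e e')

/-- The projections of `A × X₁ × ⋯ × X_k`. -/
noncomputable def paramProj (A : K) {k : ℕ} (X : Fin k → K) (i : Fin (k + 1)) :
    (A ⨯ ∏ᶜ X) ⟶ (Fin.cons A X : Fin (k + 1) → K) i :=
  Fin.cases (motive := fun i => (A ⨯ ∏ᶜ X) ⟶ (Fin.cons A X : Fin (k + 1) → K) i)
    prod.fst (fun i => prod.snd ≫ Pi.π X i) i

theorem isTwoProduct_paramProj (A : K) {k : ℕ} (X : Fin k → K) :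
    IsTwoProduct (Fin.cons A X : Fin (k + 1) → K) (A ⨯ ∏ᶜ X) (paramProj A X) := by
  obtain ⟨p, π, hp⟩ := HasFiniteTwoProducts.exists_isTwoProduct (k + 1)
    (Fin.cons A X : Fin (k + 1) → K)
  refine hp.of_isProduct fun Z f => ?_
  have key (f₀ : Z ⟶ A) (f₁ : ∀ i, Z ⟶ X i) : ∃! g : Z ⟶ A ⨯ ∏ᶜ X,
      g ≫ prod.fst = f₀ ∧ ∀ i, g ≫ prod.snd ≫ Pi.π X i = f₁ i := by
    refine ⟨prod.lift f₀ (Pi.lift f₁), ⟨prod.lift_fst _ _, fun i => ?_⟩, fun g hg => ?_⟩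
    · exact (prod.lift_snd_assoc _ _ _).trans (Pi.lift_π _ _)
    apply prod.hom_ext
    · rw [prod.lift_fst]; exact hg.1
    · rw [prod.lift_snd]
      refine Pi.hom_ext _ _ fun i => ?_
      rw [Pi.lift_π, Category.assoc]
      exact hg.2 i
  obtain ⟨g, hg, hu⟩ := key (f 0) (fun i => f i.succ)
  exact ⟨g, fun i => Fin.cases hg.1 hg.2 i, fun g' hg' => hu g' ⟨hg' 0, fun i => hg' i.succ⟩⟩

theorem paramProduct_ext {A Z : K} {k : ℕ} {X : Fin k → K} {g h : Z ⟶ A ⨯ ∏ᶜ X} {β β' : g ⟶ h}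
    (h₁ : β ▷ (prod.fst : (A ⨯ ∏ᶜ X) ⟶ A) = β' ▷ (prod.fst : (A ⨯ ∏ᶜ X) ⟶ A))
    (h₂ : ∀ i, β ▷ ((prod.snd : (A ⨯ ∏ᶜ X) ⟶ _) ≫ Pi.π X i) =
      β' ▷ ((prod.snd : (A ⨯ ∏ᶜ X) ⟶ _) ≫ Pi.π X i)) : β = β' :=
  ((isTwoProduct_paramProj A X).existsUnique_lift₂ Z g h (fun i => β' ▷ paramProj A X i)).unique
    (Fin.cases h₁ h₂) (fun _ => rfl)

theorem paramMap_fst (A : K) {k : ℕ} {X Y : Fin k → K} (F : ∀ i, X i ⟶ Y i) :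
    paramMap A F ≫ (prod.fst : (A ⨯ ∏ᶜ Y) ⟶ A) = prod.fst := by
  simp

theorem paramMap_snd (A : K) {k : ℕ} {X Y : Fin k → K} (F : ∀ i, X i ⟶ Y i) (i : Fin k) :
    paramMap A F ≫ (prod.snd : (A ⨯ ∏ᶜ Y) ⟶ _) ≫ Pi.π Y i = (prod.snd ≫ Pi.π X i) ≫ F i := by
  simp

theorem existsUnique_isParamMap₂ (A : K) {k : ℕ} {X Y : Fin k → K} {F G : ∀ i, X i ⟶ Y i}
    (α : ∀ i, F i ⟶ G i) : ∃! β : paramMap A F ⟶ paramMap A G, IsParamMap₂ A α β := by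
  obtain ⟨β, hβ, -⟩ := (isTwoProduct_paramProj A Y).existsUnique_lift₂ _ (paramMap A F)
    (paramMap A G) (fun i => Fin.cases
      (motive := fun i => paramMap A F ≫ paramProj A Y i ⟶ paramMap A G ≫ paramProj A Y i)
      (eqToHom ((paramMap_fst A F).trans (paramMap_fst A G).symm))
      (fun i => eqToHom (paramMap_snd A F i) ≫ ((prod.snd : (A ⨯ ∏ᶜ X) ⟶ _) ≫ Pi.π X i) ◁ α i ≫
        eqToHom (paramMap_snd A G i).symm) i)
  have h₀ : β ▷ (prod.fst : (A ⨯ ∏ᶜ Y) ⟶ A) =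
    eqToHom ((paramMap_fst A F).trans (paramMap_fst A G).symm) := hβ 0
  have hs : ∀ i, β ▷ ((prod.snd : (A ⨯ ∏ᶜ Y) ⟶ _) ≫ Pi.π Y i) = eqToHom (paramMap_snd A F i) ≫
    ((prod.snd : (A ⨯ ∏ᶜ X) ⟶ _) ≫ Pi.π X i) ◁ α i ≫ eqToHom (paramMap_snd A G i).symm :=
    fun i => hβ i.succ
  have hp : IsParamMap₂ A α β := by
    refine ⟨?_, fun i => ?_⟩
    · rw [h₀]
      refine HEq.trans ?_ (TwoCat.id_heq (paramMap_fst A F))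
      exact TwoCat.eqToHom_heq_id _
    · rw [hs]
      exact TwoCat.eqToHom_conj_heq _ _ _
  refine ⟨β, hp, fun β' hβ' => paramProduct_ext ?_ fun i => ?_⟩
  · exact eq_of_heq (hβ'.fst.trans hp.fst.symm)
  · exact eq_of_heq ((hβ'.snd i).trans (hp.snd i).symm)

/-- The 2-cell `1 × α₁ × ⋯ × α_k`. -/
noncomputable def paramMap₂ (A : K) {k : ℕ} {X Y : Fin k → K} {F G : ∀ i, X i ⟶ Y i}
    (α : ∀ i, F i ⟶ G i) : paramMap A F ⟶ paramMap A G :=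
  (existsUnique_isParamMap₂ A α).choose

theorem isParamMap₂ (A : K) {k : ℕ} {X Y : Fin k → K} {F G : ∀ i, X i ⟶ Y i}
    (α : ∀ i, F i ⟶ G i) : IsParamMap₂ A α (paramMap₂ A α) :=
  (existsUnique_isParamMap₂ A α).choose_spec.1

theorem IsParamMap₂.eq {A : K} {k : ℕ} {X Y : Fin k → K} {F G : ∀ i, X i ⟶ Y i}
    {α : ∀ i, F i ⟶ G i} {β : paramMap A F ⟶ paramMap A G} (h : IsParamMap₂ A α β) :
    β = paramMap₂ A α :=
  (existsUnique_isParamMap₂ A α).choose_spec.2 β h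

theorem paramMap_comp (A : K) {k : ℕ} {X Y Z : Fin k → K} (F : ∀ i, X i ⟶ Y i)
    (G : ∀ i, Y i ⟶ Z i) : paramMap A F ≫ paramMap A G = paramMap A (fun i => F i ≫ G i) := by
  apply prod.hom_ext
  · simp
  · refine Pi.hom_ext _ _ fun i => ?_
    simp

theorem paramMap_id (A : K) {k : ℕ} (X : Fin k → K) :
    paramMap A (fun i => 𝟙 (X i)) = 𝟙 (A ⨯ ∏ᶜ X) := by
  apply prod.hom_ext
  · simp
  · refine Pi.hom_ext _ _ fun i => ?_
    simp

theorem paramMap₂_id (A : K) {k : ℕ} {X Y : Fin k → K} (F : ∀ i, X i ⟶ Y i) :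
    paramMap₂ A (fun i => 𝟙 (F i)) = 𝟙 (paramMap A F) := by
  refine (IsParamMap₂.eq ⟨?_, fun i => ?_⟩).symm
  · rw [id_whiskerRight]
    exact TwoCat.id_heq (paramMap_fst A F)
  · rw [id_whiskerRight, whiskerLeft_id]
    exact TwoCat.id_heq (paramMap_snd A F i)

theorem paramMap₂_comp (A : K) {k : ℕ} {X Y : Fin k → K} {F G H : ∀ i, X i ⟶ Y i}
    (α : ∀ i, F i ⟶ G i) (β : ∀ i, G i ⟶ H i) :
    paramMap₂ A (fun i => α i ≫ β i) = paramMap₂ A α ≫ paramMap₂ A β := by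
  refine (IsParamMap₂.eq ⟨?_, fun i => ?_⟩).symm
  · rw [comp_whiskerRight]
    refine (TwoCat.comp_heq (paramMap_fst A F) (paramMap_fst A G) (paramMap_fst A H)
      (isParamMap₂ A α).fst (isParamMap₂ A β).fst).trans ?_
    rw [Category.comp_id]
  · rw [comp_whiskerRight, whiskerLeft_comp]
    exact TwoCat.comp_heq (paramMap_snd A F i) (paramMap_snd A G i) (paramMap_snd A H i)
      ((isParamMap₂ A α).snd i) ((isParamMap₂ A β).snd i)

/-- Recognition of `1 × α^k` up to equality of the source and target. -/
theorem paramMap₂_heq (A : K) {k : ℕ} {X Y : Fin k → K} {F G : ∀ i, X i ⟶ Y i}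
    (α : ∀ i, F i ⟶ G i) {f g : (A ⨯ ∏ᶜ X) ⟶ (A ⨯ ∏ᶜ Y)} (hf : f = paramMap A F)
    (hg : g = paramMap A G) {β : f ⟶ g}
    (h₁ : HEq (β ▷ (prod.fst : (A ⨯ ∏ᶜ Y) ⟶ A)) (𝟙 (prod.fst : (A ⨯ ∏ᶜ X) ⟶ A)))
    (h₂ : ∀ i, HEq (β ▷ ((prod.snd : (A ⨯ ∏ᶜ Y) ⟶ _) ≫ Pi.π Y i))
      (((prod.snd : (A ⨯ ∏ᶜ X) ⟶ _) ≫ Pi.π X i) ◁ α i)) :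
    HEq (paramMap₂ A α) β := by
  subst hf hg
  exact heq_of_eq (IsParamMap₂.eq ⟨h₁, h₂⟩).symm

theorem paramMap₂_whiskerLeft (A : K) {k : ℕ} {X Y Z : Fin k → K} (F : ∀ i, X i ⟶ Y i)
    {G H : ∀ i, Y i ⟶ Z i} (β : ∀ i, G i ⟶ H i) :
    HEq (paramMap₂ A (fun i => F i ◁ β i)) (paramMap A F ◁ paramMap₂ A β) := by
  refine paramMap₂_heq A _ (paramMap_comp A F G) (paramMap_comp A F H) ?_ fun i => ?_
  · refine (TwoCat.whisker_assoc_heq _ _ _).trans ?_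
    refine (TwoCat.whiskerLeft_heq rfl (paramMap_fst A G) (paramMap_fst A H)
      (isParamMap₂ A β).fst).trans ?_
    rw [whiskerLeft_id]
    exact TwoCat.id_heq (paramMap_fst A F)
  · refine (TwoCat.whisker_assoc_heq _ _ _).trans ?_
    refine (TwoCat.whiskerLeft_heq rfl (paramMap_snd A G i) (paramMap_snd A H i)
      ((isParamMap₂ A β).snd i)).trans ?_
    refine (TwoCat.comp_whiskerLeft_heq _ _ _).symm.trans ?_
    refine (TwoCat.whiskerLeft_heq (paramMap_snd A F i) rfl rfl HEq.rfl).trans ?_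
    exact TwoCat.comp_whiskerLeft_heq _ _ _

theorem paramMap₂_whiskerRight (A : K) {k : ℕ} {X Y Z : Fin k → K} {F G : ∀ i, X i ⟶ Y i}
    (α : ∀ i, F i ⟶ G i) (H : ∀ i, Y i ⟶ Z i) :
    HEq (paramMap₂ A (fun i => α i ▷ H i)) (paramMap₂ A α ▷ paramMap A H) := by
  refine paramMap₂_heq A _ (paramMap_comp A F H) (paramMap_comp A G H) ?_ fun i => ?_
  · refine (TwoCat.whiskerRight_comp_heq _ _ _).symm.trans ?_
    refine (TwoCat.whiskerRight_heq (paramMap_fst A H) rfl rfl HEq.rfl).trans ?_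
    exact (isParamMap₂ A α).fst
  · refine (TwoCat.whiskerRight_comp_heq _ _ _).symm.trans ?_
    refine (TwoCat.whiskerRight_heq (paramMap_snd A H i) rfl rfl HEq.rfl).trans ?_
    refine (TwoCat.whiskerRight_comp_heq _ _ _).trans ?_
    refine (TwoCat.whiskerRight_heq rfl (paramMap_snd A F i) (paramMap_snd A G i)
      ((isParamMap₂ A α).snd i)).trans ?_
    exact TwoCat.whisker_assoc_heq _ _ _

end ParamProduct

/-! ### The 2-category of `(K, P)`-categories, strict functors and icons -/

namespace KPCat

variable {K : Type u} [Bicategory.{w₂, v} K] [Strict K] [HasFiniteTwoProducts K] {P : Operad K}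

/-- A graph morphism is a strict `(K, P)`-functor if it commutes with composition. -/
def IsFunctor (X Y : KPCat.{w} P) (F : X.graph ⟶ Y.graph) : Prop :=
  ∀ ⦃k : ℕ⦄ ⦃s t : Fin k → X.graph.Obj⦄ ⦃a b : X.graph.Obj⦄ (h : IsPath a b s t),
    X.act h ≫ F.map a b =
      paramMap (P.obj k) (fun i => F.map (s i) (t i)) ≫ Y.act (h.map F.obj)

/-- A 2-cell of graphs `α : F ⟶ G` (so `F` and `G` agree on objects) is a `(K, P)`-icon if
`m ◁ α = (1 × α^k) ▷ m'` for all composition maps `m` of `X` and `m'` of `Y`; for functors `F` and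
`G` the types of the two sides agree. -/
def IsIcon (X Y : KPCat.{w} P) : ∀ {F G : X.graph ⟶ Y.graph}, (F ⟶ G) → Prop
  | _, _, KGraph.Hom₂.mk f α =>
    ∀ ⦃k : ℕ⦄ ⦃s t : Fin k → X.graph.Obj⦄ ⦃a b : X.graph.Obj⦄ (h : IsPath a b s t),
      HEq (X.act h ◁ α a b)
        (paramMap₂ (P.obj k) (fun i => α (s i) (t i)) ▷ Y.act (h.map f))

variable (P) in
/-- `(K, P)`-categories, with strict functors and icons among the cells of the 2-category of
`K`-graphs. -/
def iconStructure : StructureOver (KGraph.{w} K) (KPCat.{w} P) where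
  obj X := X.graph
  IsHom {X Y} F := IsFunctor X Y F
  IsHom₂ X Y _ _ α := IsIcon X Y α
  isHom_id X := by
    intro k s t a b h
    refine (Strict.comp_id _).trans ?_
    exact (Strict.id_comp _).symm.trans
      (congrArg (· ≫ X.act h) (paramMap_id (P.obj k) fun i => X.graph.hom (s i) (t i)).symm)
  isHom_comp {X Y Z F G} hF hG := by
    intro k s t a b h
    refine (Strict.assoc _ _ _).symm.trans ?_
    rw [hF h, Strict.assoc, hG (h.map F.obj), ← Strict.assoc, paramMap_comp]
    rfl
  isHom₂_id {X Y F} hF := by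
    obtain ⟨f, F⟩ := F
    intro k s t a b h
    rw [whiskerLeft_id, paramMap₂_id, id_whiskerRight]
    exact TwoCat.id_heq (hF h)
  isHom₂_comp {X Y F G H α β} hF hG hH hα hβ := by
    obtain ⟨f, α⟩ := α
    obtain ⟨_, β⟩ := β
    intro k s t a b h
    rw [whiskerLeft_comp, paramMap₂_comp, comp_whiskerRight]
    exact TwoCat.comp_heq (hF h) (hG h) (hH h) (hα h) (hβ h)
  isHom₂_whiskerLeft {X Y Z F G H β} hF hG hH hβ := by
    obtain ⟨g, β⟩ := β
    intro k s t a b h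
    refine (TwoCat.comp_whiskerLeft_heq _ _ _).symm.trans ?_
    refine (TwoCat.whiskerLeft_heq (hF h) rfl rfl HEq.rfl).trans ?_
    refine (TwoCat.comp_whiskerLeft_heq _ _ _).trans ?_
    refine (TwoCat.whiskerLeft_heq rfl (hG _) (hH _) (hβ _)).trans ?_
    refine (TwoCat.whisker_assoc_heq _ _ _).symm.trans ?_
    exact TwoCat.whiskerRight_heq rfl (paramMap_comp _ _ _) (paramMap_comp _ _ _)
      (paramMap₂_whiskerLeft _ _ _).symm
  isHom₂_whiskerRight {X Y Z F G H α} hF hG hH hα := by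
    obtain ⟨f, α⟩ := α
    intro k s t a b h
    refine (TwoCat.whisker_assoc_heq _ _ _).symm.trans ?_
    refine (TwoCat.whiskerRight_heq rfl (hF h) (hG h) (hα h)).trans ?_
    refine (TwoCat.whiskerRight_comp_heq _ _ _).symm.trans ?_
    refine (TwoCat.whiskerRight_heq (hH _) rfl rfl HEq.rfl).trans ?_
    refine (TwoCat.whiskerRight_comp_heq _ _ _).trans ?_
    exact TwoCat.whiskerRight_heq rfl (paramMap_comp _ _ _) (paramMap_comp _ _ _)
      (paramMap₂_whiskerRight _ _ _).symm

/-- The 2-category of `(K, P)`-categories, strict `(K, P)`-functors and `(K, P)`-icons. -/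
noncomputable instance : Bicategory (KPCat.{w} P) := (iconStructure P).bicategory

instance : Strict (KPCat.{w} P) := (iconStructure P).strict

variable (P) in
/-- The forgetful 2-functor to `K`-graphs. -/
noncomputable def forget : StrictPseudofunctor (KPCat.{w} P) (KGraph.{w} K) :=
  (iconStructure P).forget

/-- `M` is the free `(K, P)`-category monad on the 1-category of `K`-graphs: it is induced by an
adjunction `F ⊣ U`, where `U` is the forgetful functor from `(K, P)`-categories, the unit `η` of
which identifies the objects of `X` with those of `F X` and for which
`F X (a, b) = ∐ P(k) × X(x_{k-1}, x_k) × ⋯ × X(x_0, x_1)`, the coproduct taken over all paths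
`a = x_0, …, x_k = b` in `X`, with injections given by mapping the edges of the path along `η` and
composing in `F X`. -/
def IsFreeMonad (P : Operad K) (M : Monad (KGraph.{w} K)) : Prop :=
  ∃ (F : KGraph.{w} K ⥤ KPCat.{w} P) (adj : F ⊣ (forget P).toFunctor),
    adj.toMonad = M ∧
    ∀ (X : KGraph.{w} K) (η : X ⟶ (F.obj X).graph), η = adj.unit.app X →
      Function.Bijective η.obj ∧
      ∀ a b : X.Obj, IsTwoCoproduct
        (fun p : PathIn a b => P.obj p.len ⨯ ∏ᶜ fun i => X.hom (p.src i) (p.tgt i))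
        ((F.obj X).graph.hom (η.obj a) (η.obj b))
        (fun p => paramMap (P.obj p.len) (fun i => η.map (p.src i) (p.tgt i)) ≫
          (F.obj X).act (p.isPath.map η.obj))

end KPCat

/-! ### The 2-cells of a strict 2-category as generalised arrows -/

/-! The hom-objects of the free category on `X` are coproducts, over paths, of `P(k)` times the
hom-objects along the path. Distributivity makes finite products preserve coproducts in every
variable (`isTwoCoproduct_paramMap`), so a composition map out of a product of such coproducts may
be prescribed summand by summand: concatenate the paths and multiply the operad parameters. The unit
and associativity laws then reduce to those of the operad and of concatenation (`freeAct_unit`,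
`freeAct_mul`). Every element of a summand is a composite of edges of `X` (`freeElt_eq_eltAct`), so
a graph morphism from `X` into a `(K, P)`-category, or a 2-cell between such morphisms, extends
uniquely (`existsUnique_freeExtension`). This is a 2-universal arrow, and a family of such arrows
assembles into a left 2-adjoint.

Monadicity holds for every left 2-adjoint `F` of the forgetful 2-functor `U` and needs no criterion
of Beck type. The counit `F U X ⟶ X` is split in graphs by the unit, and a graph morphism or 2-cell
out of `X` respects composition as soon as its restriction along the counit does
(`IsFun.of_section`). Hence algebra maps are functors, algebra 2-cells are icons, and two categories
with the same algebra coincide because the identity between them is a functor. Conversely, an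
algebra `a : F A ⟶ A` composes elements of `A` by sending them to `F A` along the unit, composing
there and applying `a`. The algebra law says that `a` of a composite depends only on `a` of the
factors (`algebra_elt_act`); this gives associativity and makes `a` a functor, which must be the
counit (`eq_counit`).

Products are formed hom by hom. A coproduct is the disjoint union, with an initial object of `K` as
hom-object between different summands. Initial objects of `K` are strict, so at a non-initial stage
no element joins two summands and a composable family is composed inside a single summand; at an
initial stage there is nothing to compare but endpoints. Multiplication by a fixed category
preserves this description of coproducts, which is distributivity.

Two devices keep dependent types away. A 2-cell is packaged with its source and target (`Cell`):
heterogeneous equations become equations, a strict 2-dimensional universal property becomes one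
unique existence statement, and 1-cells are included as identity 2-cells. Elements of hom-objects
are packaged with their endpoints (`Edge`), so that no transport along equalities of objects is
needed. -/

namespace TwoCat

/-- A 2-cell of a 2-category together with its source and target. -/
structure Cell {B : Type u} [Bicategory.{w₂, v} B] (a b : B) where
  {src tgt : a ⟶ b}
  cell : src ⟶ tgt

namespace Cell

section

variable {B : Type u} [Bicategory.{w₂, v} B] {a b c d : B}

theorem mk_eq_mk {f g f' g' : a ⟶ b} {η : f ⟶ g} {η' : f' ⟶ g'} (hf : f = f') (hg : g = g')
    (h : HEq η η') : Cell.mk η = Cell.mk η' := by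
  subst hf hg; cases h; rfl

theorem heq_of_mk_eq_mk {f g f' g' : a ⟶ b} {η : f ⟶ g} {η' : f' ⟶ g'}
    (h : Cell.mk η = Cell.mk η') : HEq η η' := by
  cases h; rfl

theorem eq_of_mk_eq_mk {f g : a ⟶ b} {η η' : f ⟶ g} (h : Cell.mk η = Cell.mk η') : η = η' :=
  eq_of_heq (heq_of_mk_eq_mk h)

/-- Replaces transport of a 2-cell along equalities of its source and target. -/
theorem exists_mk_eq {f g : a ⟶ b} (α : Cell a b) (hf : α.src = f) (hg : α.tgt = g) :
    ∃ η : f ⟶ g, Cell.mk η = α := by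
  subst hf hg; exact ⟨α.cell, rfl⟩

theorem mk_eqToHom_conj {f f' g g' : a ⟶ b} (hf : f = f') (η : f' ⟶ g') (hg : g' = g) :
    Cell.mk (eqToHom hf ≫ η ≫ eqToHom hg) = Cell.mk η := by
  subst hf hg; simp

/-- The identity 2-cell on a 1-cell. -/
def ofHom (f : a ⟶ b) : Cell a b := ⟨𝟙 f⟩

theorem ofHom_injective {f g : a ⟶ b} (h : ofHom f = ofHom g) : f = g :=
  congrArg Cell.src h

/-- Whiskering with a 1-cell on the left. -/
def pre (f : a ⟶ b) (α : Cell b c) : Cell a c := ⟨f ◁ α.cell⟩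

/-- Whiskering with a 1-cell on the right. -/
def post (α : Cell a b) (g : b ⟶ c) : Cell a c := ⟨α.cell ▷ g⟩

@[simp] theorem pre_ofHom (f : a ⟶ b) (g : b ⟶ c) : pre f (ofHom g) = ofHom (f ≫ g) := by
  simp [pre, ofHom]

@[simp] theorem post_ofHom (f : a ⟶ b) (g : b ⟶ c) : post (ofHom f) g = ofHom (f ≫ g) := by
  simp [post, ofHom]

end

variable {B : Type u} [Bicategory.{w₂, v} B] [Strict B] {a b c d : B}

@[simp] theorem pre_id (α : Cell a b) : pre (𝟙 a) α = α :=
  mk_eq_mk (Strict.id_comp _) (Strict.id_comp _) (id_whiskerLeft_heq _)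

@[simp] theorem post_id (α : Cell a b) : post α (𝟙 b) = α :=
  mk_eq_mk (Strict.comp_id _) (Strict.comp_id _) (whiskerRight_id_heq _)

theorem pre_pre (f : a ⟶ b) (g : b ⟶ c) (α : Cell c d) : pre f (pre g α) = pre (f ≫ g) α :=
  (mk_eq_mk (Strict.assoc _ _ _) (Strict.assoc _ _ _) (comp_whiskerLeft_heq _ _ _)).symm

theorem post_post (α : Cell a b) (f : b ⟶ c) (g : c ⟶ d) : post (post α f) g = post α (f ≫ g) :=
  (mk_eq_mk (Strict.assoc _ _ _).symm (Strict.assoc _ _ _).symm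
    (whiskerRight_comp_heq _ _ _)).symm

theorem post_pre (f : a ⟶ b) (α : Cell b c) (g : c ⟶ d) : post (pre f α) g = pre f (post α g) :=
  mk_eq_mk (Strict.assoc _ _ _) (Strict.assoc _ _ _) (whisker_assoc_heq _ _ _)

end Cell

end TwoCat

open TwoCat

/-! ### Two-dimensional universal properties in terms of packaged 2-cells. -/

section Universal

variable {B : Type u} [Bicategory.{w₂, v} B]

/-- An isomorphism of hom-categories is already determined by being a bijection on arrows: objects
are recovered as sources of identity arrows. Both levels of the universal property are thus handled
at once in all later arguments. -/
theorem isTwoCoproduct_iff {ι : Type*} {X : ι → B} {c : B} {j : ∀ i, X i ⟶ c} :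
    IsTwoCoproduct X c j ↔ ∀ (Z : B) (α : ∀ i, Cell (X i) Z), ∃! β : Cell c Z,
      ∀ i, β.pre (j i) = α i := by
  constructor
  · intro h Z α
    obtain ⟨f, hf, hf'⟩ := h.existsUnique_desc Z (fun i => (α i).src)
    obtain ⟨g, hg, hg'⟩ := h.existsUnique_desc Z (fun i => (α i).tgt)
    have key : ∀ i, ∃ γ : j i ≫ f ⟶ j i ≫ g, Cell.mk γ = α i := fun i =>
      (α i).exists_mk_eq (hf i).symm (hg i).symm
    choose γ hγ using key
    obtain ⟨β, hβ, hβ'⟩ := h.existsUnique_desc₂ Z f g γ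
    refine ⟨⟨β⟩, fun i => ?_, ?_⟩
    · rw [← hγ i, ← hβ i]; rfl
    · rintro ⟨δ⟩ hδ
      rename_i f₁ g₁
      obtain rfl := hf' f₁ (fun i => congrArg Cell.src (hδ i))
      obtain rfl := hg' g₁ (fun i => congrArg Cell.tgt (hδ i))
      rw [hβ' δ fun i => Cell.eq_of_mk_eq_mk ((hδ i).trans (hγ i).symm)]
  · intro h
    -- Uniqueness for 1-cells is uniqueness for their identity 2-cells.
    have inj : ∀ (Z : B) (g g' : c ⟶ Z), (∀ i, j i ≫ g = j i ≫ g') → g = g' := fun Z g g' e =>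
      Cell.ofHom_injective ((h Z fun i => Cell.ofHom (j i ≫ g)).unique
        (fun i => Cell.pre_ofHom _ _) (fun i => by rw [Cell.pre_ofHom, e i]))
    refine ⟨fun Z f => ?_, fun Z g g' α => ?_⟩
    · obtain ⟨β, hβ, -⟩ := h Z (fun i => Cell.ofHom (f i))
      exact ⟨β.src, fun i => congrArg Cell.src (hβ i), fun g hg => inj _ _ _ fun i =>
        (hg i).trans (congrArg Cell.src (hβ i)).symm⟩
    · obtain ⟨β, hβ, hu⟩ := h Z (fun i => ⟨α i⟩)
      obtain ⟨β, rfl⟩ := β.exists_mk_eq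
        (inj _ _ g fun i => congrArg Cell.src (hβ i)) (inj _ _ g' fun i => congrArg Cell.tgt (hβ i))
      exact ⟨β, fun i => Cell.eq_of_mk_eq_mk (hβ i), fun γ hγ => Cell.eq_of_mk_eq_mk
        (hu ⟨γ⟩ fun i => congrArg Cell.mk (hγ i))⟩

theorem isTwoProduct_iff {ι : Type*} {X : ι → B} {p : B} {π : ∀ i, p ⟶ X i} :
    IsTwoProduct X p π ↔ ∀ (Z : B) (α : ∀ i, Cell Z (X i)), ∃! β : Cell Z p,
      ∀ i, β.post (π i) = α i := by
  constructor
  · intro h Z α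
    obtain ⟨f, hf, hf'⟩ := h.existsUnique_lift Z (fun i => (α i).src)
    obtain ⟨g, hg, hg'⟩ := h.existsUnique_lift Z (fun i => (α i).tgt)
    have key : ∀ i, ∃ γ : f ≫ π i ⟶ g ≫ π i, Cell.mk γ = α i := fun i =>
      (α i).exists_mk_eq (hf i).symm (hg i).symm
    choose γ hγ using key
    obtain ⟨β, hβ, hβ'⟩ := h.existsUnique_lift₂ Z f g γ
    refine ⟨⟨β⟩, fun i => ?_, ?_⟩
    · rw [← hγ i, ← hβ i]; rfl
    · rintro ⟨δ⟩ hδ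
      rename_i f₁ g₁
      obtain rfl := hf' f₁ (fun i => congrArg Cell.src (hδ i))
      obtain rfl := hg' g₁ (fun i => congrArg Cell.tgt (hδ i))
      rw [hβ' δ fun i => Cell.eq_of_mk_eq_mk ((hδ i).trans (hγ i).symm)]
  · intro h
    have inj : ∀ (Z : B) (g g' : Z ⟶ p), (∀ i, g ≫ π i = g' ≫ π i) → g = g' := fun Z g g' e =>
      Cell.ofHom_injective ((h Z fun i => Cell.ofHom (g ≫ π i)).unique
        (fun i => Cell.post_ofHom _ _) (fun i => by rw [Cell.post_ofHom, e i]))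
    refine ⟨fun Z f => ?_, fun Z g g' α => ?_⟩
    · obtain ⟨β, hβ, -⟩ := h Z (fun i => Cell.ofHom (f i))
      exact ⟨β.src, fun i => congrArg Cell.src (hβ i), fun g hg => inj _ _ _ fun i =>
        (hg i).trans (congrArg Cell.src (hβ i)).symm⟩
    · obtain ⟨β, hβ, hu⟩ := h Z (fun i => ⟨α i⟩)
      obtain ⟨β, rfl⟩ := β.exists_mk_eq
        (inj _ _ g fun i => congrArg Cell.src (hβ i)) (inj _ _ g' fun i => congrArg Cell.tgt (hβ i))
      exact ⟨β, fun i => Cell.eq_of_mk_eq_mk (hβ i), fun γ hγ => Cell.eq_of_mk_eq_mk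
        (hu ⟨γ⟩ fun i => congrArg Cell.mk (hγ i))⟩

namespace IsTwoCoproduct

variable {ι : Type*} {X : ι → B} {c : B} {j : ∀ i, X i ⟶ c}

theorem hom_ext (h : IsTwoCoproduct X c j) {Z : B} {f g : c ⟶ Z}
    (e : ∀ i, j i ≫ f = j i ≫ g) : f = g :=
  (h.existsUnique_desc Z fun i => j i ≫ g).unique e fun _ => rfl

theorem cell_ext (h : IsTwoCoproduct X c j) {Z : B} {α β : Cell c Z}
    (e : ∀ i, α.pre (j i) = β.pre (j i)) : α = β :=
  (isTwoCoproduct_iff.1 h Z fun i => β.pre (j i)).unique e fun _ => rfl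

theorem exists_desc (h : IsTwoCoproduct X c j) {Z : B} (f : ∀ i, X i ⟶ Z) :
    ∃ g : c ⟶ Z, ∀ i, j i ≫ g = f i :=
  (h.existsUnique_desc Z f).exists

theorem exists_cellDesc (h : IsTwoCoproduct X c j) {Z : B} (α : ∀ i, Cell (X i) Z) :
    ∃ β : Cell c Z, ∀ i, β.pre (j i) = α i :=
  (isTwoCoproduct_iff.1 h Z α).exists

variable [Strict B]

/-- Invariance under reindexing and isomorphism, needed because the products occurring later are
only isomorphic to those for which distributivity is known. -/
theorem of_iso (h : IsTwoCoproduct X c j) {ι' : Type*} {X' : ι' → B} {c' : B}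
    {j' : ∀ i, X' i ⟶ c'} (σ : ι' ≃ ι) (u : ∀ i, X' i ≅ X (σ i)) (e : c' ≅ c)
    (w : ∀ i, j' i ≫ e.hom = (u i).hom ≫ j (σ i)) : IsTwoCoproduct X' c' j' := by
  rw [isTwoCoproduct_iff] at h ⊢
  intro Z α
  obtain ⟨γ, hγ, hu⟩ := h Z fun i =>
    (σ.apply_symm_apply i) ▸ (α (σ.symm i)).pre (u (σ.symm i)).inv
  have hγ' : ∀ i, γ.pre (j (σ i)) = (α i).pre (u i).inv := by
    intro i
    rw [hγ]
    -- Generalising `σ.symm (σ i)` to a variable `k` lets the transport be removed by substitution.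
    have : ∀ (k : ι') (hk : k = i) (hk' : σ k = σ i),
        hk' ▸ (α k).pre (u k).inv = (α i).pre (u i).inv := by
      rintro k rfl hk'; rfl
    exact this _ (σ.symm_apply_apply i) _
  refine ⟨γ.pre e.hom, fun i => ?_, fun β hβ => ?_⟩
  · rw [Cell.pre_pre, w, ← Cell.pre_pre, hγ', Cell.pre_pre, Iso.hom_inv_id, Cell.pre_id]
  · have : β.pre e.inv = γ := by
      refine (h Z fun i => γ.pre (j i)).unique (fun i => ?_) (fun _ => rfl)
      obtain ⟨i, rfl⟩ := σ.surjective i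
      have w' : j (σ i) ≫ e.inv = (u i).inv ≫ j' i := by
        rw [Iso.comp_inv_eq, Category.assoc, w, Iso.inv_hom_id_assoc]
      rw [Cell.pre_pre, w', ← Cell.pre_pre, hβ, hγ']
    rw [← this, Cell.pre_pre, Iso.hom_inv_id, Cell.pre_id]

/-- A coproduct of coproducts is a coproduct over the total index type; it drives the induction on
the number of factors. -/
theorem sigma (h : IsTwoCoproduct X c j) {κ : ι → Type*} {Y : ∀ i, κ i → B}
    {l : ∀ i k, Y i k ⟶ X i} (hl : ∀ i, IsTwoCoproduct (Y i) (X i) (l i)) :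
    IsTwoCoproduct (fun x : Σ i, κ i => Y x.1 x.2) c (fun x => l x.1 x.2 ≫ j x.1) := by
  rw [isTwoCoproduct_iff]
  intro Z α
  choose β hβ using fun i => (hl i).exists_cellDesc fun k => α ⟨i, k⟩
  obtain ⟨γ, hγ⟩ := h.exists_cellDesc β
  refine ⟨γ, fun ⟨i, k⟩ => ?_, fun γ' hγ' => h.cell_ext fun i => (hl i).cell_ext fun k => ?_⟩
  · rw [← Cell.pre_pre, hγ, hβ]
  · rw [hγ, hβ, Cell.pre_pre]; exact hγ' ⟨i, k⟩

end IsTwoCoproduct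

namespace IsTwoProduct

variable {ι : Type*} {X : ι → B} {p : B} {π : ∀ i, p ⟶ X i}

theorem cell_ext (h : IsTwoProduct X p π) {Z : B} {α β : Cell Z p}
    (e : ∀ i, α.post (π i) = β.post (π i)) : α = β :=
  (isTwoProduct_iff.1 h Z fun i => β.post (π i)).unique e fun _ => rfl

theorem exists_cellLift (h : IsTwoProduct X p π) {Z : B} (α : ∀ i, Cell Z (X i)) :
    ∃ β : Cell Z p, ∀ i, β.post (π i) = α i :=
  (isTwoProduct_iff.1 h Z α).exists

end IsTwoProduct

end Universal

/-! ### Rearranging products with a parameter. -/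

section OneDimensional

variable {V : Type u} [Category.{v} V] [HasFiniteProducts V]

theorem prod.hom_ext_param {A Z : V} {k : ℕ} {X : Fin k → V} {f g : Z ⟶ A ⨯ ∏ᶜ X}
    (h : f ≫ prod.fst = g ≫ prod.fst)
    (h' : ∀ i, f ≫ prod.snd ≫ Pi.π X i = g ≫ prod.snd ≫ Pi.π X i) : f = g := by
  apply prod.hom_ext h
  refine Pi.hom_ext _ _ fun i => ?_
  simpa using h' i

theorem prod.eq_lift_param {A Z : V} {k : ℕ} {X : Fin k → V} (f : Z ⟶ A ⨯ ∏ᶜ X) :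
    f = prod.lift (f ≫ prod.fst) (Pi.lift fun i => f ≫ prod.snd ≫ Pi.π X i) :=
  prod.hom_ext_param (by rw [prod.lift_fst])
    fun i => by rw [prod.lift_snd_assoc, Pi.lift_π]

attribute [local simp] prod.lift_fst prod.lift_snd prod.lift_fst_assoc prod.lift_snd_assoc
  prod.map_fst prod.map_snd prod.map_fst_assoc prod.map_snd_assoc Pi.lift_π Pi.lift_π_assoc
  Pi.map_π Pi.map_π_assoc

attribute [-simp] prod.comp_lift prod.lift_map

/-- Splitting off the first factor of the product in `A × X₁ × ⋯ × X_k`. -/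
noncomputable def paramCons (A : V) {k : ℕ} (X : Fin (k + 1) → V) :
    (A ⨯ ∏ᶜ X) ≅ ((A ⨯ X 0) ⨯ ∏ᶜ fun i : Fin k => X i.succ) where
  hom := prod.lift (prod.lift prod.fst (prod.snd ≫ Pi.π X 0))
    (Pi.lift fun i => prod.snd ≫ Pi.π X i.succ)
  inv := prod.lift (prod.fst ≫ prod.fst) (Pi.lift fun i => Fin.cases
    (motive := fun i => ((A ⨯ X 0) ⨯ ∏ᶜ fun i : Fin k => X i.succ) ⟶ X i)
    (prod.fst ≫ prod.snd) (fun i => prod.snd ≫ Pi.π _ i) i)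
  hom_inv_id := by
    refine prod.hom_ext_param (by simp) (Fin.cases (by simp) fun i => by simp)
  inv_hom_id := by
    refine prod.hom_ext_param (prod.hom_ext (by simp) (by simp)) fun i => by simp

theorem paramCons_natural (A : V) {k : ℕ} {X Y : Fin (k + 1) → V} (F : ∀ i, X i ⟶ Y i) :
    prod.map (𝟙 A) (Limits.Pi.map F) ≫ (paramCons A Y).hom = (paramCons A X).hom ≫
      prod.map (prod.map (𝟙 A) (F 0)) (Limits.Pi.map fun i : Fin k => F i.succ) := by
  refine prod.hom_ext_param (prod.hom_ext ?_ ?_) fun i => ?_ <;> simp [paramCons]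

/-- Varying first the later factors and then the initial one matches the composite injections of
`IsTwoCoproduct.sigma`. -/
theorem paramMap_sigma (A : V) {k : ℕ} {X Y : Fin (k + 1) → V} (F : ∀ i, X i ⟶ Y i) :
    prod.map (prod.map (𝟙 A) (F 0)) (Limits.Pi.map fun i : Fin k => F i.succ) =
    prod.map (𝟙 (A ⨯ X 0)) (Limits.Pi.map fun i : Fin k => F i.succ) ≫
      prod.map (prod.map (𝟙 A) (F 0)) (𝟙 _) := by
  simp

end OneDimensional

/-! ### Tupling of 2-cells into products. -/

section Products

variable {K : Type u} [Bicategory.{w₂, v} K] [Strict K] [HasFiniteTwoProducts K]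

theorem TwoCat.Cell.param_ext {A Z : K} {k : ℕ} {X : Fin k → K} {α β : Cell Z (A ⨯ ∏ᶜ X)}
    (h : α.post prod.fst = β.post prod.fst)
    (h' : ∀ i, α.post (prod.snd ≫ Pi.π X i) = β.post (prod.snd ≫ Pi.π X i)) : α = β :=
  (isTwoProduct_paramProj A X).cell_ext (Fin.cases h h')

theorem TwoCat.Cell.exists_param {A Z : K} {k : ℕ} {X : Fin k → K} (p : Cell Z A)
    (f : ∀ i, Cell Z (X i)) : ∃ α : Cell Z (A ⨯ ∏ᶜ X), α.post prod.fst = p ∧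
      ∀ i, α.post (prod.snd ≫ Pi.π X i) = f i := by
  obtain ⟨α, hα⟩ := (isTwoProduct_paramProj A X).exists_cellLift (Z := Z)
    (fun i => Fin.cases (motive := fun i => Cell Z ((Fin.cons A X : Fin (k + 1) → K) i)) p f i)
  exact ⟨α, hα 0, fun i => hα i.succ⟩

/-- The 2-cell into `A × X₁ × ⋯ × X_k` with given components. -/
noncomputable def TwoCat.Cell.param {A Z : K} {k : ℕ} {X : Fin k → K} (p : Cell Z A)
    (f : ∀ i, Cell Z (X i)) : Cell Z (A ⨯ ∏ᶜ X) :=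
  (Cell.exists_param p f).choose

namespace TwoCat.Cell

section

variable {A Z : K} {k : ℕ} {X : Fin k → K}

@[simp] theorem param_fst (p : Cell Z A) (f : ∀ i, Cell Z (X i)) :
    (param p f).post prod.fst = p :=
  (Cell.exists_param p f).choose_spec.1

@[simp] theorem param_snd (p : Cell Z A) (f : ∀ i, Cell Z (X i)) (i : Fin k) :
    (param p f).post (prod.snd ≫ Pi.π X i) = f i :=
  (Cell.exists_param p f).choose_spec.2 i

theorem pre_param {W : K} (g : W ⟶ Z) (p : Cell Z A) (f : ∀ i, Cell Z (X i)) :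
    (param p f).pre g = param (p.pre g) (fun i => (f i).pre g) := by
  apply param_ext
  · rw [post_pre, param_fst, param_fst]
  · intro i; rw [post_pre, param_snd, param_snd]

theorem param_ofHom (p : Z ⟶ A) (f : ∀ i, Z ⟶ X i) :
    param (ofHom p) (fun i => ofHom (f i)) = ofHom (prod.lift p (Pi.lift f)) := by
  apply param_ext
  · rw [param_fst, post_ofHom, prod.lift_fst]
  · intro i; rw [param_snd, post_ofHom, prod.lift_snd_assoc, Pi.lift_π]

/-- Used to turn axioms about generalised elements, which are 1-cells, into the same equations for
2-cells. -/
theorem post_lift {W : K} (c : Cell W Z) (p : Z ⟶ A) (f : ∀ i, Z ⟶ X i) :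
    c.post (prod.lift p (Pi.lift f)) = param (c.post p) (fun i => c.post (f i)) := by
  apply param_ext
  · rw [param_fst, post_post, prod.lift_fst]
  · intro i; rw [param_snd, post_post, prod.lift_snd_assoc, Pi.lift_π]

theorem post_lift_comp {W D : K} (c : Cell W Z) (p : Z ⟶ A) (f : ∀ i, Z ⟶ X i)
    (g : (A ⨯ ∏ᶜ X) ⟶ D) : c.post (prod.lift p (Pi.lift f) ≫ g) =
      (param (c.post p) (fun i => c.post (f i))).post g := by
  rw [← post_post, post_lift]

theorem post_fst_comp {D : K} (p : Cell Z A) (f : ∀ i, Cell Z (X i)) (g : A ⟶ D) :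
    (param p f).post (prod.fst ≫ g) = p.post g := by
  rw [← post_post, param_fst]

/-- Rewrites the 2-cell of the icon condition as a tuple, so that compatibility with composition can
be calculated on components. -/
theorem mk_paramMap₂ {Y : Fin k → K} {F G : ∀ i, X i ⟶ Y i} (α : ∀ i, F i ⟶ G i) :
    Cell.mk (paramMap₂ A α) = param (ofHom prod.fst) (fun i => pre (prod.snd ≫ Pi.π X i) ⟨α i⟩) := by
  apply param_ext
  · rw [param_fst]
    exact mk_eq_mk (paramMap_fst A F) (paramMap_fst A G) (isParamMap₂ A α).fst
  · intro i
    rw [param_snd]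
    exact mk_eq_mk (paramMap_snd A F i) (paramMap_snd A G i) ((isParamMap₂ A α).snd i)

end

end TwoCat.Cell

/-- A cone with the universal property of a binary product for 1-cells has it for 2-cells. -/
theorem isTwoProduct_binary (X : Fin 2 → K) (π : ∀ i, (X 0 ⨯ X 1) ⟶ X i)
    (h₀ : π 0 = prod.fst) (h₁ : π 1 = prod.snd) : IsTwoProduct X (X 0 ⨯ X 1) π := by
  obtain ⟨p, ρ, hp⟩ := HasFiniteTwoProducts.exists_isTwoProduct 2 X
  refine hp.of_isProduct fun Z f => ⟨prod.lift (f 0) (f 1), ?_, fun g hg => ?_⟩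
  · exact Fin.forall_fin_two.2 ⟨by rw [h₀, prod.lift_fst], by rw [h₁, prod.lift_snd]⟩
  · have hg := Fin.forall_fin_two.1 hg
    rw [h₀, h₁] at hg
    exact prod.hom_ext (by rw [hg.1, prod.lift_fst]) (by rw [hg.2, prod.lift_snd])

end Products

section BinaryCells

variable {K : Type u} [Bicategory.{w₂, v} K] [Strict K] [HasFiniteTwoProducts K]

theorem isTwoProduct_prod (A B : K) : IsTwoProduct ![A, B] (A ⨯ B)
    (fun i => Fin.cases (motive := fun i => (A ⨯ B) ⟶ ![A, B] i) prod.fst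
      (fun i => Fin.cases (motive := fun i : Fin 1 => (A ⨯ B) ⟶ ![A, B] i.succ) prod.snd
        (fun i => i.elim0) i) i) :=
  isTwoProduct_binary ![A, B] _ rfl rfl

theorem TwoCat.Cell.prod_ext {A B Z : K} {α β : Cell Z (A ⨯ B)}
    (h : α.post prod.fst = β.post prod.fst) (h' : α.post prod.snd = β.post prod.snd) : α = β :=
  (isTwoProduct_prod A B).cell_ext (Fin.forall_fin_two.2 ⟨h, h'⟩)

theorem TwoCat.Cell.exists_prodLift {A B Z : K} (α : Cell Z A) (β : Cell Z B) :
    ∃ γ : Cell Z (A ⨯ B), γ.post prod.fst = α ∧ γ.post prod.snd = β := by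
  obtain ⟨γ, hγ⟩ := (isTwoProduct_prod A B).exists_cellLift (Z := Z)
    (fun i => Fin.cases (motive := fun i => Cell Z (![A, B] i)) α
      (fun i => Fin.cases (motive := fun i : Fin 1 => Cell Z (![A, B] i.succ)) β
        (fun i => i.elim0) i) i)
  exact ⟨γ, hγ 0, hγ 1⟩

theorem TwoCat.Cell.existsUnique_terminal (Z : K) : ∃! _α : Cell Z (⊤_ K), True := by
  obtain ⟨p, ρ, hp⟩ := HasFiniteTwoProducts.exists_isTwoProduct (K := K) 0 (fun i => i.elim0)
  have : IsTwoProduct (fun i : Fin 0 => i.elim0) (⊤_ K) (fun i => i.elim0) :=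
    hp.of_isProduct fun Z f => ⟨terminal.from Z, fun i => i.elim0, fun g hg => terminal.hom_ext _ _⟩
  obtain ⟨α, -, h⟩ := isTwoProduct_iff.1 this Z (fun i => i.elim0)
  exact ⟨α, trivial, fun β _ => h β fun i => i.elim0⟩

end BinaryCells

/-! ### Finite products preserve coproducts in each variable. -/

namespace InfinitelyDistributive

variable {K : Type u} [Bicategory.{w₂, v} K] [Strict K] [HasFiniteTwoProducts K]

theorem distrib' (hK : InfinitelyDistributive.{w} K) (A : K) {ι : Type w} {X : ι → K} {c : K}
    {j : ∀ i, X i ⟶ c} (h : IsTwoCoproduct X c j) :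
    IsTwoCoproduct (fun i => X i ⨯ A) (c ⨯ A) (fun i => prod.map (j i) (𝟙 A)) :=
  (hK.distrib A ι X c j h).of_iso (Equiv.refl ι) (fun _ => prod.braiding _ _) (prod.braiding _ _)
    fun _ => Limits.braid_natural _ _

/-- Finite products preserve coproducts in each variable. -/
theorem isTwoCoproduct_paramMap (hK : InfinitelyDistributive.{w} K) {k : ℕ} (A : K)
    {I : Fin k → Type w} {Y : ∀ i, I i → K} {C : Fin k → K} {j : ∀ i x, Y i x ⟶ C i}
    (hj : ∀ i, IsTwoCoproduct (Y i) (C i) (j i)) :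
    IsTwoCoproduct (fun x : ∀ i, I i => A ⨯ ∏ᶜ fun i => Y i (x i)) (A ⨯ ∏ᶜ C)
      (fun x => paramMap A (fun i => j i (x i))) := by
  -- The parameter must vary because the inductive step absorbs the first factor into it.
  induction k generalizing A with
  | zero =>
    have hid : ∀ x : ∀ i, I i, paramMap A (fun i => j i (x i)) ≫
        prod.map (𝟙 A) (Pi.lift fun i => i.elim0) = 𝟙 (A ⨯ ∏ᶜ fun i => Y i (x i)) := fun x =>
      prod.hom_ext_param (by simp) fun i => i.elim0
    have hid' : ∀ x : ∀ i, I i, (prod.map (𝟙 A) (Pi.lift fun i => i.elim0) ≫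
        paramMap A (fun i => j i (x i)) : (A ⨯ ∏ᶜ C) ⟶ _) = 𝟙 _ := fun x =>
      prod.hom_ext_param (by simp) fun i => i.elim0
    rw [isTwoCoproduct_iff]
    intro Z α
    -- With no factors there is exactly one index, and its injection is invertible.
    let x : ∀ i, I i := fun i => i.elim0
    have hx : ∀ y, y = x := fun y => funext fun i => i.elim0
    refine ⟨(α x).pre (prod.map (𝟙 A) (Pi.lift fun i => i.elim0)), fun y => ?_, fun β hβ => ?_⟩
    · obtain rfl := hx y
      rw [Cell.pre_pre, hid, Cell.pre_id]
    · rw [← hβ x, Cell.pre_pre, hid', Cell.pre_id]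
  | succ k ih =>
    -- Decompose the first factor with the others held fixed, then decompose the others by induction
    -- with parameter `A ⨯ Y 0 x`.
    have h₀ := hK.distrib' (∏ᶜ fun i : Fin k => C i.succ) (hK.distrib A _ _ _ _ (hj 0))
    have h₁ := fun x => ih (A ⨯ Y 0 x) (fun i : Fin k => hj i.succ)
    refine (h₀.sigma h₁).of_iso
      ((Fin.consEquiv I).symm.trans (Equiv.sigmaEquivProd (I 0) (∀ i : Fin k, I i.succ)).symm)
      (fun x => paramCons A _) (paramCons A C) fun x => ?_
    exact (paramCons_natural A fun i => j i (x i)).trans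
      (congrArg ((paramCons A _).hom ≫ ·) (paramMap_sigma A fun i => j i (x i)))

end InfinitelyDistributive

/-! ### Concatenation of finite families and of paths -/

section Concat

variable {E : Type*}

/-- The concatenation of finite sequences, indexed as in `finSigmaFinEquiv`. -/
def finConcat {k : ℕ} (n : Fin k → ℕ) {N : ℕ} (h : ∑ i, n i = N) (e : ∀ i, Fin (n i) → E) :
    Fin N → E :=
  fun l => e (finSigmaFinEquiv.symm (Fin.cast h.symm l)).1
    (finSigmaFinEquiv.symm (Fin.cast h.symm l)).2

@[simp] theorem finConcat_apply {k : ℕ} (n : Fin k → ℕ) (e : ∀ i, Fin (n i) → E) (i : Fin k)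
    (j : Fin (n i)) : finConcat n rfl e (finSigmaFinEquiv ⟨i, j⟩) = e i j := by
  have : ∀ x : (i : Fin k) × Fin (n i), x = ⟨i, j⟩ → e x.1 x.2 = e i j := by
    rintro x rfl; rfl
  exact this _ (finSigmaFinEquiv.symm_apply_apply _)

theorem finConcat_eq_iff {k : ℕ} {n : Fin k → ℕ} {e : ∀ i, Fin (n i) → E}
    {f : Fin (∑ i, n i) → E} :
    finConcat n rfl e = f ↔ ∀ i j, f (finSigmaFinEquiv ⟨i, j⟩) = e i j := by
  constructor
  · rintro rfl i j; simp
  · intro h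
    funext l
    obtain ⟨⟨i, j⟩, rfl⟩ := finSigmaFinEquiv.surjective l
    rw [finConcat_apply, h]

theorem finConcat_succ {k : ℕ} (n : Fin (k + 1) → ℕ) (e : ∀ i, Fin (n i) → E) :
    finConcat n rfl e = fun l => Fin.append
      (finConcat (fun i : Fin k => n i.castSucc) rfl (fun i => e i.castSucc)) (e (Fin.last k))
      (Fin.cast (Fin.sum_univ_castSucc n) l) := by
  rw [finConcat_eq_iff]
  intro i
  induction i using Fin.lastCases with
  | last =>
    intro j
    have : Fin.cast (Fin.sum_univ_castSucc n) (finSigmaFinEquiv ⟨Fin.last k, j⟩) =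
        Fin.natAdd _ j := by
      apply Fin.ext
      simp only [Fin.val_cast, finSigmaFinEquiv_apply, Fin.val_natAdd]
      rfl
    rw [this, Fin.append_right]
  | cast i =>
    intro j
    have : Fin.cast (Fin.sum_univ_castSucc n) (finSigmaFinEquiv ⟨i.castSucc, j⟩) =
        Fin.castAdd _ (finSigmaFinEquiv (n := fun i : Fin k => n i.castSucc) ⟨i, j⟩) := by
      apply Fin.ext
      simp only [Fin.val_cast, finSigmaFinEquiv_apply, Fin.val_castAdd]
      rfl
    rw [this, Fin.append_left, finConcat_apply]

/-- As lists, concatenations are flattenings. The monoid laws for lists then give associativity and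
the unit laws without arithmetic on `Fin` indices or casts between lengths. -/
theorem ofFn_finConcat {k : ℕ} (n : Fin k → ℕ) {N : ℕ} (h : ∑ i, n i = N)
    (e : ∀ i, Fin (n i) → E) :
    List.ofFn (finConcat n h e) = (List.ofFn fun i => List.ofFn (e i)).flatten := by
  subst h
  induction k with
  | zero =>
    rw [List.ofFn_zero, List.flatten_nil, ← List.length_eq_zero_iff, List.length_ofFn]
    simp
  | succ k ih =>
    rw [List.ofFn_succ', List.concat_eq_append, List.flatten_append, ← ih, finConcat_succ,
      List.flatten_singleton, ← List.ofFn_fin_append]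
    exact List.ofFn_congr (Fin.sum_univ_castSucc n) _

theorem finConcat_finConcat {k : ℕ} (n : Fin k → ℕ) (m : Fin (∑ i, n i) → ℕ) {N : ℕ}
    (h : ∑ l, m l = N) (h' : ∑ i, ∑ j, m (finSigmaFinEquiv ⟨i, j⟩) = N)
    (e : ∀ l, Fin (m l) → E) :
    finConcat m h e = finConcat (fun i => ∑ j, m (finSigmaFinEquiv ⟨i, j⟩)) h'
      (fun i => finConcat (fun j => m (finSigmaFinEquiv ⟨i, j⟩)) rfl
        (fun j => e (finSigmaFinEquiv ⟨i, j⟩))) := by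
  apply List.ofFn_injective
  simp only [ofFn_finConcat]
  -- The outer list is itself a concatenation, so the claim becomes the identity between the two
  -- ways of flattening a list of lists of lists.
  have : (fun l => List.ofFn (e l)) = finConcat n rfl
      (fun i j => List.ofFn (e (finSigmaFinEquiv ⟨i, j⟩))) :=
    (finConcat_eq_iff.2 fun i j => rfl).symm
  rw [this, ofFn_finConcat, List.flatten_flatten, List.map_ofFn]
  rfl

theorem finConcat_singletons {k : ℕ} (h : ∑ _i : Fin k, 1 = k) (e : Fin k → E) :
    finConcat (fun _ => 1) h (fun i _ => e i) = e := by
  apply List.ofFn_injective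
  rw [ofFn_finConcat]
  have : (List.ofFn fun i : Fin k => List.ofFn fun _ : Fin 1 => e i) =
      (List.ofFn e).map fun x => [x] := by
    rw [List.map_ofFn]; congr 1
  rw [this, ← List.flatMap_def, List.flatMap_singleton']

theorem finConcat_single {k : ℕ} (h : ∑ _i : Fin 1, k = k) (e : Fin k → E) :
    finConcat (fun _ => k) h (fun _ => e) = e := by
  apply List.ofFn_injective
  rw [ofFn_finConcat]
  simp

end Concat

namespace IsPath

variable {O : Type*}

theorem single (a b : O) : IsPath a b (fun _ : Fin 1 => a) (fun _ : Fin 1 => b) := by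
  -- Vertices are numbered from the end of the path, so `b` precedes `a`.
  refine ⟨![b, a], rfl, rfl, fun i => ?_⟩
  obtain rfl : i = 0 := Subsingleton.elim _ _
  exact ⟨rfl, rfl⟩

theorem eq_of_len_zero {a b : O} {s t : Fin 0 → O} (h : IsPath a b s t) : a = b := by
  obtain ⟨x, h₀, h₁, -⟩ := h
  exact h₁.symm.trans h₀

theorem nil (a : O) (s t : Fin 0 → O) : IsPath a a s t :=
  ⟨fun _ => a, rfl, rfl, fun i => i.elim0⟩

theorem append {a b c : O} {m n : ℕ} {s t : Fin m → O} {s' t' : Fin n → O}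
    (h : IsPath b c s t) (h' : IsPath a b s' t') :
    IsPath a c (Fin.append s s') (Fin.append t t') := by
  obtain ⟨x, hc, hb, hx⟩ := h
  obtain ⟨y, hb', ha, hy⟩ := h'
  -- The joined vertex sequence is defined on `ℕ` to avoid dependent bounds. The two sequences
  -- overlap at index `m`, where both equal `b`; the value past the end is never used.
  obtain ⟨z, hz, hz'⟩ : ∃ z : ℕ → O, (∀ i (hi : i < m + 1), z i = x ⟨i, hi⟩) ∧
      ∀ i (hi : i < n + 1), z (m + i) = y ⟨i, hi⟩ := by
    refine ⟨fun i => if h : i < m then x ⟨i, by omega⟩ else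
      if h : i - m < n + 1 then y ⟨i - m, h⟩ else b, fun i hi => ?_, fun i hi => ?_⟩
    · by_cases h : i < m
      · simp only [dif_pos h]
      · obtain rfl : i = m := by omega
        simp only [lt_irrefl, Nat.sub_self, Nat.succ_pos, dite_true, dite_false]
        exact hb'.trans hb.symm
    · have h₁ : ¬ m + i < m := by omega
      have h₂ : m + i - m = i := by omega
      simp only [dif_neg h₁, h₂, dif_pos hi]
  refine ⟨fun i => z i, (hz 0 (Nat.succ_pos m)).trans hc, (hz' n (Nat.lt_succ_self n)).trans ha,
    fun i => ?_⟩
  induction i using Fin.addCases with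
  | left i =>
    rw [Fin.append_left, Fin.append_left, (hx i).1, (hx i).2]
    exact ⟨(hz (i + 1) (by omega)).symm, (hz i (by omega)).symm⟩
  | right i =>
    rw [Fin.append_right, Fin.append_right, (hy i).1, (hy i).2]
    exact ⟨(hz' (i + 1) (by omega)).symm, (hz' i (by omega)).symm⟩

theorem concat {k : ℕ} {a b : O} {S T : Fin k → O} (H : IsPath a b S T) (n : Fin k → ℕ) {N : ℕ}
    (hN : ∑ i, n i = N) {s t : ∀ i, Fin (n i) → O} (h : ∀ i, IsPath (S i) (T i) (s i) (t i)) :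
    IsPath a b (finConcat n hN s) (finConcat n hN t) := by
  subst hN
  induction k generalizing a with
  | zero =>
    obtain rfl := H.eq_of_len_zero
    exact nil _ _ _
  | succ k ih =>
    obtain ⟨x, hb, ha, hx⟩ := H
    -- Since paths are listed backwards, the segment of index `Fin.last k` is the one leaving `a`;
    -- induction applies to the remainder of the path.
    have h₁ := ih (a := x (Fin.last k).castSucc) (S := fun i => S i.castSucc)
      (T := fun i => T i.castSucc) ⟨fun i => x i.castSucc, hb, rfl, fun i => hx i.castSucc⟩
      (fun i => n i.castSucc) (fun i => h i.castSucc)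
    have h₂ := h (Fin.last k)
    rw [(hx (Fin.last k)).1, (hx (Fin.last k)).2, Fin.succ_last, ha] at h₂
    have h₃ := h₁.append h₂
    rw [finConcat_succ, finConcat_succ]
    have cast : ∀ {p q : ℕ} (e : p = q) {s t : Fin q → O}, IsPath a b s t →
        IsPath a b (fun l => s (Fin.cast e l)) (fun l => t (Fin.cast e l)) := by
      rintro p _ rfl s t h; exact h
    exact cast (Fin.sum_univ_castSucc n) h₃

/-- The vertices of a path are determined by its edges: they are the end `b` followed by the
sources. Hence they lift along `f` when the edges and endpoints do. -/
theorem reflect {O' : Type*} {f : O → O'} (hf : Function.Injective f) {a b : O} {k : ℕ}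
    {s t : Fin k → O} (h : IsPath (f a) (f b) (fun i => f (s i)) (fun i => f (t i))) :
    IsPath a b s t := by
  obtain ⟨x, hb, ha, hx⟩ := h
  let y : Fin (k + 1) → O := Fin.cases b s
  have hy : ∀ i, f (y i) = x i := Fin.cases hb.symm fun i => (hx i).1
  refine ⟨y, rfl, hf ((hy _).trans ha), fun i => ⟨rfl, hf ((hx i).2.trans (hy _).symm)⟩⟩

/-- A function that does not change along edges is constant along the path. It is applied to the
index of a summand in a disjoint sum. -/
theorem congr_of_edges {O' : Type*} (c : O → O') {a b : O} {k : ℕ} {s t : Fin k → O}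
    (h : IsPath a b s t) (e : ∀ i, c (s i) = c (t i)) :
    c a = c b ∧ ∀ i, c (s i) = c b ∧ c (t i) = c b := by
  obtain ⟨x, rfl, rfl, hx⟩ := h
  have key : ∀ i, c (x i) = c (x 0) := by
    intro i
    induction i using Fin.induction with
    | zero => rfl
    | succ i ih => rw [← ih, ← (hx i).1, ← (hx i).2, e]
  exact ⟨key _, fun i => ⟨by rw [(hx i).1, key], by rw [(hx i).2, key]⟩⟩

end IsPath

/-! ### Generalised elements of enriched graphs -/

namespace KGraph

/-- A generalised element, of kind `E`, of one of the hom-objects of an enriched graph. -/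
structure Edge {K : Type u} (X : KGraph.{w} K) (E : K → Type*) where
  src : X.Obj
  tgt : X.Obj
  hom : E (X.hom src tgt)

theorem Edge.eq_of_mk_eq_mk {K : Type u} {X : KGraph.{w} K} {E : K → Type*} {a b : X.Obj}
    {f g : E (X.hom a b)} (h : (⟨a, b, f⟩ : X.Edge E) = ⟨a, b, g⟩) : f = g := by
  simpa using h

/-- Moves an element to a hom-object with equal endpoints, in place of a transport. -/
theorem Edge.exists_mk_eq {K : Type u} {X : KGraph.{w} K} {E : K → Type*} {a b : X.Obj}
    (e : X.Edge E) (ha : e.src = a) (hb : e.tgt = b) :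
    ∃ f : E (X.hom a b), (⟨a, b, f⟩ : X.Edge E) = e := by
  subst ha hb; exact ⟨e.hom, rfl⟩

variable {K : Type u} [Bicategory.{w₂, v} K]

/-- The elements of hom-objects with stage of definition `Z`. -/
abbrev Elt (X : KGraph.{w} K) (Z : K) := X.Edge (fun c => Z ⟶ c)

/-- The 2-cells between elements of hom-objects with stage of definition `Z`. -/
abbrev CellElt (X : KGraph.{w} K) (Z : K) := X.Edge (fun c => Cell Z c)

/-- Change of stage. -/
abbrev Elt.pre {X : KGraph.{w} K} {W Z : K} (g : W ⟶ Z) (e : X.Elt Z) : X.Elt W :=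
  ⟨e.src, e.tgt, g ≫ e.hom⟩

/-- Change of stage. -/
abbrev CellElt.pre {X : KGraph.{w} K} {W Z : K} (g : W ⟶ Z) (e : X.CellElt Z) : X.CellElt W :=
  ⟨e.src, e.tgt, e.hom.pre g⟩

/-- The identity 2-cell on an element. -/
abbrev Elt.cell {X : KGraph.{w} K} {Z : K} (e : X.Elt Z) : X.CellElt Z :=
  ⟨e.src, e.tgt, Cell.ofHom e.hom⟩

theorem Elt.cell_injective {X : KGraph.{w} K} {Z : K} {e e' : X.Elt Z} (h : e.cell = e'.cell) :
    e = e' := by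
  obtain ⟨a, b, f⟩ := e
  obtain ⟨a', b', f'⟩ := e'
  obtain rfl : a = a' := congrArg Edge.src h
  obtain rfl : b = b' := congrArg Edge.tgt h
  exact congrArg (Edge.mk a b) (Cell.ofHom_injective (Edge.eq_of_mk_eq_mk h))

/-- A 2-cell of enriched graphs, together with its source and target. -/
structure CellHom (X Y : KGraph.{w} K) where
  obj : X.Obj → Y.Obj
  map : ∀ a b, Cell (X.hom a b) (Y.hom (obj a) (obj b))

/-- The action of a graph morphism on elements. -/
abbrev Hom.elt {X Y : KGraph.{w} K} (F : X ⟶ Y) {Z : K} (e : X.Elt Z) : Y.Elt Z :=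
  ⟨F.obj e.src, F.obj e.tgt, e.hom ≫ F.map _ _⟩

namespace CellHom

variable {X Y Y' : KGraph.{w} K}

/-- The identity 2-cell on a graph morphism. -/
abbrev ofHom (F : X ⟶ Y) : CellHom X Y := ⟨F.obj, fun a b => Cell.ofHom (F.map a b)⟩

/-- Whiskering on the left. -/
abbrev pre (F : X ⟶ Y) (φ : CellHom Y Y') : CellHom X Y' :=
  ⟨fun a => φ.obj (F.obj a), fun a b => (φ.map _ _).pre (F.map a b)⟩

/-- Whiskering on the right. -/
abbrev post (φ : CellHom X Y) (F : Y ⟶ Y') : CellHom X Y' :=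
  ⟨fun a => F.obj (φ.obj a), fun a b => (φ.map a b).post (F.map _ _)⟩

/-- The action of a 2-cell on elements. -/
abbrev elt (φ : CellHom X Y) {Z : K} (e : X.Elt Z) : Y.CellElt Z :=
  ⟨φ.obj e.src, φ.obj e.tgt, (φ.map _ _).pre e.hom⟩

/-- The 2-cells of the 2-category of graphs, as families of 2-cells. -/
def ofCell : Cell X Y → CellHom X Y
  | ⟨Hom₂.mk f α⟩ => ⟨f, fun a b => ⟨α a b⟩⟩

/-- The 2-cell of the 2-category of graphs given by a family of 2-cells. -/
def toCell (φ : CellHom X Y) : Cell X Y :=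
  Cell.mk (Hom₂.mk φ.obj fun a b => (φ.map a b).cell : Hom₂ _ _)

@[simp] theorem toCell_ofCell (α : Cell X Y) : (ofCell α).toCell = α :=
  match α with
  | ⟨Hom₂.mk _ _⟩ => rfl

theorem ofCell_injective {α β : Cell X Y} (h : ofCell α = ofCell β) : α = β := by
  rw [← toCell_ofCell α, h, toCell_ofCell]

theorem ofCell_pre (F : X ⟶ Y) (α : Cell Y Y') : ofCell (α.pre F) = (ofCell α).pre F :=
  match α with
  | ⟨Hom₂.mk _ _⟩ => rfl

theorem ofCell_post (α : Cell X Y) (F : Y ⟶ Y') : ofCell (α.post F) = (ofCell α).post F :=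
  match α with
  | ⟨Hom₂.mk _ _⟩ => rfl

theorem ofHom_elt (F : X ⟶ Y) {Z : K} (e : X.Elt Z) : (ofHom F).elt e = (Hom.elt F e).cell :=
  congrArg (Edge.mk _ _) (Cell.pre_ofHom _ _)

variable [Strict K]

theorem pre_elt (F : X ⟶ Y) (φ : CellHom Y Y') {Z : K} (e : X.Elt Z) :
    (φ.pre F).elt e = φ.elt (Hom.elt F e) :=
  congrArg (Edge.mk _ _) (Cell.pre_pre _ _ _)

theorem elt_pre (φ : CellHom X Y) {W Z : K} (g : W ⟶ Z) (e : X.Elt Z) :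
    φ.elt (e.pre g) = (φ.elt e).pre g :=
  congrArg (Edge.mk _ _) (Cell.pre_pre _ _ _).symm

/-- Yoneda: the universal elements, namely the identities of the hom-objects, suffice. -/
theorem ext_elt {φ ψ : CellHom X Y}
    (h : ∀ a b, φ.elt ⟨a, b, 𝟙 (X.hom a b)⟩ = ψ.elt ⟨a, b, 𝟙 (X.hom a b)⟩) : φ = ψ := by
  obtain ⟨f, α⟩ := φ
  obtain ⟨g, β⟩ := ψ
  obtain rfl : f = g := funext fun a => congrArg Edge.src (h a a)
  congr 1
  funext a b
  simpa using Edge.eq_of_mk_eq_mk (h a b)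

end CellHom

theorem Hom.elt_comp {X Y Y' : KGraph.{w} K} [Strict K] (F : X ⟶ Y) (G : Y ⟶ Y') {Z : K}
    (e : X.Elt Z) : Hom.elt (F ≫ G) e = Hom.elt G (Hom.elt F e) :=
  congrArg (Edge.mk _ _) (Strict.assoc _ _ _).symm

theorem Hom.elt_id {X : KGraph.{w} K} [Strict K] {Z : K} (e : X.Elt Z) :
    Hom.elt (𝟙 X) e = e :=
  congrArg (Edge.mk _ _) (Strict.comp_id _)

end KGraph

open KGraph

/-! ### The action of a `(K, P)`-category on elements -/

namespace KPCat

variable {K : Type u} [Bicategory.{w₂, v} K] [Strict K] [HasFiniteTwoProducts K] {P : Operad K}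
  {X Y : KPCat.{w} P} {Z : K} {k : ℕ}

/-- Composition of elements. -/
noncomputable abbrev eltAct (X : KPCat.{w} P) (p : Z ⟶ P.obj k) (e : Fin k → X.graph.Elt Z)
    {a b : X.graph.Obj} (h : IsPath a b (fun i => (e i).src) (fun i => (e i).tgt)) :
    X.graph.Elt Z :=
  ⟨a, b, prod.lift p (Pi.lift fun i => (e i).hom) ≫ X.act h⟩

/-- Composition of 2-cells between elements. -/
noncomputable abbrev cellAct (X : KPCat.{w} P) (p : Z ⟶ P.obj k) (e : Fin k → X.graph.CellElt Z)
    {a b : X.graph.Obj} (h : IsPath a b (fun i => (e i).src) (fun i => (e i).tgt)) :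
    X.graph.CellElt Z :=
  ⟨a, b, (Cell.param (Cell.ofHom p) fun i => (e i).hom).post (X.act h)⟩

theorem eltAct_cell (p : Z ⟶ P.obj k) (e : Fin k → X.graph.Elt Z) {a b : X.graph.Obj}
    (h : IsPath a b (fun i => (e i).src) (fun i => (e i).tgt)) :
    (X.eltAct p e h).cell = X.cellAct p (fun i => (e i).cell) h := by
  refine congrArg (Edge.mk a b) ?_
  exact (Cell.post_ofHom _ _).symm.trans (congrArg (Cell.post · (X.act h))
    (Cell.param_ofHom p fun i => (e i).hom).symm)

/-- The two path proofs are unrelated, so factors and endpoints may be replaced by equal ones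
without transporting the composability condition. -/
theorem cellAct_congr {p p' : Z ⟶ P.obj k} (hp : p = p') {e e' : Fin k → X.graph.CellElt Z}
    (he : e = e') {a b a' b' : X.graph.Obj} (ha : a = a') (hb : b = b')
    {h : IsPath a b (fun i => (e i).src) (fun i => (e i).tgt)}
    {h' : IsPath a' b' (fun i => (e' i).src) (fun i => (e' i).tgt)} :
    X.cellAct p e h = X.cellAct p' e' h' := by
  subst hp he ha hb; rfl

theorem eltAct_congr {p p' : Z ⟶ P.obj k} (hp : p = p') {e e' : Fin k → X.graph.Elt Z}
    (he : e = e') {a b a' b' : X.graph.Obj} (ha : a = a') (hb : b = b')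
    {h : IsPath a b (fun i => (e i).src) (fun i => (e i).tgt)}
    {h' : IsPath a' b' (fun i => (e' i).src) (fun i => (e' i).tgt)} :
    X.eltAct p e h = X.eltAct p' e' h' := by
  subst hp he ha hb; rfl

theorem eltAct_pre {W : K} (g : W ⟶ Z) (p : Z ⟶ P.obj k) (e : Fin k → X.graph.Elt Z)
    {a b : X.graph.Obj} (h : IsPath a b (fun i => (e i).src) (fun i => (e i).tgt)) :
    (X.eltAct p e h).pre g = X.eltAct (g ≫ p) (fun i => (e i).pre g) h := by
  refine congrArg (Edge.mk a b) ?_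
  refine (Strict.assoc _ _ _).symm.trans (congrArg (· ≫ X.act h) ?_)
  exact prod.hom_ext_param (by rw [Category.assoc, prod.lift_fst, prod.lift_fst]) fun i => by
    rw [Category.assoc, prod.lift_snd_assoc, prod.lift_snd_assoc, Pi.lift_π, Pi.lift_π]

/-- Associativity is an equation between 1-cells; at the universal element it can be whiskered with
any tuple of 2-cells, which yields associativity for those. -/
theorem cellAct_mul (n : Fin k → ℕ) {N : ℕ} (hN : ∑ i, n i = N) (p : Z ⟶ P.obj k)
    (q : ∀ i, Z ⟶ P.obj (n i)) (e : ∀ i, Fin (n i) → X.graph.CellElt Z)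
    {S T : Fin k → X.graph.Obj} {a b : X.graph.Obj}
    (h : ∀ i, IsPath (S i) (T i) (fun j => (e i j).src) (fun j => (e i j).tgt))
    (H : IsPath a b S T)
    (h' : IsPath a b (fun l => (finConcat n hN e l).src) (fun l => (finConcat n hN e l).tgt)) :
    X.cellAct (prod.lift p (Pi.lift q) ≫ P.mul n N hN) (finConcat n hN e) h' =
      X.cellAct p (fun i => X.cellAct (q i) (e i) (h i)) H := by
  subst hN
  generalize hE : finConcat n rfl e = E at h' ⊢
  rw [finConcat_eq_iff] at hE
  -- The axiom starts from the concatenated family, so the nested family is expressed through it.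
  obtain rfl : e = fun i j => E (finSigmaFinEquiv ⟨i, j⟩) :=
    funext fun i => funext fun j => (hE i j).symm
  refine congrArg (Edge.mk a b) ?_
  have key := X.act_mul n S T _ _ a b H h h'
    ((P.obj k ⨯ ∏ᶜ fun i => P.obj (n i)) ⨯ ∏ᶜ fun l => X.graph.hom (E l).src (E l).tgt)
    (prod.fst ≫ prod.fst) (fun i => prod.fst ≫ prod.snd ≫ Pi.π _ i)
    (fun l => prod.snd ≫ Pi.π _ l)
  have key' := congrArg (Cell.post (Cell.param (Cell.ofHom (prod.lift p (Pi.lift q)))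
    fun l => (E l).hom)) key
  have e₁ : prod.lift p (Pi.lift q) ≫ prod.fst = p := prod.lift_fst _ _
  have e₂ (i) : prod.lift p (Pi.lift q) ≫ prod.snd ≫ Pi.π (fun i => P.obj (n i)) i = q i := by
    rw [prod.lift_snd_assoc, Pi.lift_π]
  simp only [Cell.post_lift_comp, Cell.param_snd, Cell.post_fst_comp, Cell.post_ofHom, e₁, e₂,
    Cell.param_ofHom] at key'
  exact key'

theorem cellAct_unit (e : X.graph.CellElt Z) {a b : X.graph.Obj}
    (h : IsPath a b (fun _ : Fin 1 => e.src) (fun _ : Fin 1 => e.tgt)) :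
    X.cellAct (terminal.from Z ≫ P.unit) (fun _ : Fin 1 => e) h = e := by
  obtain ⟨a', b', f⟩ := e
  obtain rfl : a = a' := by
    obtain ⟨x, hb, ha, hx⟩ := h
    exact ha.symm.trans (hx 0).1.symm
  obtain rfl : b = b' := by
    obtain ⟨x, hb, ha, hx⟩ := h
    exact hb.symm.trans (hx 0).2.symm
  refine congrArg (Edge.mk a b) ?_
  have key := congrArg f.post (X.act_unit a b h (X.graph.hom a b) (𝟙 _))
  rw [Cell.post_lift_comp, Cell.post_id] at key
  refine Eq.trans ?_ key
  congr 2
  -- After whiskering with `f`, the parameter is a 2-cell factoring through the terminal object,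
  -- hence an identity 2-cell.
  have ht := Cell.existsUnique_terminal (K := K) Z
  rw [← Cell.post_post, ← Cell.post_ofHom]
  congr 1
  exact ht.unique trivial trivial

/-- A 2-cell of graphs is a 2-cell of `(K, P)`-categories if it commutes with composition. -/
def IsFun (X Y : KPCat.{w} P) (φ : CellHom X.graph Y.graph) : Prop :=
  ∀ ⦃k : ℕ⦄ ⦃s t : Fin k → X.graph.Obj⦄ ⦃a b : X.graph.Obj⦄ (h : IsPath a b s t),
    (φ.map a b).pre (X.act h) = (Cell.param (Cell.ofHom prod.fst)
      fun i => (φ.map (s i) (t i)).pre (prod.snd ≫ Pi.π _ i)).post (Y.act (h.map φ.obj))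

/-- Yoneda again: one direction restricts the equation along a tuple, the other evaluates at the
projections from the domain of the composition map. -/
theorem isFun_iff_elt {φ : CellHom X.graph Y.graph} : IsFun X Y φ ↔
    ∀ ⦃Z : K⦄ ⦃k : ℕ⦄ (p : Z ⟶ P.obj k) (e : Fin k → X.graph.Elt Z) ⦃a b : X.graph.Obj⦄
      (h : IsPath a b (fun i => (e i).src) (fun i => (e i).tgt)),
      φ.elt (X.eltAct p e h) = Y.cellAct p (fun i => φ.elt (e i)) (h.map φ.obj) := by
  constructor
  · intro hφ Z k p e a b h
    refine congrArg (Edge.mk _ _) ?_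
    rw [← Cell.pre_pre, hφ h, ← Cell.post_pre, Cell.pre_param, Cell.pre_ofHom, prod.lift_fst]
    congr 2
    funext i
    rw [Cell.pre_pre, prod.lift_snd_assoc, Pi.lift_π]
  · intro hφ k s t a b h
    have := Edge.eq_of_mk_eq_mk (hφ (Z := P.obj k ⨯ ∏ᶜ fun i => X.graph.hom (s i) (t i)) prod.fst
      (fun i => ⟨s i, t i, prod.snd ≫ Pi.π _ i⟩) h)
    rw [← this]
    congr 1
    refine (Strict.id_comp _).symm.trans (congrArg (· ≫ X.act h) ?_)
    exact prod.hom_ext_param (by rw [prod.lift_fst]; exact Strict.id_comp _) fun i => by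
      rw [prod.lift_snd_assoc, Pi.lift_π]; exact Strict.id_comp _

/-- Functoriality of `F` and `G` equates the boundaries of the two sides, so the heterogeneous
equation for an icon is an equation of packaged 2-cells. -/
theorem isFun_ofCell {F G : X.graph ⟶ Y.graph} (hF : IsFunctor X Y F) (hG : IsFunctor X Y G)
    (α : F ⟶ G) : IsFun X Y (CellHom.ofCell ⟨α⟩) ↔ IsIcon X Y α := by
  obtain ⟨f, α⟩ := α
  refine forall_congr' fun k => forall_congr' fun s => forall_congr' fun t =>
    forall_congr' fun a => forall_congr' fun b => forall_congr' fun h => ?_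
  rw [← Cell.mk_paramMap₂]
  exact ⟨fun e => Cell.heq_of_mk_eq_mk e, fun e => Cell.mk_eq_mk (hF h) (hG h) e⟩

/-- An equation of packaged 2-cells includes the equation of their sources, so functoriality of the
boundary comes with the icon condition. -/
theorem IsFun.isFunctor_src {F G : X.graph ⟶ Y.graph} {α : F ⟶ G}
    (h : IsFun X Y (CellHom.ofCell ⟨α⟩)) : IsFunctor X Y F := by
  obtain ⟨f, α⟩ := α
  intro k s t a b hp
  have := congrArg Cell.src (h hp)
  rw [← Cell.mk_paramMap₂] at this
  exact this

theorem IsFun.isFunctor_tgt {F G : X.graph ⟶ Y.graph} {α : F ⟶ G}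
    (h : IsFun X Y (CellHom.ofCell ⟨α⟩)) : IsFunctor X Y G := by
  obtain ⟨f, α⟩ := α
  intro k s t a b hp
  have := congrArg Cell.tgt (h hp)
  rw [← Cell.mk_paramMap₂] at this
  exact this

/-- The graph 2-cell underlying a 2-cell of `(K, P)`-categories. -/
def cellHom (α : Cell X Y) : CellHom X.graph Y.graph := CellHom.ofCell ⟨α.cell.hom⟩

theorem isFun_cellHom (α : Cell X Y) : IsFun X Y (cellHom α) :=
  (isFun_ofCell α.src.isHom α.tgt.isHom α.cell.hom).2 α.cell.isHom₂

theorem cellHom_injective {α β : Cell X Y} (h : cellHom α = cellHom β) : α = β := by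
  have h := CellHom.ofCell_injective h
  obtain @⟨⟨F, hF⟩, ⟨G, hG⟩, ⟨α, hα⟩⟩ := α
  obtain @⟨⟨F', hF'⟩, ⟨G', hG'⟩, ⟨β, hβ⟩⟩ := β
  obtain rfl : F = F' := congrArg Cell.src h
  obtain rfl : G = G' := congrArg Cell.tgt h
  obtain rfl : α = β := Cell.eq_of_mk_eq_mk h
  rfl

theorem exists_cellHom_eq {φ : CellHom X.graph Y.graph} (h : IsFun X Y φ) :
    ∃ α : Cell X Y, cellHom α = φ := by
  have h' : IsFun X Y (CellHom.ofCell ⟨φ.toCell.cell⟩) := h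
  refine ⟨@Cell.mk _ _ X Y ⟨_, h'.isFunctor_src⟩ ⟨_, h'.isFunctor_tgt⟩
    ⟨φ.toCell.cell, (isFun_ofCell h'.isFunctor_src h'.isFunctor_tgt _).1 h'⟩, rfl⟩

theorem cellHom_pre {X' : KPCat.{w} P} (F : X' ⟶ X) (α : Cell X Y) :
    cellHom (α.pre F) = (cellHom α).pre F.hom :=
  CellHom.ofCell_pre F.hom ⟨α.cell.hom⟩

theorem cellHom_post {Y' : KPCat.{w} P} (α : Cell X Y) (F : Y ⟶ Y') :
    cellHom (α.post F) = (cellHom α).post F.hom :=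
  CellHom.ofCell_post ⟨α.cell.hom⟩ F.hom

theorem isFunctor_iff {F : X.graph ⟶ Y.graph} : IsFunctor X Y F ↔ IsFun X Y (CellHom.ofHom F) :=
  ⟨fun h => (isFun_ofCell h h (𝟙 F)).2 ((iconStructure P).isHom₂_id h),
    fun h => IsFun.isFunctor_src (α := 𝟙 F) h⟩

theorem isFunctor_iff_elt {F : X.graph ⟶ Y.graph} : IsFunctor X Y F ↔
    ∀ ⦃Z : K⦄ ⦃k : ℕ⦄ (p : Z ⟶ P.obj k) (e : Fin k → X.graph.Elt Z) ⦃a b : X.graph.Obj⦄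
      (h : IsPath a b (fun i => (e i).src) (fun i => (e i).tgt)),
      Hom.elt F (X.eltAct p e h) = Y.eltAct p (fun i => Hom.elt F (e i)) (h.map F.obj) := by
  rw [isFunctor_iff, isFun_iff_elt]
  refine forall_congr' fun Z => forall_congr' fun k => forall_congr' fun p =>
    forall_congr' fun e => forall_congr' fun a => forall_congr' fun b => forall_congr' fun h => ?_
  have h₁ : (CellHom.ofHom F).elt (X.eltAct p e h) = (Hom.elt F (X.eltAct p e h)).cell :=
    CellHom.ofHom_elt F _
  have h₂ : Y.cellAct p (fun i => (CellHom.ofHom F).elt (e i)) (h.map F.obj) =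
      (Y.eltAct p (fun i => Hom.elt F (e i)) (h.map F.obj)).cell := by
    rw [eltAct_cell]
    exact cellAct_congr rfl (funext fun i => CellHom.ofHom_elt F _) rfl rfl
  rw [h₁, h₂]
  exact ⟨fun h => Elt.cell_injective h, fun h => congrArg _ h⟩

end KPCat

/-! ### Graphs whose hom-objects are coproducts -/

section Generators

variable {K : Type u} [Bicategory.{w₂, v} K] [Strict K] [HasFiniteTwoProducts K]

/-- Natural operations on families of elements of coproducts are determined by their values on
elements of the summands. -/
theorem InfinitelyDistributive.eq_of_elements (hK : InfinitelyDistributive.{w} K) {k : ℕ} {A : K}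
    {I : Fin k → Type w} {Y : ∀ i, I i → K} {C : Fin k → K} {j : ∀ i x, Y i x ⟶ C i}
    (hj : ∀ i, IsTwoCoproduct (Y i) (C i) (j i)) {D : K}
    (L R : ∀ {Z : K}, (Z ⟶ A) → (∀ i, Z ⟶ C i) → (Z ⟶ D))
    (hL : ∀ {W Z : K} (g : W ⟶ Z) (p : Z ⟶ A) (f : ∀ i, Z ⟶ C i),
      g ≫ L p f = L (g ≫ p) (fun i => g ≫ f i))
    (hR : ∀ {W Z : K} (g : W ⟶ Z) (p : Z ⟶ A) (f : ∀ i, Z ⟶ C i),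
      g ≫ R p f = R (g ≫ p) (fun i => g ≫ f i))
    (h : ∀ {Z : K} (p : Z ⟶ A) (x : ∀ i, I i) (f : ∀ i, Z ⟶ Y i (x i)),
      L p (fun i => f i ≫ j i (x i)) = R p (fun i => f i ≫ j i (x i)))
    {Z : K} (p : Z ⟶ A) (f : ∀ i, Z ⟶ C i) : L p f = R p f := by
  -- By naturality only the universal family matters, and its stage `A ⨯ ∏ᶜ C` is a coproduct over
  -- choices of summands.
  have key : L (Z := A ⨯ ∏ᶜ C) prod.fst (fun i => prod.snd ≫ Pi.π C i) =
      R (Z := A ⨯ ∏ᶜ C) prod.fst (fun i => prod.snd ≫ Pi.π C i) := by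
    refine (hK.isTwoCoproduct_paramMap A hj).hom_ext fun x => ?_
    rw [hL, hR]
    have h₂ : (fun i => paramMap A (fun i => j i (x i)) ≫ prod.snd ≫ Pi.π C i) =
      fun i => (prod.snd ≫ Pi.π (fun i => Y i (x i)) i) ≫ j i (x i) :=
        funext fun i => paramMap_snd A _ i
    rw [h₂]
    exact h _ x _
  have := congrArg (prod.lift p (Pi.lift f) ≫ ·) key
  simp only [hL, hR] at this
  have h₁ : prod.lift p (Pi.lift f) ≫ prod.fst = p := prod.lift_fst _ _
  have h₂ : (fun i => prod.lift p (Pi.lift f) ≫ prod.snd ≫ Pi.π C i) = f := funext fun i => by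
    rw [prod.lift_snd_assoc, Pi.lift_π]
  rwa [h₁, h₂] at this

theorem comp_lift_param_comp {W Z A D : K} {k : ℕ} {X : Fin k → K} (g : W ⟶ Z) (p : Z ⟶ A)
    (f : ∀ i, Z ⟶ X i) (m : (A ⨯ ∏ᶜ X) ⟶ D) :
    g ≫ prod.lift p (Pi.lift f) ≫ m = prod.lift (g ≫ p) (Pi.lift fun i => g ≫ f i) ≫ m := by
  rw [← Strict.assoc]
  congr 1
  exact prod.hom_ext_param (by rw [Category.assoc, prod.lift_fst, prod.lift_fst]) fun i => by
    rw [Category.assoc, prod.lift_snd_assoc, prod.lift_snd_assoc, Pi.lift_π, Pi.lift_π]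

variable {P : Operad K} (hK : InfinitelyDistributive.{w} K) {X : KGraph.{w} K}
  {I : X.Obj → X.Obj → Type w} {Y : ∀ a b, I a b → K} {j : ∀ a b x, Y a b x ⟶ X.hom a b}
  (hj : ∀ a b, IsTwoCoproduct (Y a b) (X.hom a b) (j a b))
include hK hj

/-- Both sides of associativity are natural in the stage, so they may be compared on families of
elements of summands. -/
theorem act_mul_of_generators (act : ∀ {k : ℕ} {s t : Fin k → X.Obj} {a b : X.Obj},
      IsPath a b s t → ((P.obj k ⨯ ∏ᶜ fun i => X.hom (s i) (t i)) ⟶ X.hom a b))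
    {k : ℕ} (n : Fin k → ℕ) (S T : Fin k → X.Obj) (s t : Fin (∑ i, n i) → X.Obj) (a b : X.Obj)
    (H : IsPath a b S T)
    (h : ∀ i, IsPath (S i) (T i) (fun j => s (finSigmaFinEquiv ⟨i, j⟩))
      (fun j => t (finSigmaFinEquiv ⟨i, j⟩)))
    (h' : IsPath a b s t)
    (key : ∀ (Z : K) (p : Z ⟶ P.obj k) (q : ∀ i, Z ⟶ P.obj (n i)) (x : ∀ l, I (s l) (t l))
      (f : ∀ l, Z ⟶ Y _ _ (x l)),
      prod.lift (prod.lift p (Pi.lift q) ≫ P.mul n _ rfl) (Pi.lift fun l => f l ≫ j _ _ (x l)) ≫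
        act h' =
      prod.lift p (Pi.lift fun i =>
        prod.lift (q i) (Pi.lift fun i' => f (finSigmaFinEquiv ⟨i, i'⟩) ≫ j _ _ (x _)) ≫
          act (h i)) ≫ act H)
    (Z : K) (p : Z ⟶ P.obj k) (q : ∀ i, Z ⟶ P.obj (n i))
    (f : ∀ l, Z ⟶ X.hom (s l) (t l)) :
    prod.lift (prod.lift p (Pi.lift q) ≫ P.mul n _ rfl) (Pi.lift f) ≫ act h' =
      prod.lift p (Pi.lift fun i =>
        prod.lift (q i) (Pi.lift fun j => f (finSigmaFinEquiv ⟨i, j⟩)) ≫ act (h i)) ≫ act H := by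
  -- All operad arguments are gathered into one parameter `r`.
  have main := hK.eq_of_elements (A := P.obj k ⨯ ∏ᶜ fun i => P.obj (n i)) (fun l => hj (s l) (t l))
    (fun {Z} r f => prod.lift (r ≫ P.mul n _ rfl) (Pi.lift f) ≫ act h')
    (fun {Z} r f => prod.lift (r ≫ prod.fst) (Pi.lift fun i =>
        prod.lift (r ≫ prod.snd ≫ Pi.π _ i) (Pi.lift fun j => f (finSigmaFinEquiv ⟨i, j⟩)) ≫
          act (h i)) ≫ act H)
    (fun g r f => by rw [comp_lift_param_comp, Strict.assoc])
    (fun g r f => by simp only [comp_lift_param_comp, Strict.assoc])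
    (fun {Z} r x f => by
      have := key Z (r ≫ prod.fst) (fun i => r ≫ prod.snd ≫ Pi.π _ i) x f
      rwa [← prod.eq_lift_param r] at this)
    (prod.lift p (Pi.lift q)) f
  have e₁ : prod.lift p (Pi.lift q) ≫ prod.fst = p := prod.lift_fst _ _
  have e₂ (i) : prod.lift p (Pi.lift q) ≫ prod.snd ≫ Pi.π (fun i => P.obj (n i)) i = q i := by
    rw [prod.lift_snd_assoc, Pi.lift_π]
  simpa only [e₁, e₂] using main

end Generators

/-- The domain of each composition map is a coproduct of products of summands, so compatibility can
be tested after restriction to these. -/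
theorem KPCat.isFun_of_generators {K : Type u} [Bicategory.{w₂, v} K] [Strict K]
    [HasFiniteTwoProducts K] {P : Operad K} (hK : InfinitelyDistributive.{w} K)
    {X X' : KPCat.{w} P} {I : X.graph.Obj → X.graph.Obj → Type w} {Y : ∀ a b, I a b → K}
    {j : ∀ a b x, Y a b x ⟶ X.graph.hom a b}
    (hj : ∀ a b, IsTwoCoproduct (Y a b) (X.graph.hom a b) (j a b))
    {φ : CellHom X.graph X'.graph}
    (key : ∀ (Z : K) (k : ℕ) (p : Z ⟶ P.obj k) (s t : Fin k → X.graph.Obj)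
      (x : ∀ i, I (s i) (t i)) (f : ∀ i, Z ⟶ Y _ _ (x i)) (a b : X.graph.Obj)
      (h : IsPath a b s t),
      φ.elt (X.eltAct p (fun i => ⟨s i, t i, f i ≫ j _ _ (x i)⟩) h) =
        X'.cellAct p (fun i => φ.elt ⟨s i, t i, f i ≫ j _ _ (x i)⟩) (h.map φ.obj)) :
    IsFun X X' φ := by
  intro k s t a b h
  refine (hK.isTwoCoproduct_paramMap (P.obj k) fun i => hj (s i) (t i)).cell_ext fun x => ?_
  have := Edge.eq_of_mk_eq_mk (key _ k prod.fst s t x (fun i => prod.snd ≫ Pi.π _ i) a b h)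
  have e : paramMap (P.obj k) (fun i => j _ _ (x i)) = prod.lift prod.fst
      (Pi.lift fun i => (prod.snd ≫ Pi.π (fun i => Y (s i) (t i) (x i)) i) ≫ j _ _ (x i)) :=
    prod.hom_ext_param (by rw [prod.lift_fst, paramMap_fst]) fun i => by
      rw [prod.lift_snd_assoc, Pi.lift_π, paramMap_snd]
  rw [Cell.pre_pre]
  refine (congrArg (fun g => (φ.map a b).pre (g ≫ X.act h)) e).trans (this.trans ?_)
  rw [← Cell.post_pre, Cell.pre_param, Cell.pre_ofHom, paramMap_fst]
  congr 2
  funext i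
  rw [Cell.pre_pre, paramMap_snd]

/-! ### The free `(K, P)`-category on a graph -/

namespace KPCat

variable {K : Type u} [Bicategory.{w₂, v} K] [Strict K] [HasFiniteTwoProducts K]
  (hK : InfinitelyDistributive.{w} K) (P : Operad K) (X : KGraph.{w} K)

/-- The hom-objects of the free `(K, P)`-category. -/
noncomputable def freeHom (a b : X.Obj) : K :=
  (hK.exists_isTwoCoproduct (PathIn a b)
    (fun p => P.obj p.len ⨯ ∏ᶜ fun i => X.hom (p.src i) (p.tgt i))).choose

/-- The coproduct injections of the hom-objects of the free `(K, P)`-category. -/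
noncomputable def freeInj {a b : X.Obj} (p : PathIn a b) :
    (P.obj p.len ⨯ ∏ᶜ fun i => X.hom (p.src i) (p.tgt i)) ⟶ freeHom hK P X a b :=
  (hK.exists_isTwoCoproduct (PathIn a b)
    (fun p => P.obj p.len ⨯ ∏ᶜ fun i => X.hom (p.src i) (p.tgt i))).choose_spec.choose p

theorem isTwoCoproduct_freeInj (a b : X.Obj) :
    IsTwoCoproduct _ (freeHom hK P X a b) (freeInj hK P X) :=
  (hK.exists_isTwoCoproduct (PathIn a b)
    (fun p => P.obj p.len ⨯ ∏ᶜ fun i => X.hom (p.src i) (p.tgt i))).choose_spec.choose_spec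

/-- The graph underlying the free `(K, P)`-category. -/
noncomputable abbrev freeGraph : KGraph.{w} K := ⟨X.Obj, freeHom hK P X⟩

variable {P X} {Z : K} {N k : ℕ}

/-- The element of the free `(K, P)`-category given by a composable family of elements. -/
noncomputable abbrev freeElt (r : Z ⟶ P.obj N) (e : Fin N → X.Elt Z) {a b : X.Obj}
    (h : IsPath a b (fun i => (e i).src) (fun i => (e i).tgt)) : (freeGraph hK P X).Elt Z :=
  ⟨a, b, prod.lift r (Pi.lift fun i => (e i).hom) ≫ freeInj hK P X ⟨N, _, _, h⟩⟩

theorem freeElt_congr {r r' : Z ⟶ P.obj N} (hr : r = r') {e e' : Fin N → X.Elt Z} (he : e = e')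
    {a b : X.Obj} {h : IsPath a b (fun i => (e i).src) (fun i => (e i).tgt)}
    {h' : IsPath a b (fun i => (e' i).src) (fun i => (e' i).tgt)} :
    freeElt hK r e h = freeElt hK r' e' h' := by
  subst hr he; rfl

theorem freeElt_hom_congr {r r' : Z ⟶ P.obj N} (hr : r = r') {e e' : Fin N → X.Elt Z}
    (he : e = e') {a b : X.Obj} {h : IsPath a b (fun i => (e i).src) (fun i => (e i).tgt)}
    {h' : IsPath a b (fun i => (e' i).src) (fun i => (e' i).tgt)} :
    prod.lift r (Pi.lift fun i => (e i).hom) ≫ freeInj hK P X ⟨N, _, _, h⟩ =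
      prod.lift r' (Pi.lift fun i => (e' i).hom) ≫ freeInj hK P X ⟨N, _, _, h'⟩ := by
  subst hr he; rfl

theorem freeElt_pre {W : K} (g : W ⟶ Z) (r : Z ⟶ P.obj N) (e : Fin N → X.Elt Z) {a b : X.Obj}
    (h : IsPath a b (fun i => (e i).src) (fun i => (e i).tgt)) :
    (freeElt hK r e h).pre g = freeElt hK (g ≫ r) (fun i => (e i).pre g) h :=
  congrArg (Edge.mk (X := freeGraph hK P X) (E := fun c => W ⟶ c) a b)
    (comp_lift_param_comp g r (fun i => (e i).hom) (freeInj hK P X ⟨N, _, _, h⟩))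

/-- The elements of `X` given by an element of a summand of the free `(K, P)`-category. -/
noncomputable abbrev summandElt {a b : X.Obj} (p : PathIn a b)
    (g : Z ⟶ P.obj p.len ⨯ ∏ᶜ fun i => X.hom (p.src i) (p.tgt i)) (i : Fin p.len) : X.Elt Z :=
  ⟨p.src i, p.tgt i, g ≫ prod.snd ≫ Pi.π (fun i => X.hom (p.src i) (p.tgt i)) i⟩

theorem comp_freeInj {a b : X.Obj} (p : PathIn a b)
    (g : Z ⟶ P.obj p.len ⨯ ∏ᶜ fun i => X.hom (p.src i) (p.tgt i)) :
    g ≫ freeInj hK P X p = (freeElt hK (g ≫ prod.fst) (summandElt p g) p.isPath).hom :=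
  congrArg (· ≫ freeInj hK P X p) (prod.eq_lift_param g)

theorem freeInj_eq {a b : X.Obj} (p : PathIn a b) :
    freeInj hK P X p = (freeElt hK prod.fst
      (fun i => ⟨p.src i, p.tgt i, prod.snd ≫ Pi.π _ i⟩) p.isPath).hom := by
  have := comp_freeInj hK (P := P) p (𝟙 _)
  simpa only [Strict.id_comp] using this

/-- The elements of `X` from which the universal composite of elements of summands of the free
`(K, P)`-category is formed. -/
noncomputable abbrev factorElt (P : Operad K) {s t : Fin k → X.Obj} (x : ∀ i, PathIn (s i) (t i))
    (i : Fin k) (j : Fin (x i).len) : X.Elt (P.obj k ⨯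
      ∏ᶜ fun i => P.obj (x i).len ⨯ ∏ᶜ fun j => X.hom ((x i).src j) ((x i).tgt j)) :=
  ⟨(x i).src j, (x i).tgt j, prod.snd ≫
    Pi.π (fun i => P.obj (x i).len ⨯ ∏ᶜ fun j => X.hom ((x i).src j) ((x i).tgt j)) i ≫
      prod.snd ≫ Pi.π (fun j => X.hom ((x i).src j) ((x i).tgt j)) j⟩

/-- On the summand of a path of paths, the composite multiplies the operad parameters and
concatenates the edges. -/
theorem exists_freeAct {s t : Fin k → X.Obj} {a b : X.Obj} (h : IsPath a b s t) :
    ∃ m : (P.obj k ⨯ ∏ᶜ fun i => freeHom hK P X (s i) (t i)) ⟶ freeHom hK P X a b,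
      ∀ x : ∀ i, PathIn (s i) (t i), paramMap (P.obj k) (fun i => freeInj hK P X (x i)) ≫ m =
        (freeElt hK (prod.lift prod.fst (Pi.lift fun i => prod.snd ≫ Pi.π _ i ≫ prod.fst) ≫
            P.mul (fun i => (x i).len) _ rfl)
          (finConcat (fun i => (x i).len) rfl (factorElt P x))
          (h.concat (fun i => (x i).len) rfl fun i => (x i).isPath)).hom :=
  (hK.isTwoCoproduct_paramMap (P.obj k)
    fun i => isTwoCoproduct_freeInj hK P X (s i) (t i)).exists_desc _

/-- The composition maps of the free `(K, P)`-category. -/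
noncomputable def freeAct {s t : Fin k → X.Obj} {a b : X.Obj} (h : IsPath a b s t) :
    (P.obj k ⨯ ∏ᶜ fun i => freeHom hK P X (s i) (t i)) ⟶ freeHom hK P X a b :=
  (exists_freeAct hK h).choose

/-- The defining formula at an arbitrary stage. A free total length `N` allows the unit and
associativity laws to be stated without casts. -/
theorem freeAct_elt (n : Fin k → ℕ) (hN : ∑ i, n i = N) (p : Z ⟶ P.obj k)
    (r : ∀ i, Z ⟶ P.obj (n i)) (e : ∀ i, Fin (n i) → X.Elt Z) {S T : Fin k → X.Obj} {a b : X.Obj}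
    (h : ∀ i, IsPath (S i) (T i) (fun j => (e i j).src) (fun j => (e i j).tgt))
    (H : IsPath a b S T) :
    prod.lift p (Pi.lift fun i => (freeElt hK (r i) (e i) (h i)).hom) ≫ freeAct hK H =
      (freeElt hK (prod.lift p (Pi.lift r) ≫ P.mul n N hN) (finConcat n hN e)
        (H.concat n hN h)).hom := by
  subst hN
  have spec := (exists_freeAct hK (P := P) H).choose_spec (fun i => ⟨n i, _, _, h i⟩)
  -- The family factors through a single summand of the product of coproducts, where the composition
  -- map is known.
  have hg : prod.lift p (Pi.lift fun i => (freeElt hK (r i) (e i) (h i)).hom) =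
      prod.lift p (Pi.lift fun i => prod.lift (r i) (Pi.lift fun j => (e i j).hom)) ≫
        paramMap (P.obj k) (fun i => freeInj hK P X ⟨n i, _, _, h i⟩) :=
    prod.hom_ext_param (by rw [Category.assoc, paramMap_fst, prod.lift_fst, prod.lift_fst])
      fun i => by
        rw [Category.assoc, paramMap_snd, prod.lift_snd_assoc, Pi.lift_π, Category.assoc,
          prod.lift_snd_assoc, Pi.lift_π_assoc]
  rw [hg, Category.assoc]
  refine (congrArg _ spec).trans ?_
  have hpre := freeElt_pre hK
    (prod.lift p (Pi.lift fun i => prod.lift (r i) (Pi.lift fun j => (e i j).hom)))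
    (prod.lift prod.fst (Pi.lift fun i => prod.snd ≫ Pi.π _ i ≫ prod.fst) ≫ P.mul n _ rfl)
    (finConcat n rfl (factorElt P fun i => ⟨n i, _, _, h i⟩)) (H.concat n rfl h)
  have factor (i : Fin k) (j : Fin (n i)) :
      prod.lift p (Pi.lift fun i => prod.lift (r i) (Pi.lift fun j => (e i j).hom)) ≫
        (factorElt P (fun i => (⟨n i, _, _, h i⟩ : PathIn (S i) (T i))) i j).hom =
          (e i j).hom := by
    rw [prod.lift_snd_assoc, Pi.lift_π_assoc, prod.lift_snd_assoc, Pi.lift_π]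
  refine Edge.eq_of_mk_eq_mk (hpre.trans (freeElt_congr hK ?_ (funext fun l => ?_)))
  · rw [comp_lift_param_comp, prod.lift_fst]
    congr 3
    funext i
    rw [prod.lift_snd_assoc, Pi.lift_π_assoc, prod.lift_fst]
  · refine congrArg (Edge.mk _ _) ?_
    exact factor _ _

end KPCat

/-! ### Unit and associativity laws of the free category. -/

namespace KPCat

variable {K : Type u} [Bicategory.{w₂, v} K] [Strict K] [HasFiniteTwoProducts K]
  (hK : InfinitelyDistributive.{w} K) {P : Operad K} {X : KGraph.{w} K}

/-- By naturality take `f` to be the identity, then restrict to a summand: there it is the left unit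
law of the operad, together with the concatenation of a single path. -/
theorem freeAct_unit (a b : X.Obj) (h : IsPath a b (fun _ : Fin 1 => a) (fun _ : Fin 1 => b))
    (Z : K) (f : Z ⟶ freeHom hK P X a b) :
    prod.lift (terminal.from Z ≫ P.unit) (Pi.lift fun _ : Fin 1 => f) ≫ freeAct hK h = f := by
  have key : prod.lift (terminal.from _ ≫ P.unit)
      (Pi.lift fun _ : Fin 1 => 𝟙 (freeHom hK P X a b)) ≫ freeAct hK h = 𝟙 _ := by
    refine (isTwoCoproduct_freeInj hK P X a b).hom_ext fun p => ?_
    rw [comp_lift_param_comp, Strict.comp_id, freeInj_eq]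
    have := freeAct_elt hK (P := P) (N := p.len) (fun _ : Fin 1 => p.len) (by simp)
      ((freeElt hK prod.fst (fun i => ⟨p.src i, p.tgt i, prod.snd ≫ Pi.π _ i⟩) p.isPath).hom ≫
        terminal.from _ ≫ P.unit) (fun _ => prod.fst)
      (fun _ i => ⟨p.src i, p.tgt i, prod.snd ≫ Pi.π _ i⟩) (fun _ => p.isPath) h
    refine this.trans (freeElt_hom_congr hK ?_ (finConcat_single _ _))
    rw [← Category.assoc, terminal.comp_from]
    exact P.unit_mul _ _ _ _
  have := congrArg (f ≫ ·) key
  rw [comp_lift_param_comp, Strict.comp_id, ← Category.assoc f,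
    terminal.comp_from] at this
  exact this

theorem freeAct_summand {Z : K} {k : ℕ} {S T : Fin k → X.Obj} {a b : X.Obj} (H : IsPath a b S T)
    (x : ∀ i, PathIn (S i) (T i)) (p : Z ⟶ P.obj k)
    (f : ∀ i, Z ⟶ P.obj (x i).len ⨯ ∏ᶜ fun j => X.hom ((x i).src j) ((x i).tgt j)) :
    prod.lift p (Pi.lift fun i => f i ≫ freeInj hK P X (x i)) ≫ freeAct hK H =
      (freeElt hK (prod.lift p (Pi.lift fun i => f i ≫ prod.fst) ≫
          P.mul (fun i => (x i).len) _ rfl)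
        (finConcat (fun i => (x i).len) rfl fun i => summandElt (x i) (f i))
        (H.concat (fun i => (x i).len) rfl fun i => (x i).isPath)).hom :=
  (congrArg (fun g => prod.lift p (Pi.lift g) ≫ freeAct hK H)
    (funext fun i => comp_freeInj hK (x i) (f i))).trans
    (freeAct_elt hK (fun i => (x i).len) rfl p (fun i => f i ≫ prod.fst)
      (fun i => summandElt (x i) (f i)) (fun i => (x i).isPath) H)

/-- On summands, the two sides differ by associativity of the operad in the parameter and
associativity of concatenation in the edges. -/
theorem freeAct_mul {k : ℕ} (n : Fin k → ℕ) (S T : Fin k → X.Obj)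
    (s t : Fin (∑ i, n i) → X.Obj) (a b : X.Obj)
    (H : IsPath a b S T)
    (h : ∀ i, IsPath (S i) (T i) (fun j => s (finSigmaFinEquiv ⟨i, j⟩))
      (fun j => t (finSigmaFinEquiv ⟨i, j⟩)))
    (h' : IsPath a b s t)
    (Z : K) (p : Z ⟶ P.obj k) (q : ∀ i, Z ⟶ P.obj (n i))
    (f : ∀ l, Z ⟶ freeHom hK P X (s l) (t l)) :
    prod.lift (prod.lift p (Pi.lift q) ≫ P.mul n _ rfl) (Pi.lift f) ≫ freeAct hK h' =
      prod.lift p (Pi.lift fun i =>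
        prod.lift (q i) (Pi.lift fun j => f (finSigmaFinEquiv ⟨i, j⟩)) ≫ freeAct hK (h i)) ≫
          freeAct hK H := by
  refine act_mul_of_generators hK (X := freeGraph hK P X) (I := fun a b => PathIn a b)
    (Y := fun a b p => P.obj p.len ⨯ ∏ᶜ fun i => X.hom (p.src i) (p.tgt i))
    (j := fun a b p => freeInj hK P X p) (fun a b => isTwoCoproduct_freeInj hK P X a b)
    (fun h => freeAct hK (P := P) (X := X) h) n S T s t a b H h h' (fun Z p q x f => ?_) Z p q f
  have hN : ∑ i, ∑ j, (x (finSigmaFinEquiv ⟨i, j⟩)).len = ∑ l, (x l).len := by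
    rw [← finSigmaFinEquiv.sum_comp, Fintype.sum_sigma]
  refine (freeAct_summand hK h' x _ f).trans ?_
  refine Eq.trans ?_ (congrArg (fun g => prod.lift p (Pi.lift g) ≫ freeAct hK H)
    (funext fun i => freeAct_summand hK (h i) (fun j => x (finSigmaFinEquiv ⟨i, j⟩)) (q i)
      (fun j => f (finSigmaFinEquiv ⟨i, j⟩)))).symm
  refine Eq.trans ?_ (freeAct_elt hK
    (fun i => ∑ j, (x (finSigmaFinEquiv ⟨i, j⟩)).len) hN p
    (fun i => prod.lift (q i) (Pi.lift fun j => f (finSigmaFinEquiv ⟨i, j⟩) ≫ prod.fst) ≫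
      P.mul (fun j => (x (finSigmaFinEquiv ⟨i, j⟩)).len) _ rfl)
    (fun i => finConcat (fun j => (x (finSigmaFinEquiv ⟨i, j⟩)).len) rfl
      fun j => summandElt (x (finSigmaFinEquiv ⟨i, j⟩)) (f (finSigmaFinEquiv ⟨i, j⟩)))
    (fun i => (h i).concat (fun j => (x (finSigmaFinEquiv ⟨i, j⟩)).len) rfl
      fun j => (x (finSigmaFinEquiv ⟨i, j⟩)).isPath) H).symm
  exact freeElt_hom_congr hK (P.assoc n (fun l => (x l).len) _ rfl hN Z p q
      fun l => f l ≫ prod.fst)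
    (finConcat_finConcat n (fun l => (x l).len) rfl hN fun l => summandElt (x l) (f l))

end KPCat

/-! ### Universal property of the free category. -/

namespace KPCat

variable {K : Type u} [Bicategory.{w₂, v} K] [Strict K] [HasFiniteTwoProducts K]
  (hK : InfinitelyDistributive.{w} K) {P : Operad K} {X : KGraph.{w} K}

variable (P X) in
/-- The free `(K, P)`-category on a graph. -/
noncomputable abbrev free : KPCat.{w} P where
  graph := freeGraph hK P X
  act h := freeAct hK (P := P) (X := X) h
  act_unit := freeAct_unit hK (P := P) (X := X)
  act_mul := freeAct_mul hK (P := P) (X := X)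

variable (P X) in
/-- The inclusion of a graph in the free `(K, P)`-category on it. -/
noncomputable abbrev freeUnit : X ⟶ (free hK P X).graph :=
  KGraph.Hom.mk (Y := freeGraph hK P X) (fun a => a) fun a b =>
    (freeElt hK (terminal.from _ ≫ P.unit) (fun _ : Fin 1 => ⟨a, b, 𝟙 (X.hom a b)⟩)
      (IsPath.single a b)).hom

variable {Z : K} {N : ℕ}

theorem freeUnit_elt (e : X.Elt Z) : Hom.elt (freeUnit hK P X) e =
    freeElt hK (terminal.from Z ≫ P.unit) (fun _ : Fin 1 => e) (IsPath.single _ _) := by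
  have := freeElt_pre hK e.hom (terminal.from _ ≫ P.unit)
    (fun _ : Fin 1 => (⟨e.src, e.tgt, 𝟙 _⟩ : X.Elt _)) (IsPath.single _ _)
  refine Eq.trans this (freeElt_congr hK ?_ (funext fun _ => ?_))
  · rw [← Category.assoc, terminal.comp_from]
  · exact congrArg (Edge.mk _ _) (Strict.comp_id _)

/-- Every element of the free `(K, P)`-category is a composite of generators. -/
theorem freeElt_eq_eltAct (r : Z ⟶ P.obj N) (e : Fin N → X.Elt Z) {a b : X.Obj}
    (h : IsPath a b (fun i => (e i).src) (fun i => (e i).tgt)) :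
    freeElt hK r e h = (free hK P X).eltAct r (fun i => Hom.elt (freeUnit hK P X) (e i)) h := by
  have h₁ := freeAct_elt hK (P := P) (fun _ : Fin N => 1) (N := N) (by simp) r
    (fun _ => terminal.from Z ≫ P.unit) (fun i _ => e i) (fun i => IsPath.single _ _) h
  have h₂ : (free hK P X).eltAct r (fun i => Hom.elt (freeUnit hK P X) (e i)) h =
      (free hK P X).eltAct r (fun i => freeElt hK (terminal.from Z ≫ P.unit)
        (fun _ : Fin 1 => e i) (IsPath.single _ _)) h :=
    eltAct_congr rfl (funext fun i => freeUnit_elt hK (e i)) rfl rfl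
  rw [h₂]
  refine Eq.trans ?_ (congrArg (Edge.mk (X := freeGraph hK P X) (E := fun c => Z ⟶ c) a b) h₁).symm
  exact freeElt_congr hK (P.mul_unit _ _ _ _).symm (finConcat_singletons _ _).symm

variable {Y : KPCat.{w} P}

/-- The extension sends a formal composite of edges to the composite in `Y` of their images; since
`φ` is a packaged 2-cell, this covers 1-cells and 2-cells together. -/
theorem existsUnique_freeExtension (φ : CellHom X Y.graph) :
    ∃! ψ : CellHom (free hK P X).graph Y.graph,
      IsFun (free hK P X) Y ψ ∧ ψ.pre (freeUnit hK P X) = φ := by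
  obtain ⟨m, hm⟩ : ∃ m : ∀ a b, Cell (freeHom hK P X a b) (Y.graph.hom (φ.obj a) (φ.obj b)),
      ∀ {Z : K} {N : ℕ} (r : Z ⟶ P.obj N) (e : Fin N → X.Elt Z) {a b : X.Obj}
        (h : IsPath a b (fun i => (e i).src) (fun i => (e i).tgt)),
        (CellHom.mk (X := freeGraph hK P X) φ.obj m).elt (freeElt hK r e h) =
          Y.cellAct r (fun i => φ.elt (e i)) (h.map φ.obj) := by
    choose m hm using fun a b => (isTwoCoproduct_freeInj hK P X a b).exists_cellDesc
      (Z := Y.graph.hom (φ.obj a) (φ.obj b))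
      fun p => (Y.cellAct prod.fst (fun i => φ.elt ⟨p.src i, p.tgt i, prod.snd ≫ Pi.π _ i⟩)
        (p.isPath.map φ.obj)).hom
    refine ⟨m, fun {Z N} r e a b h => ?_⟩
    refine congrArg (Edge.mk (φ.obj a) (φ.obj b)) ?_
    rw [← Cell.pre_pre, hm, ← Cell.post_pre, Cell.pre_param, Cell.pre_ofHom, prod.lift_fst]
    congr 2
    funext i
    rw [Cell.pre_pre, prod.lift_snd_assoc, Pi.lift_π]
  refine ⟨⟨φ.obj, m⟩, ⟨?_, ?_⟩, ?_⟩
  -- On summands, composition is concatenation, so functoriality is associativity in `Y`.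
  · refine isFun_of_generators hK (X := free hK P X) (I := fun a b => PathIn a b)
      (Y := fun a b p => P.obj p.len ⨯ ∏ᶜ fun i => X.hom (p.src i) (p.tgt i))
      (j := fun a b p => freeInj hK P X p) (fun a b => isTwoCoproduct_freeInj hK P X a b)
      fun Z k p s t x f a b h => ?_
    have h₁ := congrArg (Edge.mk (X := freeGraph hK P X) (E := fun c => Z ⟶ c) a b)
      (freeAct_summand hK (X := X) h x p f)
    have h₂ (i : Fin k) := congrArg (Edge.mk (X := freeGraph hK P X) (E := fun c => Z ⟶ c) _ _)
      (comp_freeInj hK (X := X) (x i) (f i))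
    refine (congrArg (CellHom.elt _) h₁).trans ((hm _ _ _).trans ?_)
    refine (cellAct_mul (fun i => (x i).len) rfl p (fun i => f i ≫ prod.fst)
      (fun i j => φ.elt (summandElt (x i) (f i) j)) (fun i => (x i).isPath.map φ.obj)
      (h.map φ.obj) _).trans ?_
    exact cellAct_congr rfl (funext fun i =>
      ((congrArg (CellHom.elt _) (h₂ i)).trans (hm _ _ _)).symm) rfl rfl
  · refine CellHom.ext_elt fun a b => ?_
    refine (CellHom.pre_elt _ _ _).trans ?_
    refine (congrArg (CellHom.elt _) (freeUnit_elt hK _)).trans ((hm _ _ _).trans ?_)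
    exact cellAct_unit _ _
  · rintro ⟨f, m'⟩ ⟨h₁, h₂⟩
    obtain rfl : f = φ.obj := congrArg CellHom.obj h₂
    congr 1
    funext a b
    -- Each injection is a composite of generators, on which a compatible extension is prescribed.
    refine (isTwoCoproduct_freeInj hK P X a b).cell_ext fun p => ?_
    have key (e : X.Elt (P.obj p.len ⨯ ∏ᶜ fun i => X.hom (p.src i) (p.tgt i))) :
        (CellHom.mk (X := freeGraph hK P X) φ.obj m').elt (Hom.elt (freeUnit hK P X) e) =
          φ.elt e :=
      (CellHom.pre_elt _ _ _).symm.trans (congrArg (fun ψ => CellHom.elt ψ e) h₂)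
    have key' := congrArg (CellHom.elt (CellHom.mk (X := freeGraph hK P X) φ.obj m'))
      (freeElt_eq_eltAct hK (P := P) prod.fst (fun i => (⟨p.src i, p.tgt i, prod.snd ≫ Pi.π _ i⟩ :
        X.Elt (P.obj p.len ⨯ ∏ᶜ fun i => X.hom (p.src i) (p.tgt i)))) p.isPath)
    refine Edge.eq_of_mk_eq_mk (a := φ.obj a) (b := φ.obj b) ?_
    rw [freeInj_eq]
    refine Eq.trans ?_ (hm _ _ _).symm
    refine key'.trans ?_
    refine (isFun_iff_elt.1 h₁ _ _ _).trans ?_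
    exact cellAct_congr rfl (funext fun i => key _) rfl rfl

/-- The coproduct injections of the hom-objects of the free `(K, P)`-category are composites of
generators. -/
theorem paramMap_freeUnit_act {a b : X.Obj} (p : PathIn a b) :
    paramMap (P.obj p.len) (fun i => (freeUnit hK P X).map (p.src i) (p.tgt i)) ≫
      (free hK P X).act (p.isPath.map (freeUnit hK P X).obj) = freeInj hK P X p := by
  rw [freeInj_eq]
  refine Eq.trans ?_ (Edge.eq_of_mk_eq_mk (X := freeGraph hK P X)
    (E := fun c => (P.obj p.len ⨯ ∏ᶜ fun i => X.hom (p.src i) (p.tgt i)) ⟶ c) (a := a) (b := b)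
    (freeElt_eq_eltAct hK _ _ _)).symm
  congr 1
  exact prod.hom_ext_param (by rw [paramMap_fst, prod.lift_fst]) fun i => by
    rw [paramMap_snd, prod.lift_snd_assoc, Pi.lift_π]

end KPCat

/-! ### 2-adjunctions from universal arrows -/

section UniversalArrows

set_option linter.unusedSectionVars false

variable {B : Type u} [Bicategory.{w₂, v} B] [Strict B]
  {C : Type u'} [Bicategory.{w₂', v'} C] [Strict C]

/-- The action of a 2-functor on 2-cells. -/
def TwoCat.Cell.map (F : StrictPseudofunctor B C) {a b : B} (α : Cell a b) :
    Cell (F.obj a) (F.obj b) := ⟨F.map₂ α.cell⟩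

namespace TwoCat.Cell

variable (F : StrictPseudofunctor B C) {a b c : B}

theorem map_pre (f : a ⟶ b) (α : Cell b c) : (α.pre f).map F = (α.map F).pre (F.map f) :=
  mk_eq_mk (F.map_comp _ _) (F.map_comp _ _) (F.map₂_whiskerLeft_heq _ _)

theorem map_post (α : Cell a b) (f : b ⟶ c) : (α.post f).map F = (α.map F).post (F.map f) :=
  mk_eq_mk (F.map_comp _ _) (F.map_comp _ _) (F.map₂_whiskerRight_heq _ _)

theorem map_ofHom (f : a ⟶ b) : (ofHom f).map F = ofHom (F.map f) :=
  mk_eq_mk rfl rfl (heq_of_eq (F.map₂_id f))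

end TwoCat.Cell

/-- `η : X ⟶ U Y` is a 2-universal arrow from `X` to `U`. -/
def IsTwoUniversal (U : StrictPseudofunctor C B) {X : B} {Y : C} (η : X ⟶ U.obj Y) : Prop :=
  ∀ (Z : C) (α : Cell X (U.obj Z)), ∃! β : Cell Y Z, (β.map U).pre η = α

namespace IsTwoUniversal

variable {U : StrictPseudofunctor C B} {X : B} {Y : C} {η : X ⟶ U.obj Y} (h : IsTwoUniversal U η)
include h

theorem cell_ext {Z : C} {β β' : Cell Y Z} (e : (β.map U).pre η = (β'.map U).pre η) : β = β' :=
  (h Z _).unique e rfl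

theorem hom_ext {Z : C} {f g : Y ⟶ Z} (e : η ≫ U.map f = η ≫ U.map g) : f = g :=
  Cell.ofHom_injective (h.cell_ext (by
    rw [Cell.map_ofHom, Cell.map_ofHom, Cell.pre_ofHom, Cell.pre_ofHom, e]))

theorem existsUnique_hom {Z : C} (f : X ⟶ U.obj Z) : ∃! g : Y ⟶ Z, η ≫ U.map g = f := by
  obtain ⟨β, hβ, -⟩ := h Z (Cell.ofHom f)
  have : η ≫ U.map β.src = f := congrArg Cell.src hβ
  exact ⟨β.src, this, fun g hg => h.hom_ext (hg.trans this.symm)⟩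

/-- The 1-cell induced by a universal arrow. -/
noncomputable def desc {Z : C} (f : X ⟶ U.obj Z) : Y ⟶ Z := (h.existsUnique_hom f).choose

theorem fac {Z : C} (f : X ⟶ U.obj Z) : η ≫ U.map (h.desc f) = f :=
  (h.existsUnique_hom f).choose_spec.1

theorem exists_desc₂ {Z : C} {f g : X ⟶ U.obj Z} (α : f ⟶ g) :
    ∃ β : h.desc f ⟶ h.desc g, ((Cell.mk β).map U).pre η = Cell.mk α := by
  obtain ⟨β, hβ, -⟩ := h Z (Cell.mk α)
  have h₁ : β.src = h.desc f := h.hom_ext ((congrArg Cell.src hβ).trans (h.fac f).symm)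
  have h₂ : β.tgt = h.desc g := h.hom_ext ((congrArg Cell.tgt hβ).trans (h.fac g).symm)
  obtain ⟨β', rfl⟩ := β.exists_mk_eq h₁ h₂
  exact ⟨β', hβ⟩

/-- The 2-cell induced by a universal arrow. -/
noncomputable def desc₂ {Z : C} {f g : X ⟶ U.obj Z} (α : f ⟶ g) : h.desc f ⟶ h.desc g :=
  (h.exists_desc₂ α).choose

theorem fac₂ {Z : C} {f g : X ⟶ U.obj Z} (α : f ⟶ g) :
    ((Cell.mk (h.desc₂ α)).map U).pre η = Cell.mk α :=
  (h.exists_desc₂ α).choose_spec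

end IsTwoUniversal

variable {U : StrictPseudofunctor C B} (F : B → C) (η : ∀ X, X ⟶ U.obj (F X))
  (h : ∀ X, IsTwoUniversal U (η X))

namespace IsTwoUniversal

/-- The left adjoint determined by a family of universal arrows, on 1-cells. -/
noncomputable def adjMap {X Y : B} (f : X ⟶ Y) : F X ⟶ F Y := (h X).desc (f ≫ η Y)

/-- The left adjoint determined by a family of universal arrows, on 2-cells. -/
noncomputable def adjMap₂ {X Y : B} {f g : X ⟶ Y} (α : f ⟶ g) : adjMap F η h f ⟶ adjMap F η h g :=
  (h X).desc₂ (α ▷ η Y)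

theorem comp_adjMap {X Y : B} (f : X ⟶ Y) : η X ≫ U.map (adjMap F η h f) = f ≫ η Y := (h X).fac _

theorem pre_adjMap₂ {X Y : B} {f g : X ⟶ Y} (α : f ⟶ g) :
    ((Cell.mk (adjMap₂ F η h α)).map U).pre (η X) = (Cell.mk α).post (η Y) :=
  (h X).fac₂ _

/-- Here, as in the other laws of the left adjoint and of the counit, both sides agree after
restriction along the universal arrow. -/
theorem adjMap_id (X : B) : adjMap F η h (𝟙 X) = 𝟙 (F X) := (h X).hom_ext (by
  rw [comp_adjMap, U.map_id, Strict.comp_id, Strict.id_comp])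

theorem adjMap_comp {X Y Z : B} (f : X ⟶ Y) (g : Y ⟶ Z) :
    adjMap F η h (f ≫ g) = adjMap F η h f ≫ adjMap F η h g := (h X).hom_ext (by
  rw [comp_adjMap, U.map_comp, ← Strict.assoc, comp_adjMap, Strict.assoc f (η Y), comp_adjMap,
    Strict.assoc])

theorem adjMap₂_id {X Y : B} (f : X ⟶ Y) : adjMap₂ F η h (𝟙 f) = 𝟙 (adjMap F η h f) :=
  Cell.eq_of_mk_eq_mk ((h X).cell_ext (by
    rw [pre_adjMap₂]
    change (Cell.ofHom f).post (η Y) = ((Cell.ofHom _).map U).pre (η X)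
    rw [Cell.map_ofHom, Cell.pre_ofHom, Cell.post_ofHom, comp_adjMap]))

theorem adjMap₂_comp {X Y : B} {f g k : X ⟶ Y} (α : f ⟶ g) (β : g ⟶ k) :
    adjMap₂ F η h (α ≫ β) = adjMap₂ F η h α ≫ adjMap₂ F η h β :=
  Cell.eq_of_mk_eq_mk ((h X).cell_ext (by
    rw [pre_adjMap₂]
    refine Cell.mk_eq_mk (comp_adjMap F η h _).symm (comp_adjMap F η h _).symm ?_
    change HEq _ (η X ◁ U.map₂ (adjMap₂ F η h α ≫ adjMap₂ F η h β))
    rw [comp_whiskerRight, U.map₂_comp, whiskerLeft_comp]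
    exact TwoCat.comp_heq (comp_adjMap F η h _).symm (comp_adjMap F η h _).symm
      (comp_adjMap F η h _).symm
      (Cell.heq_of_mk_eq_mk (pre_adjMap₂ F η h α).symm)
      (Cell.heq_of_mk_eq_mk (pre_adjMap₂ F η h β).symm)))

theorem adjMap₂_whiskerLeft {X Y Z : B} (f : X ⟶ Y) {g k : Y ⟶ Z} (α : g ⟶ k) :
    Cell.mk (adjMap₂ F η h (f ◁ α)) = (Cell.mk (adjMap₂ F η h α)).pre (adjMap F η h f) :=
  (h X).cell_ext (by
    rw [pre_adjMap₂, Cell.map_pre, Cell.pre_pre, comp_adjMap, ← Cell.pre_pre, pre_adjMap₂]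
    exact Cell.post_pre _ (Cell.mk α) _)

theorem adjMap₂_whiskerRight {X Y Z : B} {f g : X ⟶ Y} (α : f ⟶ g) (k : Y ⟶ Z) :
    Cell.mk (adjMap₂ F η h (α ▷ k)) = (Cell.mk (adjMap₂ F η h α)).post (adjMap F η h k) :=
  (h X).cell_ext (by
    rw [pre_adjMap₂, Cell.map_post, ← Cell.post_pre, pre_adjMap₂, Cell.post_post, comp_adjMap,
      ← Cell.post_post]
    rfl)

/-- The left 2-adjoint determined by a family of universal arrows. -/
noncomputable def leftAdjoint : StrictPseudofunctor B C :=
  StrictPseudofunctor.mk''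
    { obj := F
      map := adjMap F η h
      map₂ := adjMap₂ F η h
      map_id := adjMap_id F η h
      map_comp := adjMap_comp F η h
      map₂_id := adjMap₂_id F η h
      map₂_comp := adjMap₂_comp F η h
      map₂_whisker_left := fun f _ _ α => Cell.eq_of_mk_eq_mk
        ((adjMap₂_whiskerLeft F η h f α).trans (Cell.mk_eqToHom_conj _ _ _).symm)
      map₂_whisker_right := fun α f => Cell.eq_of_mk_eq_mk
        ((adjMap₂_whiskerRight F η h α f).trans (Cell.mk_eqToHom_conj _ _ _).symm) }

/-- The counit of the 2-adjunction determined by a family of universal arrows. -/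
noncomputable def counit (Y : C) : F (U.obj Y) ⟶ Y := (h (U.obj Y)).desc (𝟙 _)

theorem comp_counit (Y : C) : η (U.obj Y) ≫ U.map (counit F η h Y) = 𝟙 _ := (h _).fac _

theorem counit_naturality {X Y : C} (f : X ⟶ Y) :
    adjMap F η h (U.map f) ≫ counit F η h Y = counit F η h X ≫ f := (h _).hom_ext (by
  rw [U.map_comp, U.map_comp, ← Strict.assoc, comp_adjMap, Strict.assoc, comp_counit,
    ← Strict.assoc, comp_counit, Strict.id_comp, Strict.comp_id])

theorem counit_naturality₂ {X Y : C} {f g : X ⟶ Y} (α : f ⟶ g) :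
    (Cell.mk (adjMap₂ F η h (U.map₂ α))).post (counit F η h Y) =
      (Cell.mk α).pre (counit F η h X) := (h _).cell_ext (by
  rw [Cell.map_post, Cell.map_pre, ← Cell.post_pre, pre_adjMap₂, Cell.post_post,
    Cell.pre_pre, comp_counit, comp_counit, Cell.post_id, Cell.pre_id]
  rfl)

theorem adjMap_comp_counit (X : B) :
    adjMap F η h (η X) ≫ counit F η h (F X) = 𝟙 (F X) := (h X).hom_ext (by
  rw [U.map_comp, ← Strict.assoc, comp_adjMap, Strict.assoc, comp_counit, U.map_id])

/-- The 2-adjunction determined by a family of universal arrows. -/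
noncomputable def adjunction : TwoAdjunction (leftAdjoint F η h) U where
  unit :=
    { app := η
      naturality := fun f => (comp_adjMap F η h f).symm
      naturality₂ := fun α => Cell.heq_of_mk_eq_mk (pre_adjMap₂ F η h α).symm }
  counit :=
    { app := counit F η h
      naturality := counit_naturality F η h
      naturality₂ := fun α => Cell.heq_of_mk_eq_mk (counit_naturality₂ F η h α) }
  left_triangle := adjMap_comp_counit F η h
  right_triangle := comp_counit F η h

end IsTwoUniversal

end UniversalArrows

/-! ### Monadicity of `(K, P)`-categories over graphs -/

theorem KGraph.Hom.elt_pre {K : Type u} [Bicategory.{w₂, v} K] [Strict K] {X Y : KGraph.{w} K}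
    (F : X ⟶ Y) {W Z : K} (g : W ⟶ Z) (e : X.Elt Z) :
    Hom.elt F (e.pre g) = (Hom.elt F e).pre g :=
  congrArg (Edge.mk _ _) (Strict.assoc _ _ _)

namespace KPCat

variable {K : Type u} [Bicategory.{w₂, v} K] [Strict K] [HasFiniteTwoProducts K] {P : Operad K}

/-- A 2-cell is compatible with composition if it is so after whiskering with a split
epimorphism. -/
theorem IsFun.of_section {X' X Y : KPCat.{w} P} {e : X'.graph ⟶ X.graph} (he : IsFunctor X' X e)
    {s : X.graph ⟶ X'.graph} (hs : s ≫ e = 𝟙 X.graph) {φ : CellHom X.graph Y.graph}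
    (h : IsFun X' Y (φ.pre e)) : IsFun X Y φ := by
  have hse {Z : K} (x : X.graph.Elt Z) : Hom.elt e (Hom.elt s x) = x := by
    rw [← Hom.elt_comp, hs, Hom.elt_id]
  have hobj (a : X.graph.Obj) : e.obj (s.obj a) = a := congrFun (congrArg Hom.obj hs) a
  rw [isFun_iff_elt]
  intro Z k p x a b hx
  -- Lift the factors along `s`, compose them in `X'` and push the result down along `e`.
  have h₁ := isFunctor_iff_elt.1 he p (fun i => Hom.elt s (x i)) (hx.map s.obj)
  have h₂ := isFun_iff_elt.1 h p (fun i => Hom.elt s (x i)) (hx.map s.obj)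
  rw [CellHom.pre_elt, h₁] at h₂
  have h₃ : X.eltAct p (fun i => Hom.elt e (Hom.elt s (x i))) ((hx.map s.obj).map e.obj) =
      X.eltAct p x hx := eltAct_congr rfl (funext fun i => hse (x i)) (hobj a) (hobj b)
  refine (congrArg φ.elt h₃).symm.trans (h₂.trans ?_)
  refine cellAct_congr rfl (funext fun i => ?_) (congrArg φ.obj (hobj a))
    (congrArg φ.obj (hobj b))
  exact (CellHom.pre_elt e φ _).trans (congrArg φ.elt (hse (x i)))

theorem IsFunctor.of_section {X' X Y : KPCat.{w} P} {e : X'.graph ⟶ X.graph}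
    (he : IsFunctor X' X e) {s : X.graph ⟶ X'.graph} (hs : s ≫ e = 𝟙 X.graph)
    {f : X.graph ⟶ Y.graph} (h : IsFunctor X' Y (e ≫ f)) : IsFunctor X Y f := by
  rw [isFunctor_iff] at h ⊢
  refine IsFun.of_section he hs ?_
  have := CellHom.ofCell_pre e (Cell.ofHom f)
  rw [Cell.pre_ofHom] at this
  exact this ▸ h

variable {F : StrictPseudofunctor (KGraph.{w} K) (KPCat.{w} P)}

variable (F) in
/-- The graph morphism underlying the image of a morphism under a 2-functor. -/
abbrev mapHom {A B : KGraph.{w} K} (f : A ⟶ B) : (F.obj A).graph ⟶ (F.obj B).graph :=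
  (F.map f).hom

variable (adj : TwoAdjunction F (forget P))

/-- A category is its graph together with its composition maps, which a functor that is the identity
on graphs forces to be equal. -/
theorem eq_of_isFunctor_id {X Y : KPCat.{w} P} (h : X.graph = Y.graph)
    (hf : IsFunctor X Y (eqToHom h)) : X = Y := by
  obtain ⟨G, act, _, _⟩ := X
  obtain ⟨G', act', _, _⟩ := Y
  obtain rfl : G = G' := h
  congr 1
  funext k s t a b hp
  have := hf hp
  refine (Strict.comp_id _).symm.trans (this.trans ?_)
  refine Eq.trans ?_ (Strict.id_comp _)
  exact congrArg (· ≫ act' hp) (paramMap_id (P.obj k) fun i => G.hom (s i) (t i))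

/-- The unit of an adjunction over graphs. -/
abbrev unitHom (A : KGraph.{w} K) : A ⟶ (F.obj A).graph := adj.unit.app A

/-- The graph morphism underlying the counit of an adjunction over graphs. -/
abbrev counitHom (X : KPCat.{w} P) : (F.obj X.graph).graph ⟶ X.graph := (adj.counit.app X).hom

theorem isFunctor_counitHom (X : KPCat.{w} P) : IsFunctor (F.obj X.graph) X (counitHom adj X) :=
  (adj.counit.app X).isHom

theorem unitHom_counitHom (X : KPCat.{w} P) : unitHom adj X.graph ≫ counitHom adj X = 𝟙 X.graph :=
  adj.right_triangle X

theorem unitHom_naturality {A B : KGraph.{w} K} (f : A ⟶ B) :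
    f ≫ unitHom adj B = unitHom adj A ≫ mapHom F f :=
  adj.unit.naturality f

/-- Restricted along the counit, `f` becomes a composite of functors; the counit has a section in
graphs, so `f` itself is a functor. -/
theorem isFunctor_of_algebraMap {X Y : KPCat.{w} P} {f : X.graph ⟶ Y.graph}
    (h : counitHom adj X ≫ f = mapHom F f ≫ counitHom adj Y) : IsFunctor X Y f := by
  refine IsFunctor.of_section (isFunctor_counitHom adj X) (unitHom_counitHom adj X) ?_
  rw [h]
  exact (iconStructure P).isHom_comp (X := F.obj X.graph) (Y := F.obj Y.graph) (Z := Y)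
    (F.map f).isHom (isFunctor_counitHom adj Y)

/-- Equality of the two algebras makes the identity of the graph an algebra map, hence a functor. -/
theorem comparison_obj_injective : Function.Injective adj.comparison.obj := by
  intro X Y h
  have hA : X.graph = Y.graph := congrArg TwoMonad.Algebra.A h
  have ha : HEq (counitHom adj X) (counitHom adj Y) := by
    have key {A B : adj.twoMonad.Algebra} (h : A = B) : HEq A.a B.a := by rw [h]
    exact key h
  refine eq_of_isFunctor_id hA (isFunctor_of_algebraMap adj ?_)
  have key {G G' : KGraph.{w} K} (e : G = G') (a : (F.obj G).graph ⟶ G)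
      (a' : (F.obj G').graph ⟶ G') (ha : HEq a a') :
      a ≫ eqToHom e = (F.map (eqToHom e)).hom ≫ a' := by
    subst e
    obtain rfl := eq_of_heq ha
    rw [eqToHom_refl, F.map_id]
    exact (Strict.comp_id _).trans (Strict.id_comp _).symm
  exact key hA _ _ ha

theorem comparison_map_bijective (X Y : KPCat.{w} P) :
    Function.Bijective (adj.comparison.map : (X ⟶ Y) → _) := by
  refine ⟨fun f g h => StructureOver.Hom.ext ?_, fun g => ?_⟩
  · exact congrArg (StructureOver.Hom.hom (S := adj.twoMonad.algebraStructure)) h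
  · exact ⟨⟨g.hom, isFunctor_of_algebraMap adj g.isHom⟩, rfl⟩

theorem isIcon_of_algebraCell {X Y : KPCat.{w} P} {f g : X.graph ⟶ Y.graph}
    (hf : IsFunctor X Y f) (hg : IsFunctor X Y g) {α : f ⟶ g}
    (h : (Cell.mk α).pre (counitHom adj X) = (Cell.mk (F.map₂ α).hom).post (counitHom adj Y)) :
    IsIcon X Y α := by
  refine (isFun_ofCell hf hg α).1 (IsFun.of_section (isFunctor_counitHom adj X)
    (unitHom_counitHom adj X) ?_)
  rw [← CellHom.ofCell_pre, h]
  exact isFun_cellHom ((Cell.mk (F.map₂ α)).post (adj.counit.app Y))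

theorem comparison_map₂_bijective {X Y : KPCat.{w} P} (f g : X ⟶ Y) :
    Function.Bijective (adj.comparison.map₂ : (f ⟶ g) → _) := by
  refine ⟨fun α β h => StructureOver.Hom₂.ext ?_, fun α => ?_⟩
  · exact congrArg (StructureOver.Hom₂.hom (S := adj.twoMonad.algebraStructure)) h
  · refine ⟨⟨α.hom, isIcon_of_algebraCell adj f.isHom g.isHom ?_⟩, rfl⟩
    exact Cell.mk_eq_mk (adj.comparison.map f).isHom (adj.comparison.map g).isHom α.isHom₂

variable {A : KGraph.{w} K} (a : (F.obj A).graph ⟶ A)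

/-- Compose the images of the `e i` under the unit of `F A`. The counit returns the composite of the
`e i`, whereas `F a` gives the composite of the images of the `a (e i)`; the algebra law identifies
the results after applying `a`. -/
theorem algebra_elt_act (ha : counitHom adj (F.obj A) ≫ a = mapHom F a ≫ a) {Z : K} {k : ℕ}
    (p : Z ⟶ P.obj k) (e : Fin k → (F.obj A).graph.Elt Z) {x y : (F.obj A).graph.Obj}
    (h : IsPath x y (fun i => (e i).src) (fun i => (e i).tgt)) :
    Hom.elt a ((F.obj A).eltAct p e h) =
      Hom.elt a ((F.obj A).eltAct p (fun i => Hom.elt (unitHom adj A) (Hom.elt a (e i)))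
        ((h.map a.obj).map (unitHom adj A).obj)) := by
  have hμ (z : (F.obj A).graph.Elt Z) :
      Hom.elt (counitHom adj (F.obj A)) (Hom.elt (unitHom adj (F.obj A).graph) z) = z := by
    rw [← Hom.elt_comp, unitHom_counitHom, Hom.elt_id]
  have hη (z : (F.obj A).graph.Elt Z) :
      Hom.elt (mapHom F a) (Hom.elt (unitHom adj (F.obj A).graph) z) =
        Hom.elt (unitHom adj A) (Hom.elt a z) :=
    (Hom.elt_comp (unitHom adj (F.obj A).graph) (mapHom F a) z).symm.trans
      ((congrArg (fun f => Hom.elt f z) (unitHom_naturality adj a)).symm.trans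
        (Hom.elt_comp _ _ _))
  have hobj (z : (F.obj A).graph.Obj) :
      (counitHom adj (F.obj A)).obj ((unitHom adj (F.obj A).graph).obj z) = z :=
    congrFun (congrArg Hom.obj (unitHom_counitHom adj (F.obj A))) z
  have hobj' (z : (F.obj A).graph.Obj) :
      (mapHom F a).obj ((unitHom adj (F.obj A).graph).obj z) = (unitHom adj A).obj (a.obj z) :=
    (congrFun (congrArg Hom.obj (unitHom_naturality adj a)) z).symm
  have h₁ := isFunctor_iff_elt.1 (isFunctor_counitHom adj (F.obj A)) p
    (fun i => Hom.elt (unitHom adj (F.obj A).graph) (e i)) (h.map (unitHom adj _).obj)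
  have h₂ := isFunctor_iff_elt.1 (F.map a).isHom p
    (fun i => Hom.elt (unitHom adj (F.obj A).graph) (e i)) (h.map (unitHom adj _).obj)
  have h₃ := Hom.elt_comp (counitHom adj (F.obj A)) a
    ((F.obj (F.obj A).graph).eltAct p (fun i => Hom.elt (unitHom adj (F.obj A).graph) (e i))
      (h.map (unitHom adj _).obj))
  rw [h₁, ha, Hom.elt_comp] at h₃
  refine Eq.trans (congrArg (Hom.elt a) ?_) (h₃.symm.trans (congrArg (Hom.elt a) (h₂.trans ?_)))
  · exact eltAct_congr rfl (funext fun i => (hμ (e i)).symm) (hobj x).symm (hobj y).symm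
  · exact eltAct_congr rfl (funext fun i => hη (e i)) (hobj' x) (hobj' y)

/-- The composition maps of an algebra for the induced 2-monad. -/
theorem exists_algebraAct (ha : unitHom adj A ≫ a = 𝟙 A) {k : ℕ} {s t : Fin k → A.Obj}
    {x y : A.Obj} (h : IsPath x y s t) :
    ∃ m : (P.obj k ⨯ ∏ᶜ fun i => A.hom (s i) (t i)) ⟶ A.hom x y,
      ∀ {Z : K} (p : Z ⟶ P.obj k) (f : ∀ i, Z ⟶ A.hom (s i) (t i)),
        (⟨x, y, prod.lift p (Pi.lift f) ≫ m⟩ : A.Elt Z) =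
          Hom.elt a ((F.obj A).eltAct p (fun i => Hom.elt (unitHom adj A) ⟨s i, t i, f i⟩)
            (h.map (unitHom adj A).obj)) := by
  have hobj (z : A.Obj) : a.obj ((unitHom adj A).obj z) = z := congrFun (congrArg Hom.obj ha) z
  obtain ⟨m, hm⟩ := Edge.exists_mk_eq (X := A)
    (E := fun c => (P.obj k ⨯ ∏ᶜ fun i => A.hom (s i) (t i)) ⟶ c) (a := x) (b := y)
    (Hom.elt a ((F.obj A).eltAct prod.fst (fun i => Hom.elt (unitHom adj A)
      ⟨s i, t i, prod.snd ≫ Pi.π _ i⟩) (h.map (unitHom adj A).obj))) (hobj x) (hobj y)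
  refine ⟨m, fun {Z} p f => ?_⟩
  refine (congrArg (Elt.pre (prod.lift p (Pi.lift f))) hm).trans ?_
  refine (Hom.elt_pre a _ _).symm.trans (congrArg (Hom.elt a) ?_)
  refine (eltAct_pre (prod.lift p (Pi.lift f)) _ _ _).trans (eltAct_congr (prod.lift_fst _ _)
    (funext fun i => congrArg (Edge.mk _ _) ?_) rfl rfl)
  refine (Strict.assoc _ _ _).symm.trans (congrArg (· ≫ _) ?_)
  exact (prod.lift_snd_assoc _ _ _).trans (Pi.lift_π _ _)

/-- The axioms are those of `F A` transported by `a`. Carrier and structure map are paired in a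
sigma type so that both can be substituted at once. -/
theorem exists_isFunctor_of_algebra (h₁ : unitHom adj A ≫ a = 𝟙 A)
    (h₂ : counitHom adj (F.obj A) ≫ a = mapHom F a ≫ a) :
    ∃ (X : KPCat.{w} P) (b : F.obj X.graph ⟶ X),
      (⟨X.graph, b.hom⟩ : Σ A, (F.obj A).graph ⟶ A) = ⟨A, a⟩ := by
  have hη {Z : K} (z : A.Elt Z) : Hom.elt a (Hom.elt (unitHom adj A) z) = z := by
    rw [← Hom.elt_comp, h₁, Hom.elt_id]
  have hobj (z : A.Obj) : a.obj ((unitHom adj A).obj z) = z := congrFun (congrArg Hom.obj h₁) z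
  choose m hm using @exists_algebraAct K _ _ _ P F adj A a h₁
  refine ⟨⟨A, @m, fun x y h Z f => ?_, ?_⟩, ⟨a, ?_⟩, rfl⟩
  · refine Edge.eq_of_mk_eq_mk (X := A) (E := fun c => Z ⟶ c) ?_
    refine (hm h _ fun _ => f).trans (Eq.trans (congrArg (Hom.elt a) ?_) (hη ⟨x, y, f⟩))
    exact congrArg (Edge.mk _ _) ((F.obj A).act_unit _ _ _ _ _)
  · intro k n S T s t x y H h h' Z p q f
    refine Edge.eq_of_mk_eq_mk (X := A) (E := fun c => Z ⟶ c) ?_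
    refine (hm h' _ f).trans (Eq.trans ?_ (hm H p _).symm)
    have h₃ := congrArg (Edge.mk (X := (F.obj A).graph) (E := fun c => Z ⟶ c) _ _)
      ((F.obj A).act_mul n _ _ _ _ _ _ (H.map (unitHom adj A).obj)
        (fun i => (h i).map (unitHom adj A).obj) (h'.map (unitHom adj A).obj) Z p q
        fun l => f l ≫ (unitHom adj A).map _ _)
    refine (congrArg (Hom.elt a) h₃).trans ?_
    -- Replaces each inner composite in `F A` by the unit applied to its value in `A`, as the
    -- definition of composition in `A` requires.
    refine (algebra_elt_act adj a h₂ p (fun i => (F.obj A).eltAct (q i)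
      (fun j => Hom.elt (unitHom adj A) ⟨_, _, f (finSigmaFinEquiv ⟨i, j⟩)⟩)
      ((h i).map (unitHom adj A).obj)) (H.map (unitHom adj A).obj)).trans ?_
    refine congrArg (Hom.elt a) (eltAct_congr rfl (funext fun i =>
      congrArg (Hom.elt (unitHom adj A)) (hm (h i) (q i) _).symm) ?_ ?_)
    · exact congrArg (unitHom adj A).obj (hobj x)
    · exact congrArg (unitHom adj A).obj (hobj y)
  · refine (isFunctor_iff_elt (X := F.obj A) (Y := KPCat.mk A @m _ _) (F := a)).2 ?_
    intro Z k p e x y h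
    exact (algebra_elt_act adj a h₂ p e h).trans (hm (h.map a.obj) p _).symm

/-- Naturality of the counit at `b`, restricted along `F` of the unit, has `b` on one side by a
triangle identity and the counit on the other by hypothesis. -/
theorem eq_counit {X : KPCat.{w} P} {b : F.obj X.graph ⟶ X}
    (h : unitHom adj X.graph ≫ b.hom = 𝟙 X.graph) : b = adj.counit.app X := by
  have h₁ : F.map b.hom ≫ adj.counit.app X = adj.counit.app (F.obj X.graph) ≫ b :=
    adj.counit.naturality b
  have h₂ : F.map (unitHom adj X.graph) ≫ F.map b.hom = 𝟙 (F.obj X.graph) :=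
    (F.map_comp _ _).symm.trans ((congrArg F.map h).trans (F.map_id _))
  have h₃ : F.map (unitHom adj X.graph) ≫ adj.counit.app (F.obj X.graph) = 𝟙 (F.obj X.graph) :=
    adj.left_triangle X.graph
  have h₄ := congrArg (F.map (unitHom adj X.graph) ≫ ·) h₁
  refine Eq.trans ?_ (Eq.trans h₄.symm ?_)
  · refine Eq.trans ?_ (Strict.assoc _ _ _)
    exact ((congrArg (· ≫ b) h₃).trans (Strict.id_comp _)).symm
  · refine (Strict.assoc _ _ _).symm.trans ?_
    exact (congrArg (· ≫ adj.counit.app X) h₂).trans (Strict.id_comp _)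

theorem comparison_obj_surjective : Function.Surjective adj.comparison.obj := by
  rintro ⟨A, a, h₁, h₂⟩
  obtain ⟨X, b, hb⟩ := exists_isFunctor_of_algebra adj a h₁ h₂
  obtain rfl : X.graph = A := congrArg Sigma.fst hb
  obtain rfl : b.hom = a := eq_of_heq (Sigma.mk.inj hb).2
  obtain rfl := eq_counit adj h₁
  exact ⟨X, rfl⟩

theorem isTwoIso_comparison : IsTwoIso adj.comparison where
  bijective_obj := ⟨comparison_obj_injective adj, comparison_obj_surjective adj⟩
  bijective_map := comparison_map_bijective adj
  bijective_map₂ := comparison_map₂_bijective adj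

section Free

variable (hK : InfinitelyDistributive.{w} K)

variable (P) in
theorem isTwoUniversal_freeUnit (X : KGraph.{w} K) :
    IsTwoUniversal (forget P) (Y := free hK P X) (freeUnit hK P X) := by
  intro Z α
  obtain ⟨ψ, ⟨hψ, hψα⟩, hu⟩ := existsUnique_freeExtension hK (P := P) (Y := Z)
    (CellHom.ofCell (X := X) (Y := Z.graph) α)
  obtain ⟨β, rfl⟩ := exists_cellHom_eq hψ
  have key (γ : Cell (free hK P X) Z) : CellHom.ofCell ((γ.map (forget P)).pre (freeUnit hK P X)) =
      (cellHom γ).pre (freeUnit hK P X) := CellHom.ofCell_pre _ _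
  refine ⟨β, CellHom.ofCell_injective ((key β).trans hψα), fun γ hγ => ?_⟩
  refine cellHom_injective (hu _ ⟨isFun_cellHom γ, (key γ).symm.trans ?_⟩)
  exact congrArg CellHom.ofCell hγ

variable (P) in
/-- The free-forgetful 2-adjunction. -/
noncomputable def freeAdjunction : TwoAdjunction
    (IsTwoUniversal.leftAdjoint (U := forget P) (free hK P) (freeUnit hK P) (isTwoUniversal_freeUnit P hK))
    (forget P) :=
  IsTwoUniversal.adjunction (U := forget P) (free hK P) (freeUnit hK P) (isTwoUniversal_freeUnit P hK)

variable (P) in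
theorem isFreeMonad_freeAdjunction : IsFreeMonad P (freeAdjunction P hK).twoMonad.toMonad := by
  let F := IsTwoUniversal.leftAdjoint (U := forget P) (free hK P) (freeUnit hK P)
    (isTwoUniversal_freeUnit P hK)
  let adj := freeAdjunction P hK
  let unit : 𝟭 (KGraph.{w} K) ⟶ F.toFunctor ⋙ (forget P).toFunctor :=
    { app := adj.unit.app, naturality := fun _ _ f => adj.unit.naturality f }
  let counit : (forget P).toFunctor ⋙ F.toFunctor ⟶ 𝟭 (KPCat.{w} P) :=
    { app := adj.counit.app, naturality := fun _ _ f => adj.counit.naturality f }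
  let adj' : F.toFunctor ⊣ (forget P).toFunctor :=
    { unit := unit
      counit := counit
      left_triangle_components := adj.left_triangle
      right_triangle_components := adj.right_triangle }
  refine ⟨F.toFunctor, adj', rfl, ?_⟩
  rintro X η rfl
  refine ⟨Function.bijective_id, fun a b => ?_⟩
  have h := isTwoCoproduct_freeInj hK P X a b
  rw [← funext (paramMap_freeUnit_act hK (P := P) (X := X) (a := a) (b := b))] at h
  exact h

end Free

end KPCat

/-! ### Products of `(K, P)`-categories -/

/-- Finite products are iterated binary products ending in a terminal object; only the single-cell
form of the universal property is needed. -/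
theorem HasFiniteTwoProducts.of_binary {B : Type u} [Bicategory.{w₂, v} B] [Strict B] {e : B}
    (he : ∀ Z : B, Nonempty (Unique (Cell Z e)))
    (hp : ∀ a b : B, ∃ (p : B) (π₁ : p ⟶ a) (π₂ : p ⟶ b), ∀ (Z : B) (α : Cell Z a) (β : Cell Z b),
      ∃! γ : Cell Z p, γ.post π₁ = α ∧ γ.post π₂ = β) : HasFiniteTwoProducts B := by
  refine ⟨fun n => ?_⟩
  induction n with
  | zero =>
    refine fun X => ⟨e, fun i => i.elim0, isTwoProduct_iff.2 fun Z α => ?_⟩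
    obtain ⟨_⟩ := he Z
    exact ⟨default, fun i => i.elim0, fun β _ => Unique.eq_default β⟩
  | succ n ih =>
    intro X
    obtain ⟨q, ρ, hq⟩ := ih fun i => X i.succ
    obtain ⟨p, π₁, π₂, h⟩ := hp (X 0) q
    refine ⟨p, fun i => Fin.cases (motive := fun i => p ⟶ X i) π₁ (fun i => π₂ ≫ ρ i) i,
      isTwoProduct_iff.2 fun Z α => ?_⟩
    obtain ⟨β, hβ⟩ := hq.exists_cellLift fun i => α i.succ
    obtain ⟨γ, ⟨h₁, h₂⟩, hu⟩ := h Z (α 0) β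
    refine ⟨γ, Fin.cases h₁ fun i => ?_, fun γ' h' => hu γ' ⟨h' 0, hq.cell_ext fun i => ?_⟩⟩
    · rw [Cell.post_post, hβ]
      exact h' i.succ
    · change γ.post (π₂ ≫ ρ i) = _
      rw [← Cell.post_post, h₂, hβ]

theorem KGraph.CellHom.map_eq_of_mk_eq_mk {K : Type u} [Bicategory.{w₂, v} K] {X Y : KGraph.{w} K}
    {f : X.Obj → Y.Obj} {m m' : ∀ a b, Cell (X.hom a b) (Y.hom (f a) (f b))}
    (h : CellHom.mk f m = CellHom.mk f m') (a b : X.Obj) : m a b = m' a b := by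
  injection h with _ h
  rw [h]

/-! ### Tuples under maps of products. -/

section

variable {K : Type u} [Bicategory.{w₂, v} K] [Strict K] [HasFiniteTwoProducts K]

theorem TwoCat.Cell.param_post_paramMap {A Z : K} {k : ℕ} {X Y : Fin k → K} (p : Cell Z A)
    (f : ∀ i, Cell Z (X i)) (F : ∀ i, X i ⟶ Y i) :
    (Cell.param p f).post (paramMap A F) = Cell.param p (fun i => (f i).post (F i)) := by
  apply Cell.param_ext
  · rw [Cell.post_post, paramMap_fst, Cell.param_fst, Cell.param_fst]
  · intro i
    rw [Cell.post_post, paramMap_snd, ← Cell.post_post, Cell.param_snd, Cell.param_snd]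

theorem lift_paramMap {A Z : K} {k : ℕ} {X Y : Fin k → K} (p : Z ⟶ A) (f : ∀ i, Z ⟶ X i)
    (F : ∀ i, X i ⟶ Y i) :
    prod.lift p (Pi.lift f) ≫ paramMap A F = prod.lift p (Pi.lift fun i => f i ≫ F i) :=
  prod.hom_ext_param
    (by rw [Category.assoc, paramMap_fst, prod.lift_fst, prod.lift_fst]) fun i => by
    rw [Category.assoc, paramMap_snd, prod.lift_snd_assoc, Pi.lift_π, Category.assoc,
      prod.lift_snd_assoc, Pi.lift_π_assoc]

end

namespace KPCat

variable {K : Type u} [Bicategory.{w₂, v} K] [Strict K] [HasFiniteTwoProducts K] {P : Operad K}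

section Binary

variable (A B : KPCat.{w} P)

/-- The product of two enriched graphs. -/
noncomputable abbrev _root_.KGraph.prod (A B : KGraph.{w} K) : KGraph.{w} K :=
  ⟨A.Obj × B.Obj, fun x y => A.hom x.1 y.1 ⨯ B.hom x.2 y.2⟩

/-- Composition in the product of two `(K, P)`-categories. -/
noncomputable abbrev prodAct {k : ℕ} {s t : Fin k → (A.graph.prod B.graph).Obj}
    {a b : (A.graph.prod B.graph).Obj} (h : IsPath a b s t) :
    (P.obj k ⨯ ∏ᶜ fun i => (A.graph.prod B.graph).hom (s i) (t i)) ⟶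
      (A.graph.prod B.graph).hom a b :=
  prod.lift (paramMap (P.obj k) (fun _ => prod.fst) ≫ A.act (h.map Prod.fst))
    (paramMap (P.obj k) (fun _ => prod.snd) ≫ B.act (h.map Prod.snd))

variable {A B}

theorem lift_prodAct_fst {k : ℕ} {s t : Fin k → (A.graph.prod B.graph).Obj}
    {a b : (A.graph.prod B.graph).Obj} (h : IsPath a b s t) {Z : K} (p : Z ⟶ P.obj k)
    (f : ∀ i, Z ⟶ (A.graph.prod B.graph).hom (s i) (t i)) :
    (prod.lift p (Pi.lift f) ≫ prodAct A B h) ≫ prod.fst =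
      prod.lift p (Pi.lift fun i => f i ≫ prod.fst) ≫ A.act (h.map Prod.fst) := by
  rw [Category.assoc, prod.lift_fst, ← Category.assoc, lift_paramMap]

theorem lift_prodAct_snd {k : ℕ} {s t : Fin k → (A.graph.prod B.graph).Obj}
    {a b : (A.graph.prod B.graph).Obj} (h : IsPath a b s t) {Z : K} (p : Z ⟶ P.obj k)
    (f : ∀ i, Z ⟶ (A.graph.prod B.graph).hom (s i) (t i)) :
    (prod.lift p (Pi.lift f) ≫ prodAct A B h) ≫ prod.snd =
      prod.lift p (Pi.lift fun i => f i ≫ prod.snd) ≫ B.act (h.map Prod.snd) := by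
  rw [Category.assoc, prod.lift_snd, ← Category.assoc, lift_paramMap]

variable (A B)

/-- The product of two `(K, P)`-categories. -/
noncomputable abbrev prodCat : KPCat.{w} P where
  graph := A.graph.prod B.graph
  act h := prodAct A B h
  act_unit a b h Z f := by
    apply prod.hom_ext
    · rw [lift_prodAct_fst]; exact A.act_unit _ _ _ _ _
    · rw [lift_prodAct_snd]; exact B.act_unit _ _ _ _ _
  act_mul n S T s t a b H h h' Z p q f := by
    apply prod.hom_ext
    · rw [lift_prodAct_fst, lift_prodAct_fst]
      simp only [lift_prodAct_fst]
      exact A.act_mul n _ _ _ _ _ _ _ (fun i => (h i).map Prod.fst) _ _ _ _ _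
    · rw [lift_prodAct_snd, lift_prodAct_snd]
      simp only [lift_prodAct_snd]
      exact B.act_mul n _ _ _ _ _ _ _ (fun i => (h i).map Prod.snd) _ _ _ _ _

/-- The first projection of a product of graphs. -/
noncomputable abbrev _root_.KGraph.prodFst (A B : KGraph.{w} K) : A.prod B ⟶ A :=
  KGraph.Hom.mk (X := A.prod B) Prod.fst fun _ _ => prod.fst

/-- The second projection of a product of graphs. -/
noncomputable abbrev _root_.KGraph.prodSnd (A B : KGraph.{w} K) : A.prod B ⟶ B :=
  KGraph.Hom.mk (X := A.prod B) Prod.snd fun _ _ => prod.snd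

/-- The first projection. -/
noncomputable def prodFst : prodCat A B ⟶ A :=
  StructureOver.Hom.mk (S := iconStructure P) (X := prodCat A B) (Y := A)
    (KGraph.prodFst A.graph B.graph) fun _ _ _ _ _ _ => prod.lift_fst _ _

/-- The second projection. -/
noncomputable def prodSnd : prodCat A B ⟶ B :=
  StructureOver.Hom.mk (S := iconStructure P) (X := prodCat A B) (Y := B)
    (KGraph.prodSnd A.graph B.graph) fun _ _ _ _ _ _ => prod.lift_snd _ _

variable {A B}

theorem cellHom_prod_ext {Z : KGraph.{w} K} {G H : KGraph.{w} K} {γ γ' : CellHom Z (G.prod H)}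
    (h₁ : γ.post (KGraph.prodFst G H) = γ'.post (KGraph.prodFst G H))
    (h₂ : γ.post (KGraph.prodSnd G H) = γ'.post (KGraph.prodSnd G H)) : γ = γ' := by
  obtain ⟨f, m⟩ := γ
  obtain ⟨f', m'⟩ := γ'
  obtain rfl : f = f' := funext fun a => Prod.ext (congrFun (congrArg CellHom.obj h₁) a)
    (congrFun (congrArg CellHom.obj h₂) a)
  congr 1
  funext a b
  exact Cell.prod_ext (CellHom.map_eq_of_mk_eq_mk h₁ a b) (CellHom.map_eq_of_mk_eq_mk h₂ a b)

/-- Pairing is done in each hom-object, and compatibility of the pair with composition is checked on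
the two projections. -/
theorem existsUnique_cell_prodCat (Z : KPCat.{w} P) (α : Cell Z A) (β : Cell Z B) :
    ∃! γ : Cell Z (prodCat A B), γ.post (prodFst A B) = α ∧ γ.post (prodSnd A B) = β := by
  have ext {γ γ' : Cell Z (prodCat A B)} (h₁ : γ.post (prodFst A B) = γ'.post (prodFst A B))
      (h₂ : γ.post (prodSnd A B) = γ'.post (prodSnd A B)) : γ = γ' := by
    refine cellHom_injective (cellHom_prod_ext ?_ ?_)
    · exact (cellHom_post γ (prodFst A B)).symm.trans
        ((congrArg cellHom h₁).trans (cellHom_post γ' (prodFst A B)))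
    · exact (cellHom_post γ (prodSnd A B)).symm.trans
        ((congrArg cellHom h₂).trans (cellHom_post γ' (prodSnd A B)))
  choose m hm₁ hm₂ using fun a b =>
    Cell.exists_prodLift ((cellHom α).map a b) ((cellHom β).map a b)
  have hφ : IsFun Z (prodCat A B)
      ⟨fun a => ((cellHom α).obj a, (cellHom β).obj a), m⟩ := by
    intro k s t a b h
    apply Cell.prod_ext
    · rw [Cell.post_pre, hm₁, Cell.post_post, prod.lift_fst, ← Cell.post_post,
        Cell.param_post_paramMap]
      refine (isFun_cellHom α h).trans (congrArg (fun f => (Cell.param _ f).post _) ?_)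
      funext i
      rw [Cell.post_pre, hm₁]
    · rw [Cell.post_pre, hm₂, Cell.post_post, prod.lift_snd, ← Cell.post_post,
        Cell.param_post_paramMap]
      refine (isFun_cellHom β h).trans (congrArg (fun f => (Cell.param _ f).post _) ?_)
      funext i
      rw [Cell.post_pre, hm₂]
  obtain ⟨γ, hγ⟩ := exists_cellHom_eq hφ
  have h₁ : γ.post (prodFst A B) = α := by
    refine cellHom_injective ((cellHom_post γ (prodFst A B)).trans ?_)
    rw [hγ]
    exact congrArg (CellHom.mk _) (funext fun a => funext fun b => hm₁ a b)
  have h₂ : γ.post (prodSnd A B) = β := by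
    refine cellHom_injective ((cellHom_post γ (prodSnd A B)).trans ?_)
    rw [hγ]
    exact congrArg (CellHom.mk _) (funext fun a => funext fun b => hm₂ a b)
  exact ⟨γ, ⟨h₁, h₂⟩, fun γ' h' => ext (h'.1.trans h₁.symm) (h'.2.trans h₂.symm)⟩

end Binary

variable (P) in
/-- The terminal `(K, P)`-category. -/
noncomputable abbrev terminalCat : KPCat.{w} P where
  graph := ⟨PUnit, fun _ _ => ⊤_ K⟩
  act _ := terminal.from _
  act_unit _ _ _ _ _ := terminal.hom_ext _ _
  act_mul _ _ _ _ _ _ _ _ _ _ _ _ _ _ := terminal.hom_ext _ _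

theorem unique_cell_terminalCat (Z : KPCat.{w} P) :
    Nonempty (Unique (Cell Z (terminalCat.{w} P))) := by
  choose m hm using fun c : K => Cell.existsUnique_terminal c
  have ext {c : K} (α β : Cell c (⊤_ K)) : α = β :=
    ((hm c).2 α trivial).trans ((hm c).2 β trivial).symm
  obtain ⟨γ, -⟩ := exists_cellHom_eq (X := Z) (Y := terminalCat.{w} P)
    (φ := ⟨fun _ => PUnit.unit, fun a b => m _⟩) fun _ _ _ _ _ _ => ext _ _
  refine ⟨⟨⟨γ⟩, fun γ' => cellHom_injective ?_⟩⟩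
  generalize cellHom γ' = φ
  generalize cellHom γ = ψ
  obtain ⟨f, m⟩ := φ
  obtain ⟨g, n⟩ := ψ
  obtain rfl : f = g := funext fun _ => PUnit.ext _ _
  exact congrArg _ (funext fun a => funext fun b => ext _ _)

instance : HasFiniteTwoProducts (KPCat.{w} P) :=
  HasFiniteTwoProducts.of_binary unique_cell_terminalCat fun A B =>
    ⟨prodCat A B, prodFst A B, prodSnd A B, existsUnique_cell_prodCat⟩

end KPCat

/-! ### Strict initial objects -/

/-- An object from which there is exactly one 2-cell to every object. -/
def IsTwoInitial {B : Type u} [Bicategory.{w₂, v} B] (z : B) : Prop :=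
  ∀ c : B, Nonempty (Unique (Cell z c))

namespace IsTwoInitial

variable {B : Type u} [Bicategory.{w₂, v} B]

theorem cell_eq {z c : B} (h : IsTwoInitial z) (α β : Cell z c) : α = β := by
  obtain ⟨_⟩ := h c
  exact Subsingleton.elim α β

theorem hom_eq {z c : B} (h : IsTwoInitial z) (f g : z ⟶ c) : f = g :=
  Cell.ofHom_injective (h.cell_eq _ _)

theorem nonempty_hom {z : B} (h : IsTwoInitial z) (c : B) : Nonempty (z ⟶ c) := by
  obtain ⟨_⟩ := h c
  exact ⟨(default : Cell z c).src⟩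

theorem of_isTwoCoproduct {X : PEmpty.{w + 1} → B} {z : B} {j : ∀ i, X i ⟶ z}
    (h : IsTwoCoproduct X z j) : IsTwoInitial z := fun c => by
  obtain ⟨β, -, hβ⟩ := isTwoCoproduct_iff.1 h c fun i => i.elim
  exact ⟨⟨⟨β⟩, fun γ => hβ γ fun i => i.elim⟩⟩

theorem isTwoCoproduct {X : PEmpty.{w + 1} → B} {z : B} {j : ∀ i, X i ⟶ z}
    (h : IsTwoInitial z) : IsTwoCoproduct X z j := isTwoCoproduct_iff.2 fun c α => by
  obtain ⟨_⟩ := h c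
  exact ⟨default, fun i => i.elim, fun β _ => h.cell_eq _ _⟩

variable {K : Type u} [Bicategory.{w₂, v} K] [Strict K] [HasFiniteTwoProducts K]
  (hK : InfinitelyDistributive.{w} K)
include hK

/-- Initial objects are strict. -/
theorem of_hom {z y : K} (h : IsTwoInitial z) (f : y ⟶ z) : IsTwoInitial y := fun c => by
  -- Distributivity over the empty coproduct makes `y ⨯ z` initial, and `f` exhibits `y` as a
  -- retract of it.
  have h' := of_isTwoCoproduct (hK.distrib y PEmpty PEmpty.elim z (fun i => i.elim)
    h.isTwoCoproduct)
  obtain ⟨g⟩ := h.nonempty_hom c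
  have key (β : Cell y c) : β = (β.pre prod.fst).pre (prod.lift (𝟙 y) f) := by
    rw [Cell.pre_pre, prod.lift_fst, Cell.pre_id]
  exact ⟨⟨⟨Cell.ofHom (f ≫ g)⟩, fun α => by
    exact (key α).trans ((congrArg _ (h'.cell_eq _ _)).trans (key _).symm)⟩⟩

end IsTwoInitial

theorem InfinitelyDistributive.exists_isTwoInitial {K : Type u} [Bicategory.{w₂, v} K] [Strict K]
    (hK : InfinitelyDistributive.{w} K) : ∃ z : K, IsTwoInitial z := by
  obtain ⟨z, _, h⟩ := hK.exists_isTwoCoproduct PEmpty PEmpty.elim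
  exact ⟨z, .of_isTwoCoproduct h⟩

/-! ### Disjoint sums of enriched graphs -/

namespace KGraph

variable {K : Type u} [Bicategory.{w₂, v} K]

theorem Edge.ext_of_isTwoInitial {X : KGraph.{w} K} {Z : K} (hZ : IsTwoInitial Z) {e e' : X.Elt Z}
    (hs : e.src = e'.src) (ht : e.tgt = e'.tgt) : e = e' := by
  obtain ⟨a, b, f⟩ := e
  obtain ⟨a', b', f'⟩ := e'
  subst hs ht
  exact congrArg (Edge.mk a b) (hZ.hom_eq _ _)

theorem CellElt.ext_of_isTwoInitial {X : KGraph.{w} K} {Z : K} (hZ : IsTwoInitial Z)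
    {e e' : X.CellElt Z} (hs : e.src = e'.src) (ht : e.tgt = e'.tgt) : e = e' := by
  obtain ⟨a, b, f⟩ := e
  obtain ⟨a', b', f'⟩ := e'
  subst hs ht
  exact congrArg (Edge.mk a b) (hZ.cell_eq _ _)

variable [Strict K]

/-- The graph `D` is the disjoint sum of the graphs `Y i`, with initial hom-objects between
different summands. -/
structure IsDisjointSum {ι : Type*} {Y : ι → KGraph.{w} K} {D : KGraph.{w} K}
    (j : ∀ i, Y i ⟶ D) : Prop where
  bijective : Function.Bijective fun x : Σ i, (Y i).Obj => (j x.1).obj x.2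
  isIso : ∀ i a b, IsIso ((j i).map a b)
  isTwoInitial : ∀ i i' a b, i ≠ i' → IsTwoInitial (D.hom ((j i).obj a) ((j i').obj b))

theorem exists_isDisjointSum (hz : ∃ z : K, IsTwoInitial z) {ι : Type w} (Y : ι → KGraph.{w} K) :
    ∃ (D : KGraph.{w} K) (j : ∀ i, Y i ⟶ D), IsDisjointSum j := by
  classical
  obtain ⟨z, hz⟩ := hz
  -- Within a summand the hom-object is the given one only up to a cast; the inclusions are
  -- therefore required to be isomorphisms on hom-objects, not identities.
  let D : KGraph.{w} K := ⟨Σ i, (Y i).Obj, fun x y =>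
    if h : x.1 = y.1 then (Y y.1).hom (h ▸ x.2) y.2 else z⟩
  have hD (i : ι) (a b : (Y i).Obj) : (Y i).hom a b = D.hom ⟨i, a⟩ ⟨i, b⟩ := by
    simp [D]
  let j (i : ι) : KGraph.Hom (Y i) D := ⟨fun a => ⟨i, a⟩, fun a b => eqToHom (hD i a b)⟩
  refine ⟨D, j, ?_, ?_, ?_⟩
  · exact Function.bijective_id
  · intro i a b
    exact inferInstanceAs (IsIso (eqToHom (hD i a b)))
  · intro i i' a b h
    have : D.hom ⟨i, a⟩ ⟨i', b⟩ = z := dif_neg h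
    exact this ▸ hz

namespace IsDisjointSum

variable {ι : Type*} {Y : ι → KGraph.{w} K} {D : KGraph.{w} K} {j : ∀ i, Y i ⟶ D}
  (h : IsDisjointSum j)
include h

theorem obj_injective (i : ι) : Function.Injective (j i).obj := fun a b e => by
  simpa using h.bijective.1 (a₁ := ⟨i, a⟩) (a₂ := ⟨i, b⟩) e

theorem index_eq {i i' : ι} {a : (Y i).Obj} {b : (Y i').Obj} (e : (j i).obj a = (j i').obj b) :
    i = i' :=
  congrArg Sigma.fst (h.bijective.1 (a₁ := ⟨i, a⟩) (a₂ := ⟨i', b⟩) e)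

/-- The summand containing an object. -/
noncomputable def index (u : D.Obj) : ι := (h.bijective.2 u).choose.1

theorem exists_obj_eq {u : D.Obj} {i : ι} (hu : h.index u = i) : ∃ a, (j i).obj a = u := by
  subst hu
  exact ⟨_, (h.bijective.2 u).choose_spec⟩

theorem elt_injective (i : ι) {W : K} : Function.Injective (Hom.elt (j i) : (Y i).Elt W → _) := by
  rintro ⟨a, b, f⟩ ⟨a', b', f'⟩ e
  obtain rfl := h.obj_injective i (congrArg Edge.src e)
  obtain rfl := h.obj_injective i (congrArg Edge.tgt e)
  have e' := Edge.eq_of_mk_eq_mk (X := D) (E := fun c => W ⟶ c) e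
  have := h.isIso i a b
  exact congrArg (Edge.mk a b) ((cancel_mono _).1 e')

theorem exists_elt_eq {W : K} (e : D.Elt W) {i : ι} (hs : h.index e.src = i)
    (ht : h.index e.tgt = i) : ∃ x : (Y i).Elt W, Hom.elt (j i) x = e := by
  obtain ⟨u, v, f⟩ := e
  obtain ⟨a, rfl⟩ := h.exists_obj_eq hs
  obtain ⟨b, rfl⟩ := h.exists_obj_eq ht
  have := h.isIso i a b
  refine ⟨⟨a, b, f ≫ inv ((j i).map a b)⟩, congrArg (Edge.mk _ _) ?_⟩
  rw [Category.assoc, IsIso.inv_hom_id, Category.comp_id]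

variable [HasFiniteTwoProducts K] (hK : InfinitelyDistributive.{w} K)
include hK

/-- An element joining different summands is a 1-cell into an initial object, and strictness would
make its stage initial. -/
theorem index_src_eq_index_tgt {W : K} (e : D.Elt W) (hW : ¬ IsTwoInitial W) :
    h.index e.src = h.index e.tgt := by
  obtain ⟨u, v, f⟩ := e
  by_contra hne
  refine hW ?_
  obtain ⟨a, ha⟩ := h.exists_obj_eq (u := u) rfl
  obtain ⟨b, hb⟩ := h.exists_obj_eq (u := v) rfl
  have := h.isTwoInitial _ _ a b hne
  rw [ha, hb] at this
  exact this.of_hom hK f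

/-- A path of elements of a disjoint sum lies in one of the summands, unless the stage of definition
is initial. -/
theorem exists_path {W : K} (hW : ¬ IsTwoInitial W) {k : ℕ} {e : Fin k → D.Elt W} {a b : D.Obj}
    (H : IsPath a b (fun i => (e i).src) (fun i => (e i).tgt)) :
    ∃ (i : ι) (x : Fin k → (Y i).Elt W) (a' b' : (Y i).Obj),
      IsPath a' b' (fun l => (x l).src) (fun l => (x l).tgt) ∧
      (e = fun l => Hom.elt (j i) (x l)) ∧ a = (j i).obj a' ∧ b = (j i).obj b' := by
  obtain ⟨hab, hst⟩ := H.congr_of_edges h.index fun l => h.index_src_eq_index_tgt hK (e l) hW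
  obtain ⟨a', rfl⟩ := h.exists_obj_eq hab
  obtain ⟨b', hb⟩ := h.exists_obj_eq (u := b) rfl
  choose x hx using fun l => h.exists_elt_eq (e l) (hst l).1 (hst l).2
  obtain rfl : (fun l => Hom.elt (j _) (x l)) = e := funext hx
  generalize h.index b = i at *
  subst hb
  exact ⟨i, x, a', b', H.reflect (h.obj_injective i), rfl, rfl, rfl⟩

/-- A path of paths of elements of a disjoint sum lies in one of the summands, unless the stage of
definition is initial. -/
theorem exists_path_of_paths {W : K} (hW : ¬ IsTwoInitial W) {k : ℕ} {n : Fin k → ℕ}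
    {e : Fin (∑ i, n i) → D.Elt W} {S T : Fin k → D.Obj} {a b : D.Obj} (H : IsPath a b S T)
    (H' : ∀ i, IsPath (S i) (T i) (fun l => (e (finSigmaFinEquiv ⟨i, l⟩)).src)
      (fun l => (e (finSigmaFinEquiv ⟨i, l⟩)).tgt)) :
    ∃ (i : ι) (x : Fin (∑ i, n i) → (Y i).Elt W) (S' T' : Fin k → (Y i).Obj) (a' b' : (Y i).Obj),
      IsPath a' b' S' T' ∧
      (∀ l, IsPath (S' l) (T' l) (fun l' => (x (finSigmaFinEquiv ⟨l, l'⟩)).src)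
        (fun l' => (x (finSigmaFinEquiv ⟨l, l'⟩)).tgt)) ∧
      (e = fun l => Hom.elt (j i) (x l)) ∧ (S = fun l => (j i).obj (S' l)) ∧
      (T = fun l => (j i).obj (T' l)) ∧ a = (j i).obj a' ∧ b = (j i).obj b' := by
  have hH' (i) := (H' i).congr_of_edges h.index
    fun l => h.index_src_eq_index_tgt hK (e (finSigmaFinEquiv ⟨i, l⟩)) hW
  obtain ⟨hab, hST⟩ := H.congr_of_edges h.index fun i => (hH' i).1
  have he (l) : h.index (e l).src = h.index b ∧ h.index (e l).tgt = h.index b := by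
    obtain ⟨⟨i, l⟩, rfl⟩ := finSigmaFinEquiv.surjective l
    exact ⟨((hH' i).2 l).1.trans (hST i).2, ((hH' i).2 l).2.trans (hST i).2⟩
  obtain ⟨a', rfl⟩ := h.exists_obj_eq hab
  obtain ⟨b', hb⟩ := h.exists_obj_eq (u := b) rfl
  choose x hx using fun l => h.exists_elt_eq (e l) (he l).1 (he l).2
  choose S' hS using fun l => h.exists_obj_eq (hST l).1
  choose T' hT using fun l => h.exists_obj_eq (hST l).2
  obtain rfl : (fun l => Hom.elt (j _) (x l)) = e := funext hx
  obtain rfl : (fun l => (j _).obj (S' l)) = S := funext hS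
  obtain rfl : (fun l => (j _).obj (T' l)) = T := funext hT
  generalize h.index b = i at *
  subst hb
  exact ⟨i, x, S', T', a', b', H.reflect (h.obj_injective i),
    fun l => (H' l).reflect (h.obj_injective i), rfl, rfl, rfl, rfl, rfl⟩

end IsDisjointSum

end KGraph

/-! ### Coproducts of `(K, P)`-categories -/

namespace KPCat

variable {K : Type u} [Bicategory.{w₂, v} K] [Strict K] [HasFiniteTwoProducts K] {P : Operad K}

theorem eltAct_unit {X : KPCat.{w} P} {Z : K} (e : Fin 1 → X.graph.Elt Z) {a b : X.graph.Obj}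
    (h : IsPath a b (fun i => (e i).src) (fun i => (e i).tgt)) :
    X.eltAct (terminal.from Z ≫ P.unit) e h = e 0 := by
  obtain ⟨e, rfl⟩ : ∃ e₀, e = fun _ => e₀ :=
    ⟨e 0, funext fun i => congrArg e (Subsingleton.elim i 0)⟩
  exact Elt.cell_injective ((eltAct_cell _ _ h).trans (cellAct_unit e.cell h))

section Sum

variable (hK : InfinitelyDistributive.{w} K) {ι : Type w}
include hK

section Existence

variable {Y : ι → KPCat.{w} P} {D : KGraph.{w} K} {j : ∀ i, (Y i).graph ⟶ D}
  (hj : IsDisjointSum j)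
include hj

/-- Unless the domain of the required map is initial, its universal composable family lies in one
summand and is composed there. -/
theorem exists_sumAct {k : ℕ} {s t : Fin k → D.Obj} {a b : D.Obj} (h : IsPath a b s t) :
    ∃ m : (P.obj k ⨯ ∏ᶜ fun l => D.hom (s l) (t l)) ⟶ D.hom a b,
      ∀ {W : K} (p : W ⟶ P.obj k) (e : ∀ l, W ⟶ D.hom (s l) (t l)) (i : ι)
        (x : Fin k → (Y i).graph.Elt W) (a' b' : (Y i).graph.Obj)
        (h' : IsPath a' b' (fun l => (x l).src) (fun l => (x l).tgt)),
        (∀ l, (⟨s l, t l, e l⟩ : D.Elt W) = Hom.elt (j i) (x l)) →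
        a = (j i).obj a' → b = (j i).obj b' →
        (⟨a, b, prod.lift p (Pi.lift e) ≫ m⟩ : D.Elt W) =
          Hom.elt (j i) ((Y i).eltAct p x h') := by
  by_cases hV : IsTwoInitial (P.obj k ⨯ ∏ᶜ fun l => D.hom (s l) (t l))
  · obtain ⟨m⟩ := hV.nonempty_hom (D.hom a b)
    exact ⟨m, fun p e i x a' b' h' _ ha hb =>
      Edge.ext_of_isTwoInitial (hV.of_hom hK (prod.lift p (Pi.lift e))) ha hb⟩
  · obtain ⟨i₀, x₀, a₀, b₀, h₀, hx₀, rfl, rfl⟩ := hj.exists_path hK hV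
      (e := fun l => ⟨s l, t l, prod.snd ≫ Pi.π _ l⟩) h
    obtain ⟨m, hm⟩ := Edge.exists_mk_eq (X := D)
      (E := fun c => (P.obj k ⨯ ∏ᶜ fun l => D.hom (s l) (t l)) ⟶ c)
      (Hom.elt (j i₀) ((Y i₀).eltAct prod.fst x₀ h₀)) rfl rfl
    refine ⟨m, fun {W} p e i x a' b' h' hx ha hb => ?_⟩
    -- Any other summand containing the family must be `i₀`, because the endpoint `a` determines it,
    -- even for an empty family.
    obtain rfl := hj.index_eq ha
    obtain rfl := hj.obj_injective _ ha
    obtain rfl := hj.obj_injective _ hb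
    refine (congrArg (Elt.pre (prod.lift p (Pi.lift e))) hm).trans ?_
    refine (Hom.elt_pre _ _ _).symm.trans (congrArg _ ?_)
    refine (eltAct_pre _ _ _ _).trans (eltAct_congr (prod.lift_fst _ _) (funext fun l => ?_) rfl rfl)
    refine hj.elt_injective _ ((Hom.elt_pre _ _ _).trans (Eq.trans ?_ (hx l)))
    refine (congrArg (Elt.pre (prod.lift p (Pi.lift e))) (congrFun hx₀ l)).symm.trans ?_
    refine congrArg (Edge.mk _ _) ?_
    exact (prod.lift_snd_assoc _ _ _).trans (Pi.lift_π _ _)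

/-- A disjoint sum of the graphs underlying `(K, P)`-categories is a `(K, P)`-category. -/
theorem exists_sum : ∃ X : KPCat.{w} P, ∃ e : D = X.graph,
    ∀ i, IsFunctor (Y i) X (j i ≫ eqToHom e) := by
  choose m hm using @exists_sumAct K _ _ _ P hK ι Y D j hj
  refine ⟨⟨D, @m, fun a b h Z f => ?_, ?_⟩, rfl, fun i => ?_⟩
  · refine Edge.eq_of_mk_eq_mk (X := D) (E := fun c => Z ⟶ c) ?_
    -- At an initial stage elements with equal endpoints are equal; otherwise the law is inherited
    -- from a single summand.
    by_cases hZ : IsTwoInitial Z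
    · exact Edge.ext_of_isTwoInitial hZ rfl rfl
    obtain ⟨i, x, a', b', h', hx, ha, hb⟩ := hj.exists_path hK hZ
      (e := fun _ : Fin 1 => ⟨a, b, f⟩) h
    refine (hm h _ (fun _ => f) i x a' b' h' (congrFun hx) ha hb).trans ?_
    exact (congrArg _ (eltAct_unit x h')).trans (congrFun hx 0).symm
  · intro k n S T s t a b H h h' Z p q f
    refine Edge.eq_of_mk_eq_mk (X := D) (E := fun c => Z ⟶ c) ?_
    by_cases hZ : IsTwoInitial Z
    · exact Edge.ext_of_isTwoInitial hZ rfl rfl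
    obtain ⟨i, x, S', T', a', b', H₁, h₁, hx, hS, hT, ha, hb⟩ := hj.exists_path_of_paths hK hZ
      (e := fun l => ⟨s l, t l, f l⟩) H h
    have hx' := congrFun hx
    have hs : s = fun l => (j i).obj (x l).src := funext fun l => congrArg Edge.src (hx' l)
    have ht : t = fun l => (j i).obj (x l).tgt := funext fun l => congrArg Edge.tgt (hx' l)
    have h₂ : IsPath a' b' (fun l => (x l).src) (fun l => (x l).tgt) := by
      rw [hs, ht, ha, hb] at h'
      exact h'.reflect (hj.obj_injective i)
    refine (hm h' _ f i x a' b' h₂ hx' ha hb).trans ?_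
    refine Eq.trans (congrArg (Hom.elt (j i)) (congrArg (Edge.mk _ _)
      ((Y i).act_mul n S' T' _ _ a' b' H₁ h₁ h₂ Z p q fun l => (x l).hom))) ?_
    refine (hm H p _ i (fun i' => (Y i).eltAct (q i') (fun l => x (finSigmaFinEquiv ⟨i', l⟩))
      (h₁ i')) a' b' H₁ (fun i' => ?_) ha hb).symm
    exact hm (h i') (q i') _ i _ _ _ (h₁ i') (fun l => hx' _) (congrFun hS i') (congrFun hT i')
  · rw [eqToHom_refl, Category.comp_id]
    refine (isFunctor_iff_elt (X := Y i) (Y := KPCat.mk D @m _ _) (F := j i)).2 ?_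
    intro Z k p e a b h
    exact (hm (h.map (j i).obj) p _ i e a b h (fun _ => rfl) rfl rfl).symm

end Existence

/-- A disjoint sum of underlying graphs is a coproduct of `(K, P)`-categories. -/
theorem isTwoCoproduct_of_isDisjointSum {Y : ι → KPCat.{w} P} {D : KPCat.{w} P}
    {j : ∀ i, Y i ⟶ D} (hj : IsDisjointSum (fun i => (j i).hom)) : IsTwoCoproduct Y D j := by
  rw [isTwoCoproduct_iff]
  intro Z α
  have hcases {W : K} (e : D.graph.Elt W) : IsTwoInitial W ∨
      ∃ i, ∃ x : (Y i).graph.Elt W, e = Hom.elt (j i).hom x := by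
    by_cases hW : IsTwoInitial W
    · exact .inl hW
    · obtain ⟨x, hx⟩ := hj.exists_elt_eq e (hj.index_src_eq_index_tgt hK e hW) rfl
      exact .inr ⟨_, x, hx.symm⟩
  obtain ⟨o, ho⟩ : ∃ o : D.graph.Obj → Z.graph.Obj,
      ∀ i a, o ((j i).hom.obj a) = (cellHom (α i)).obj a := by
    let σ := Equiv.ofBijective _ hj.bijective
    refine ⟨fun u => (cellHom (α (σ.symm u).1)).obj (σ.symm u).2, fun i a => ?_⟩
    exact congrArg (fun x : Σ i, (Y i).graph.Obj => (cellHom (α x.1)).obj x.2)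
      (σ.symm_apply_apply ⟨i, a⟩)
  have hm (u v : D.graph.Obj) : ∃ m : Cell (D.graph.hom u v) (Z.graph.hom (o u) (o v)),
      ∀ {W : K} (g : W ⟶ D.graph.hom u v) (i : ι) (x : (Y i).graph.Elt W),
        (⟨u, v, g⟩ : D.graph.Elt W) = Hom.elt (j i).hom x →
        (⟨o u, o v, m.pre g⟩ : Z.graph.CellElt W) = (cellHom (α i)).elt x := by
    -- The universal element of the hom-object decides the case: either the hom-object is initial,
    -- or the element comes from a summand and the value of `α i` there is forced.
    rcases hcases ⟨u, v, 𝟙 _⟩ with hW | ⟨i, x, hx⟩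
    · obtain ⟨_⟩ := hW (Z.graph.hom (o u) (o v))
      refine ⟨default, fun g i x hx => CellElt.ext_of_isTwoInitial (hW.of_hom hK g) ?_ ?_⟩
      · exact (congrArg o (congrArg Edge.src hx)).trans (ho _ _)
      · exact (congrArg o (congrArg Edge.tgt hx)).trans (ho _ _)
    · obtain ⟨m, hm⟩ := Edge.exists_mk_eq (X := Z.graph)
        (E := fun c => Cell (D.graph.hom u v) c) (a := o u) (b := o v) ((cellHom (α i)).elt x)
        ((congrArg o (congrArg Edge.src hx)).trans (ho _ _)).symm
        ((congrArg o (congrArg Edge.tgt hx)).trans (ho _ _)).symm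
      refine ⟨m, fun {W} g i' x' hx' => ?_⟩
      obtain rfl := hj.index_eq
        ((congrArg Edge.src hx).symm.trans (congrArg Edge.src hx'))
      refine (congrArg (CellElt.pre g) hm).trans ((CellHom.elt_pre _ _ _).symm.trans ?_)
      refine congrArg (CellHom.elt _) (hj.elt_injective i ?_)
      refine (Hom.elt_pre _ _ _).trans ((congrArg (Elt.pre g) hx).symm.trans ?_)
      exact Eq.trans (congrArg (Edge.mk _ _) (Strict.comp_id _)) hx'
  choose m hm using hm
  have hφ {W : K} (i : ι) (x : (Y i).graph.Elt W) :
      (CellHom.mk o m).elt (Hom.elt (j i).hom x) = (cellHom (α i)).elt x := hm _ _ _ i x rfl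
  have hfun : IsFun D Z (CellHom.mk o m) := by
    refine isFun_iff_elt.2 fun W k p e a b h => ?_
    by_cases hW : IsTwoInitial W
    · exact CellElt.ext_of_isTwoInitial hW rfl rfl
    obtain ⟨i, x, a', b', h', rfl, rfl, rfl⟩ := hj.exists_path hK hW h
    refine (congrArg (CellHom.elt _) (isFunctor_iff_elt.1 (j i).isHom p x h')).symm.trans ?_
    refine (hφ i _).trans ((isFun_iff_elt.1 (isFun_cellHom (α i)) p x h').trans ?_)
    exact cellAct_congr rfl (funext fun l => (hφ i (x l)).symm) (ho i a').symm (ho i b').symm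
  obtain ⟨β, hβ⟩ := exists_cellHom_eq hfun
  have hβα (i : ι) : β.pre (j i) = α i := by
    refine cellHom_injective ((cellHom_pre (j i) β).trans ?_)
    rw [hβ]
    exact CellHom.ext_elt fun a b => (CellHom.pre_elt _ _ _).trans (hφ i _)
  refine ⟨β, hβα, fun β' hβ' => cellHom_injective (CellHom.ext_elt fun u v => ?_)⟩
  have key {W : K} (i : ι) (x : (Y i).graph.Elt W) :
      (cellHom β').elt (Hom.elt (j i).hom x) = (cellHom β).elt (Hom.elt (j i).hom x) := by
    refine (CellHom.pre_elt _ _ _).symm.trans (Eq.trans ?_ (CellHom.pre_elt _ _ _))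
    refine congrArg (fun φ => CellHom.elt φ x) ?_
    refine (cellHom_pre (j i) β').symm.trans (Eq.trans ?_ (cellHom_pre (j i) β))
    rw [hβ', hβα]
  have hobj (u : D.graph.Obj) : (cellHom β').obj u = (cellHom β).obj u := by
    obtain ⟨a, ha⟩ := hj.exists_obj_eq (u := u) rfl
    -- Agreement on objects is read off from the source of the identity element of an
    -- endo-hom-object.
    exact (congrArg _ ha).symm.trans
      ((congrArg Edge.src (key _ ⟨a, a, 𝟙 _⟩)).trans (congrArg _ ha))
  rcases hcases ⟨u, v, 𝟙 _⟩ with hW | ⟨i, x, hx⟩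
  · exact CellElt.ext_of_isTwoInitial hW (hobj u) (hobj v)
  · rw [hx]
    exact key i x

theorem exists_isDisjointSum (Y : ι → KPCat.{w} P) :
    ∃ (D : KPCat.{w} P) (j : ∀ i, Y i ⟶ D), IsDisjointSum (fun i => (j i).hom) := by
  obtain ⟨D, j, hj⟩ := KGraph.exists_isDisjointSum hK.exists_isTwoInitial fun i => (Y i).graph
  obtain ⟨X, rfl, hX⟩ := exists_sum hK hj
  simp only [eqToHom_refl, Category.comp_id] at hX
  exact ⟨X, fun i => ⟨j i, hX i⟩, hj⟩

end Sum

end KPCat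

/-! ### Distributivity for `(K, P)`-categories -/

theorem IsTwoCoproduct.exists_iso {B : Type u} [Bicategory.{w₂, v} B] [Strict B] {ι : Type*}
    {X : ι → B} {c c' : B} {j : ∀ i, X i ⟶ c} {j' : ∀ i, X i ⟶ c'} (h : IsTwoCoproduct X c j)
    (h' : IsTwoCoproduct X c' j') : ∃ e : c ≅ c', ∀ i, j i ≫ e.hom = j' i := by
  obtain ⟨f, hf⟩ := h.exists_desc j'
  obtain ⟨g, hg⟩ := h'.exists_desc j
  refine ⟨⟨f, g, h.hom_ext fun i => ?_, h'.hom_ext fun i => ?_⟩, hf⟩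
  · rw [← Category.assoc, hf, hg, Category.comp_id]
  · rw [← Category.assoc, hg, hf, Category.comp_id]

namespace KPCat

variable {K : Type u} [Bicategory.{w₂, v} K] [Strict K] [HasFiniteTwoProducts K] {P : Operad K}

/-- The graph morphism `1 × f`. -/
noncomputable abbrev _root_.KGraph.prodMap (A : KGraph.{w} K) {X Y : KGraph.{w} K} (f : X ⟶ Y) :
    A.prod X ⟶ A.prod Y :=
  KGraph.Hom.mk (X := A.prod X) (Y := A.prod Y) (fun a => (a.1, f.obj a.2))
    fun _ _ => prod.map (𝟙 _) (f.map _ _)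

theorem isFunctor_prodMap (A : KPCat.{w} P) {X Y : KPCat.{w} P} {f : X.graph ⟶ Y.graph}
    (hf : IsFunctor X Y f) :
    IsFunctor (prodCat A X) (prodCat A Y) (KGraph.prodMap A.graph f) := by
  intro k s t a b h
  apply prod.hom_ext
  · rw [Category.assoc, prod.map_fst, Category.comp_id, prod.lift_fst, Category.assoc,
      prod.lift_fst, ← Category.assoc, paramMap_comp]
    simp only [prod.map_fst, Category.comp_id]
  · rw [Category.assoc, prod.map_snd, ← Category.assoc, prod.lift_snd, Category.assoc,
      Category.assoc, prod.lift_snd, hf, ← Category.assoc, ← Category.assoc, paramMap_comp,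
      paramMap_comp]
    simp only [prod.map_snd]

/-- The functor `1 × f`. -/
noncomputable def prodMap (A : KPCat.{w} P) {X Y : KPCat.{w} P} (f : X ⟶ Y) :
    prodCat A X ⟶ prodCat A Y :=
  StructureOver.Hom.mk (S := iconStructure P) (X := prodCat A X) (Y := prodCat A Y)
    (KGraph.prodMap A.graph f.hom) (isFunctor_prodMap A f.isHom)

theorem prodMap_fst (A : KPCat.{w} P) {X Y : KPCat.{w} P} (f : X ⟶ Y) :
    prodMap A f ≫ prodFst A Y = prodFst A X :=
  StructureOver.Hom.ext (congrArg (KGraph.Hom.mk _) (funext fun _ => funext fun _ =>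
    (prod.map_fst _ _).trans (Category.comp_id _)))

theorem prodMap_snd (A : KPCat.{w} P) {X Y : KPCat.{w} P} (f : X ⟶ Y) :
    prodMap A f ≫ prodSnd A Y = prodSnd A X ≫ f :=
  StructureOver.Hom.ext (congrArg (KGraph.Hom.mk _) (funext fun _ => funext fun _ =>
    prod.map_snd _ _))

theorem prodCat_hom_ext {Z A B : KPCat.{w} P} {f g : Z ⟶ prodCat A B}
    (h₁ : f ≫ prodFst A B = g ≫ prodFst A B) (h₂ : f ≫ prodSnd A B = g ≫ prodSnd A B) : f = g :=
  Cell.ofHom_injective ((existsUnique_cell_prodCat Z (Cell.ofHom (g ≫ prodFst A B))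
    (Cell.ofHom (g ≫ prodSnd A B))).unique
    ⟨by rw [Cell.post_ofHom, h₁], by rw [Cell.post_ofHom, h₂]⟩
    ⟨Cell.post_ofHom _ _, Cell.post_ofHom _ _⟩)

/-- The statement of distributivity uses the chosen product, while the disjoint sum is computed in
the explicit one. -/
theorem exists_prodIso (A B : KPCat.{w} P) : ∃ e : (A ⨯ B) ≅ prodCat A B,
    e.hom ≫ prodFst A B = prod.fst ∧ e.hom ≫ prodSnd A B = prod.snd := by
  obtain ⟨γ, ⟨h₁, h₂⟩, -⟩ := existsUnique_cell_prodCat (A ⨯ B) (Cell.ofHom (prod.fst : (A ⨯ B) ⟶ A))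
    (Cell.ofHom (prod.snd : (A ⨯ B) ⟶ B))
  have h₁ : γ.src ≫ prodFst A B = prod.fst := congrArg Cell.src h₁
  have h₂ : γ.src ≫ prodSnd A B = prod.snd := congrArg Cell.src h₂
  refine ⟨⟨γ.src, prod.lift (prodFst A B) (prodSnd A B), ?_, ?_⟩, h₁, h₂⟩
  · apply prod.hom_ext
    · rw [Category.assoc, prod.lift_fst, h₁, Category.id_comp]
    · rw [Category.assoc, prod.lift_snd, h₂, Category.id_comp]
  · apply prodCat_hom_ext
    · rw [Category.assoc, h₁, prod.lift_fst, Category.id_comp]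
    · rw [Category.assoc, h₂, prod.lift_snd, Category.id_comp]

variable (hK : InfinitelyDistributive.{w} K)
include hK

/-- Across summands, the hom-object projects to an initial object, so it is initial by strictness.
-/
theorem _root_.KGraph.IsDisjointSum.prod (A : KGraph.{w} K) {ι : Type*} {Y : ι → KGraph.{w} K}
    {D : KGraph.{w} K} {j : ∀ i, Y i ⟶ D} (h : IsDisjointSum j) :
    IsDisjointSum fun i => KGraph.prodMap A (j i) := by
  refine ⟨⟨?_, ?_⟩, ?_, ?_⟩
  · rintro ⟨i, a, y⟩ ⟨i', a', y'⟩ e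
    obtain rfl : a = a' := congrArg Prod.fst e
    have e : (j i).obj y = (j i').obj y' := congrArg Prod.snd e
    obtain rfl := h.index_eq e
    obtain rfl := h.obj_injective _ e
    rfl
  · rintro ⟨a, u⟩
    obtain ⟨⟨i, y⟩, rfl⟩ := h.bijective.2 u
    exact ⟨⟨i, a, y⟩, rfl⟩
  · intro i a b
    have := h.isIso i a.2 b.2
    exact inferInstanceAs (IsIso (prod.map (𝟙 _) ((j i).map a.2 b.2)))
  · intro i i' a b hi
    exact (h.isTwoInitial i i' a.2 b.2 hi).of_hom hK prod.snd

theorem infinitelyDistributive : InfinitelyDistributive.{w} (KPCat.{w} P) where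
  exists_isTwoCoproduct ι X := by
    obtain ⟨D, j, hj⟩ := exists_isDisjointSum hK X
    exact ⟨D, j, isTwoCoproduct_of_isDisjointSum hK hj⟩
  distrib A ι X c l hl := by
    obtain ⟨D, j, hj⟩ := exists_isDisjointSum hK X
    -- An arbitrary coproduct is compared with the disjoint sum, for which distributivity is
    -- visible.
    obtain ⟨θ, hθ⟩ := hl.exists_iso (isTwoCoproduct_of_isDisjointSum hK hj)
    have hD : IsTwoCoproduct (fun i => prodCat A (X i)) (prodCat A D) fun i => prodMap A (j i) :=
      isTwoCoproduct_of_isDisjointSum hK (hj.prod hK A.graph)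
    choose u hu₁ hu₂ using fun i => exists_prodIso A (X i)
    obtain ⟨e, he₁, he₂⟩ := exists_prodIso A D
    refine hD.of_iso (Equiv.refl ι) u (prod.mapIso (Iso.refl A) θ ≪≫ e) fun i => ?_
    apply prodCat_hom_ext
    · simp only [Iso.trans_hom, prod.mapIso_hom, Category.assoc, he₁, prod.map_fst, Iso.refl_hom,
        Category.comp_id, prodMap_fst, Equiv.refl_apply, hu₁]
    · simp only [Iso.trans_hom, prod.mapIso_hom, Category.assoc, he₂, prod.map_snd,
        prod.map_snd_assoc, prodMap_snd, Equiv.refl_apply, reassoc_of% hu₂, hθ]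

end KPCat

theorem proposition1 {K : Type u} [Bicategory.{w₂, v} K] [Strict K] [HasFiniteTwoProducts K]
    (hK : InfinitelyDistributive.{w} K) (P : Operad K) :
    (∃ fc : TwoMonad (KGraph.{w} K),
      IsTwoMonadicVia (KPCat.forget.{w} P) fc ∧ KPCat.IsFreeMonad P fc.toMonad) ∧
    InfinitelyDistributive.{w} (KPCat.{w} P) := by
  exact ⟨⟨(KPCat.freeAdjunction P hK).twoMonad, ⟨_, KPCat.freeAdjunction P hK, rfl,
    KPCat.isTwoIso_comparison _⟩, KPCat.isFreeMonad_freeAdjunction P hK⟩,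
    KPCat.infinitelyDistributive hK⟩
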